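/- Work on a randomized real RAM: memory consists of arrays of natural numbers and of real numbers; the unit-cost operations are addition, truncated subtraction and comparison of natural numbers; $+,-,\times,/,\sqrt{\cdot},\log$ and comparison of real numbers; the constant $\pi$; conversion of a natural number to a real number (but no rounding of reals); memory access; drawing a standard Gaussian; and drawing a uniform element of $\{0,\dots,k-1\}$. For $f > 0$, $\widetilde O(f)$ stands for a bound $C\, f \log^{c}(2+f)$ with absolute constants $C, c$. There is a data structure for distance estimation in Euclidean space, that is, three fixed programs (creation, insertion, query), independent of all parameters, such that the following holds for all $d \ge 1$ and $\varepsilon, \delta \in (0, 1/2)$. Creation gets $d, \varepsilon, \delta$ as input and produces a structure with empty database; an insertion adds a given point $x \in \mathbb{R}^d$ to the database. With probability at least $1-\delta$ over the random draws made during creation, the structure is initialized correctly, which means: after any sequence of insertions and queries, chosen arbitrarily (so possibly adaptively, with knowledge of all previous answers and of the contents of the data structure), if the database is $x_1, \dots, x_n$, then for every query $q \in \mathbb{R}^d$, with probability at least $1 - \delta$ over the fresh random draws made in answering it, the output $d_1, \dots, d_n$ satisfies $$(1-\varepsilon)\,\|q - x_i\| \le d_i \le (1+\varepsilon)\,\|q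 - x_i\| \quad \text{for all } i = 1, \dots, n .$$ Furthermore, for every outcome of the random draws, a query on a database of $n$ points takes time $\widetilde O\big(\varepsilon^{-2}(n+d)\log(1/\delta)\big)$, adding a point takes time $\widetilde O\big(\varepsilon^{-2} d \log(1/\delta)\big)$, and constructing the data structure for $n$ points (creation followed by $n$ insertions) takes time $\widetilde O\big(\varepsilon^{-2}\max(n,1)\, d\,\log(1/\delta)\big)$. -/

import Mathlib

open MeasureTheory ProbabilityTheory

/-! ## A randomized real RAM

Memory consists of arrays of natural numbers and arrays of real numbers, addressed by an array
name (fixed in the program text) and a computed index.  The unit-cost operations are: addition,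
truncated subtraction and comparison of natural numbers; `+`, `-`, `*`, `/`, square root, logarithm
and comparison of reals; the embedding of naturals into reals (but no rounding of reals, and no
multiplication of naturals); drawing a standard Gaussian; drawing a uniform element of
`{0, ..., k - 1}`. -/

/-- The memory of the machine: `nat a i` and `real a i` are the cells with index `i` of the
natural-number array `a` and of the real array `a`. -/
structure Mem where
  nat : ℕ → ℕ → ℕ
  real : ℕ → ℕ → ℝ

/-- Overwrite one natural-number cell. -/
def Mem.setNat (M : Mem) (a i v : ℕ) : Mem :=
  { M with nat := fun b j => if b = a ∧ j = i then v else M.nat b j }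

/-- Overwrite one real cell. -/
noncomputable def Mem.setReal (M : Mem) (a i : ℕ) (v : ℝ) : Mem :=
  { M with real := fun b j => if b = a ∧ j = i then v else M.real b j }

/-- Expressions with natural-number values. -/
inductive NatExp where
  | const (k : ℕ)
  | get (a : ℕ) (i : NatExp)
  | add (e f : NatExp)
  | sub (e f : NatExp)

namespace NatExp

/-- The value of an expression. -/
def eval (M : Mem) : NatExp → ℕ
  | const k => k
  | get a i => M.nat a (i.eval M)
  | add e f => e.eval M + f.eval M
  | sub e f => e.eval M - f.eval M

/-- The number of elementary operations needed to evaluate an expression. -/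
def cost : NatExp → ℕ
  | const _ => 1
  | get _ i => i.cost + 1
  | add e f => e.cost + f.cost + 1
  | sub e f => e.cost + f.cost + 1

end NatExp

/-- Expressions with real values. -/
inductive RealExp where
  | pi
  | ofNat (e : NatExp)
  | get (a : ℕ) (i : NatExp)
  | add (e f : RealExp)
  | sub (e f : RealExp)
  | mul (e f : RealExp)
  | div (e f : RealExp)
  | sqrt (e : RealExp)
  | log (e : RealExp)

namespace RealExp

/-- The value of an expression. -/
noncomputable def eval (M : Mem) : RealExp → ℝ
  | pi => Real.pi
  | ofNat e => (e.eval M : ℝ)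
  | get a i => M.real a (i.eval M)
  | add e f => e.eval M + f.eval M
  | sub e f => e.eval M - f.eval M
  | mul e f => e.eval M * f.eval M
  | div e f => e.eval M / f.eval M
  | sqrt e => Real.sqrt (e.eval M)
  | log e => Real.log (e.eval M)

/-- The number of elementary operations needed to evaluate an expression. -/
def cost : RealExp → ℕ
  | pi => 1
  | ofNat e => e.cost + 1
  | get _ i => i.cost + 1
  | add e f => e.cost + f.cost + 1
  | sub e f => e.cost + f.cost + 1
  | mul e f => e.cost + f.cost + 1
  | div e f => e.cost + f.cost + 1
  | sqrt e => e.cost + 1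
  | log e => e.cost + 1

end RealExp

/-- Tests. -/
inductive Test where
  | natLt (e f : NatExp)
  | realLt (e f : RealExp)
  | not (b : Test)

namespace Test

/-- The truth of a test. -/
def holds (M : Mem) : Test → Prop
  | natLt e f => e.eval M < f.eval M
  | realLt e f => e.eval M < f.eval M
  | not b => ¬ b.holds M

/-- The number of elementary operations needed to evaluate a test. -/
def cost : Test → ℕ
  | natLt e f => e.cost + f.cost + 1
  | realLt e f => e.cost + f.cost + 1
  | not b => b.cost + 1

end Test

/-- Programs: assignments, random draws, sequencing, branching and unbounded loops.  The first two
arguments of `setNat`, `setReal`, `gauss`, `unif` are the target cell. -/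
inductive Prog where
  | skip
  | setNat (a : ℕ) (i : NatExp) (e : NatExp)
  | setReal (a : ℕ) (i : NatExp) (e : RealExp)
  | gauss (a : ℕ) (i : NatExp)
  | unif (a : ℕ) (i : NatExp) (k : NatExp)
  | seq (p q : Prog)
  | branch (b : Test) (p q : Prog)
  | loop (b : Test) (p : Prog)

/-- A random tape: each random draw of a program consumes the next entry `(g, u)` of the tape; a
Gaussian draw uses `g`, a uniform draw uses `u`. -/
abbrev Tape := ℕ → ℝ × ℝ

/-- The law of a random tape: the entries are i.i.d., and each entry consists of a standard Gaussian
and an independent uniform element of `[0, 1]`. -/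
noncomputable def tapeLaw : Measure Tape :=
  Measure.infinitePi fun _ : ℕ =>
    (gaussianReal 0 1).prod (volume.restrict (Set.Icc (0 : ℝ) 1))

/-- The law of a random tape is a probability measure. -/
instance tapeLaw_isProbabilityMeasure : IsProbabilityMeasure tapeLaw := by
  haveI : IsProbabilityMeasure (volume.restrict (Set.Icc (0 : ℝ) 1)) := by constructor; simp
  unfold tapeLaw
  infer_instance

/-- The element of `{0, ..., k - 1}` obtained from `u ∈ [0, 1]` (it is `0` if `k = 0`). -/
noncomputable def pick (u : ℝ) (k : ℕ) : ℕ := min ⌊u * k⌋₊ (k - 1)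

/-- `Exec ω p M s M' s' t`: with the random tape `ω`, the program `p`, started in memory `M` with
`s` entries of the tape consumed, halts after `t` steps in memory `M'` with `s'` entries of the tape
consumed. -/
inductive Exec (ω : Tape) : Prog → Mem → ℕ → Mem → ℕ → ℕ → Prop where
  | skip (M : Mem) (s : ℕ) : Exec ω .skip M s M s 1
  | setNat (a : ℕ) (i e : NatExp) (M : Mem) (s : ℕ) :
      Exec ω (.setNat a i e) M s (M.setNat a (i.eval M) (e.eval M)) s (i.cost + e.cost + 1)
  | setReal (a : ℕ) (i : NatExp) (e : RealExp) (M : Mem) (s : ℕ) :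
      Exec ω (.setReal a i e) M s (M.setReal a (i.eval M) (e.eval M)) s (i.cost + e.cost + 1)
  | gauss (a : ℕ) (i : NatExp) (M : Mem) (s : ℕ) :
      Exec ω (.gauss a i) M s (M.setReal a (i.eval M) (ω s).1) (s + 1) (i.cost + 1)
  | unif (a : ℕ) (i k : NatExp) (M : Mem) (s : ℕ) :
      Exec ω (.unif a i k) M s (M.setNat a (i.eval M) (pick (ω s).2 (k.eval M))) (s + 1)
        (i.cost + k.cost + 1)
  | seq {p q : Prog} {M₁ M₂ M₃ : Mem} {s₁ s₂ s₃ t t' : ℕ} :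
      Exec ω p M₁ s₁ M₂ s₂ t → Exec ω q M₂ s₂ M₃ s₃ t' →
      Exec ω (.seq p q) M₁ s₁ M₃ s₃ (t + t')
  | branch_pos {b : Test} {p : Prog} (q : Prog) {M M' : Mem} {s s' t : ℕ} :
      b.holds M → Exec ω p M s M' s' t → Exec ω (.branch b p q) M s M' s' (b.cost + 1 + t)
  | branch_neg {b : Test} (p : Prog) {q : Prog} {M M' : Mem} {s s' t : ℕ} :
      ¬ b.holds M → Exec ω q M s M' s' t → Exec ω (.branch b p q) M s M' s' (b.cost + 1 + t)
  | loop_done {b : Test} (p : Prog) {M : Mem} (s : ℕ) :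
      ¬ b.holds M → Exec ω (.loop b p) M s M s (b.cost + 1)
  | loop_step {b : Test} {p : Prog} {M₁ M₂ M₃ : Mem} {s₁ s₂ s₃ t t' : ℕ} :
      b.holds M₁ → Exec ω p M₁ s₁ M₂ s₂ t → Exec ω (.loop b p) M₂ s₂ M₃ s₃ t' →
      Exec ω (.loop b p) M₁ s₁ M₃ s₃ (b.cost + 1 + t + t')

/-- A run is determined by the program, the memory it starts from and the random tape. -/
theorem Exec.det {ω : Tape} {p : Prog} {M M₁ : Mem} {s s₁ t₁ : ℕ} (h : Exec ω p M s M₁ s₁ t₁) :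
    ∀ {M₂ : Mem} {s₂ t₂ : ℕ}, Exec ω p M s M₂ s₂ t₂ → M₂ = M₁ ∧ s₂ = s₁ ∧ t₂ = t₁ := by
  induction h with
  | skip | setNat | setReal | gauss | unif => intro M₂ s₂ t₂ h'; cases h'; exact ⟨rfl, rfl, rfl⟩
  | seq _ _ ih ih' =>
    intro M₂ s₂ t₂ h'
    cases h' with
    | seq h₁ h₂ =>
      obtain ⟨rfl, rfl, rfl⟩ := ih h₁
      obtain ⟨rfl, rfl, rfl⟩ := ih' h₂
      exact ⟨rfl, rfl, rfl⟩
  | branch_pos q hb _ ih =>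
    intro M₂ s₂ t₂ h'
    cases h' with
    | branch_pos _ _ h₁ => obtain ⟨rfl, rfl, rfl⟩ := ih h₁; exact ⟨rfl, rfl, rfl⟩
    | branch_neg _ hb' _ => exact absurd hb hb'
  | branch_neg p hb _ ih =>
    intro M₂ s₂ t₂ h'
    cases h' with
    | branch_pos _ hb' _ => exact absurd hb' hb
    | branch_neg _ _ h₁ => obtain ⟨rfl, rfl, rfl⟩ := ih h₁; exact ⟨rfl, rfl, rfl⟩
  | loop_done p s hb =>
    intro M₂ s₂ t₂ h'
    cases h' with
    | loop_done _ _ _ => exact ⟨rfl, rfl, rfl⟩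
    | loop_step hb' _ _ => exact absurd hb' hb
  | loop_step hb _ _ ih ih' =>
    intro M₂ s₂ t₂ h'
    cases h' with
    | loop_done _ _ hb' => exact absurd hb hb'
    | loop_step _ h₁ h₂ =>
      obtain ⟨rfl, rfl, rfl⟩ := ih h₁
      obtain ⟨rfl, rfl, rfl⟩ := ih' h₂
      exact ⟨rfl, rfl, rfl⟩

/-- `p.Run ω M M' t`: with the fresh random tape `ω`, the program `p` started in memory `M` halts
after `t` steps in memory `M'`. -/
def Prog.Run (p : Prog) (ω : Tape) (M M' : Mem) (t : ℕ) : Prop :=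
  ∃ s : ℕ, Exec ω p M 0 M' s t

/-! ## Data structures for Euclidean distance estimation -/

/-- A data structure: a program that creates it with an empty database, a program that adds a point
to the database, and a program that answers a query. -/
structure DistanceDS where
  create : Prog
  insert : Prog
  query : Prog

/-- The memory in which `create` starts: `d` is cell `0` of the natural-number array `0`; `ε` and
`δ` are cells `0` and `1` of the real array `0`; everything else is zero. -/
noncomputable def inputMem (d : ℕ) (ε δ : ℝ) : Mem where
  nat a i := if a = 0 ∧ i = 0 then d else 0
  real a i := if a = 0 ∧ i = 0 then ε else if a = 0 ∧ i = 1 then δ else 0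

/-- Before a call of `insert` or `query`, its argument `x ∈ ℝ^d` is written to the cells
`0, ..., d - 1` of the real array `0`; all other cells keep the contents that the previous calls have left there. -/
noncomputable def Mem.load {d : ℕ} (M : Mem) (x : EuclideanSpace ℝ (Fin d)) : Mem :=
  { M with real := fun a i => if h : a = 0 ∧ i < d then x ⟨i, h.2⟩ else M.real a i }

/-- The real array `1` of `M` holds in its cells `0, ..., n - 1` estimates of the distances from `q`
to the points `x₁, ..., xₙ` of the list `X`, with relative error at most `ε`. -/
def Mem.Answers {d : ℕ} (M : Mem) (ε : ℝ) (X : List (EuclideanSpace ℝ (Fin d)))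
    (q : EuclideanSpace ℝ (Fin d)) : Prop :=
  ∀ i : Fin X.length,
    (1 - ε) * dist q (X.get i) ≤ M.real 1 i ∧ M.real 1 i ≤ (1 + ε) * dist q (X.get i)

namespace DistanceDS

/-- `A.Reachable d ε δ ω M X`: if the data structure is created with the random tape `ω`, then some
sequence of insertions and queries, with arbitrary arguments and arbitrary outcomes of the random
draws made during them, leads to the memory `M` and the database `X`. -/
inductive Reachable (A : DistanceDS) (d : ℕ) (ε δ : ℝ) (ω : Tape) :
    Mem → List (EuclideanSpace ℝ (Fin d)) → Prop where
  | create {M : Mem} {t : ℕ} :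
      A.create.Run ω (inputMem d ε δ) M t → Reachable A d ε δ ω M []
  | insert {M M' : Mem} {X : List (EuclideanSpace ℝ (Fin d))} {t : ℕ}
      (x : EuclideanSpace ℝ (Fin d)) (ω' : Tape) :
      Reachable A d ε δ ω M X → A.insert.Run ω' (M.load x) M' t →
      Reachable A d ε δ ω M' (X ++ [x])
  | query {M M' : Mem} {X : List (EuclideanSpace ℝ (Fin d))} {t : ℕ}
      (q : EuclideanSpace ℝ (Fin d)) (ω' : Tape) :
      Reachable A d ε δ ω M X → A.query.Run ω' (M.load q) M' t →
      Reachable A d ε δ ω M' X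

/-- `A.Constructs d ε δ M X t`: constructing the data structure for the points `X` (creating it and
inserting the points one after the other), for some outcomes of the random draws, takes `t` steps in
total and ends in memory `M`. -/
inductive Constructs (A : DistanceDS) (d : ℕ) (ε δ : ℝ) :
    Mem → List (EuclideanSpace ℝ (Fin d)) → ℕ → Prop where
  | create {M : Mem} {t : ℕ} (ω : Tape) :
      A.create.Run ω (inputMem d ε δ) M t → Constructs A d ε δ M [] t
  | insert {M M' : Mem} {X : List (EuclideanSpace ℝ (Fin d))} {t t' : ℕ}
      (x : EuclideanSpace ℝ (Fin d)) (ω : Tape) :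
      Constructs A d ε δ M X t → A.insert.Run ω (M.load x) M' t' →
      Constructs A d ε δ M' (X ++ [x]) (t + t')

end DistanceDS

/-- The bound `C f log^c (2 + f)`: a quantity is `Õ(f)` if it is at most `softO C c f` for some
absolute constants `C` and `c`. -/
noncomputable def softO (C : ℝ) (c : ℕ) (f : ℝ) : ℝ := C * f * Real.log (2 + f) ^ c

/-! Copy a vector `z` into `m` blocks of length `D = 2 ^ L ≥ d`, multiply all coordinates by
independent Gaussian seeds `g`, and apply a Walsh–Hadamard transform to each block. The squared
length of the image, divided by `D * m`, is a weighted sum of the `d` numbers `z k ^ 2`, each weight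
being a mean of `m` squared Gaussians (`sum_embed_sq`). Once these `d` means are within `ε / 8` of
1, the map is nearly a multiple of an isometry on all of `ℝ^d` simultaneously.

The length of the image can be read off from few random coordinates unless a few coordinates carry
too much of it. Because queries are adaptive, this too has to be excluded for all `z` at once. For a
fixed unit vector `z` the coordinates of the image are standard Gaussians, and the distance of the
image from a cube `[-T, T]^κ` is a Lipschitz function of the seeds, hence concentrated
(`measure_sum_excess_sq_ge_le`, by the Maurey–Pisier inequality). For a normalized sign vector with
`s` nonzero entries the squared Lipschitz constant is only `D / s`; so the failure probability can
be made to decay like `(4 * d) ^ (-s)`, which pays for a union bound over all sign vectors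
(`measure_not_goodSeeds_le`). Cutting a unit vector into dyadic levels exhibits it as `2 * (L + 1)`
times an average of vectors in convex hulls of sign vectors. The vectors with image close to the
cube form a convex set, so all unit vectors have images close to a slightly larger cube
(`mem_nearCube_of_sum_sq_le_one`).

For such seeds, the mean of `G` sampled squares, with `G` of order `ε⁻²` up to logarithms, misses
the squared length with probability at most `1 / 16`: Chebyshev's inequality applies to the squares
truncated at the cube, and the few large coordinates are rarely hit
(`measure_groupMean_not_mem_le`). An approximate median of `R` independent group means then fails
with probability at most `2 ^ (-R)`, and `2 ^ R ≥ n / δ` permits a union bound over the database. By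
linearity the image of `q - x` is the difference of the image of `q` and the stored image of `x`. A
query therefore embeds `q` once and afterwards spends about `R * G` steps on each point, which
depends on `d` only through logarithms.

The seeds do not change after creation and every query uses fresh samples, so good seeds withstand
every adaptive sequence of operations. What remains is to check programs for these computations,
with step counts, against a total-correctness calculus (`Prog.Wp`), and to estimate the counts. -/

section GaussianConcentration

/-! ### Gaussian concentration of smooth Lipschitz functions. -/

variable {E : Type*} [NormedAddCommGroup E] [InnerProductSpace ℝ E] [FiniteDimensional ℝ E]

/-- Bounding a difference of values by an average of exponentials of directional derivatives along
a quarter circle. -/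
theorem exp_sub_le_integral_exp_inner_gradient {F : E → ℝ} {G : E → E} (hG : Continuous G)
    (hF : ∀ x, HasGradientAt F (G x) x) (k : ℝ) (x y : E) :
    Real.exp (k * (F y - F x)) ≤ ∫ u in Set.Icc (0 : ℝ) 1,
      Real.exp (inner ℝ ((k * (Real.pi / 2)) •
        G (ContinuousLinearMap.rotation (Real.pi / 2 * u) (x, y)).1)
        (ContinuousLinearMap.rotation (Real.pi / 2 * u) (x, y)).2) := by
  have : IsProbabilityMeasure (volume.restrict (Set.Icc (0 : ℝ) 1)) := by constructor; simp
  simp only [ContinuousLinearMap.rotation_apply]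
  set c : ℝ → E := fun u => Real.cos (Real.pi / 2 * u) • x + Real.sin (Real.pi / 2 * u) • y with hc
  set c' : ℝ → E := fun u => -Real.sin (Real.pi / 2 * u) • x + Real.cos (Real.pi / 2 * u) • y
    with hc'
  have hcc : Continuous c := by fun_prop
  have hcc' : Continuous c' := by fun_prop
  have hd : ∀ u, HasDerivAt c ((Real.pi / 2) • c' u) u := by
    intro u
    have h1 : HasDerivAt (fun u : ℝ => Real.pi / 2 * u) (Real.pi / 2) u := by
      simpa using (hasDerivAt_id u).const_mul (Real.pi / 2)
    have h2 := (h1.cos.smul_const x).add (h1.sin.smul_const y)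
    refine h2.congr_deriv ?_
    simp only [hc', smul_add, smul_smul]
    congr 2 <;> ring
  have hcont : Continuous fun u => inner ℝ ((k * (Real.pi / 2)) • G (c u)) (c' u) := by fun_prop
  have hder : ∀ u, HasDerivAt (fun u => k * F (c u))
      (inner ℝ ((k * (Real.pi / 2)) • G (c u)) (c' u)) u := by
    intro u
    have h1 := ((hF (c u)).hasFDerivAt.comp_hasDerivAt u (hd u)).const_mul k
    refine h1.congr_deriv ?_
    simp [real_inner_smul_left]
    ring
  have hint : ∫ u in Set.Icc (0 : ℝ) 1, inner ℝ ((k * (Real.pi / 2)) • G (c u)) (c' u)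
      = k * (F y - F x) := by
    rw [integral_Icc_eq_integral_Ioc, ← intervalIntegral.integral_of_le zero_le_one,
      intervalIntegral.integral_eq_sub_of_hasDerivAt (fun u _ => hder u)
        (hcont.intervalIntegrable _ _)]
    simp [hc]
    ring
  rw [← hint]
  -- Jensen's inequality for the exponential and the uniform measure on `[0, 1]`.
  refine ConvexOn.map_integral_le convexOn_exp Real.continuous_exp.continuousOn isClosed_univ
    (by simp) ?_ ?_
  · exact hcont.continuousOn.integrableOn_compact isCompact_Icc
  · exact (Real.continuous_exp.comp hcont).continuousOn.integrableOn_compact isCompact_Icc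

variable [MeasurableSpace E] [BorelSpace E]

/-- The exponential moments of a linear functional of a standard Gaussian vector. -/
theorem lintegral_exp_inner_stdGaussian (v : E) :
    ∫⁻ y, ENNReal.ofReal (Real.exp (inner ℝ v y)) ∂(stdGaussian E)
      = ENNReal.ofReal (Real.exp (‖v‖ ^ 2 / 2)) := by
  have hmap : (stdGaussian E).map (innerSL ℝ v) = gaussianReal 0 (‖v‖₊ ^ 2) := by
    rw [IsGaussian.map_eq_gaussianReal (μ := stdGaussian E) (innerSL ℝ v)]
    congr 1
    · exact integral_strongDual_stdGaussian _
    · rw [variance_dual_stdGaussian]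
      exact NNReal.eq (by simp)
  have h1 := mgf_gaussianReal (p := stdGaussian E) (X := innerSL ℝ v) hmap 1
  have h2 : Integrable (fun y => Real.exp (inner ℝ v y)) (stdGaussian E) := by
    have h3 := (integrable_exp_mul_gaussianReal (μ := 0) (v := (‖v‖₊ ^ 2)) 1)
    rw [← hmap] at h3
    have h4 := h3.comp_measurable (by fun_prop : Measurable (innerSL ℝ v))
    simpa [Function.comp_def] using h4
  rw [← ofReal_integral_eq_lintegral_ofReal h2 (ae_of_all _ fun _ => (Real.exp_pos _).le)]
  congr 1
  simpa [mgf] using h1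

/-- The Maurey--Pisier inequality: the difference of a smooth Lipschitz function at two independent
standard Gaussian vectors is subgaussian. -/
theorem lintegral_exp_sub_le_of_hasGradientAt {F : E → ℝ} {G : E → E} (hG : Continuous G)
    (hF : ∀ x, HasGradientAt F (G x) x) {Λ : ℝ} (hΛ : ∀ x, ‖G x‖ ≤ Λ) (k : ℝ) :
    ∫⁻ p, ENNReal.ofReal (Real.exp (k * (F p.2 - F p.1))) ∂((stdGaussian E).prod (stdGaussian E))
      ≤ ENNReal.ofReal (Real.exp (k ^ 2 * Real.pi ^ 2 * Λ ^ 2 / 8)) := by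
  have : IsProbabilityMeasure (volume.restrict (Set.Icc (0 : ℝ) 1)) := by constructor; simp
  set μ := stdGaussian E
  set κ := k * (Real.pi / 2)
  let h : E × E → ENNReal := fun p => ENNReal.ofReal (Real.exp (inner ℝ (κ • G p.1) p.2))
  have hh : Measurable h := by
    apply ENNReal.measurable_ofReal.comp
    apply Real.measurable_exp.comp
    exact (by fun_prop : Continuous fun p : E × E => inner ℝ (κ • G p.1) p.2).measurable
  have hrot : Continuous fun q : (E × E) × ℝ =>
      ContinuousLinearMap.rotation (Real.pi / 2 * q.2) q.1 := by
    simp only [ContinuousLinearMap.rotation_apply]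
    fun_prop
  calc ∫⁻ p, ENNReal.ofReal (Real.exp (k * (F p.2 - F p.1))) ∂(μ.prod μ)
      ≤ ∫⁻ p, (∫⁻ u in Set.Icc (0 : ℝ) 1,
          h (ContinuousLinearMap.rotation (Real.pi / 2 * u) p)) ∂(μ.prod μ) := by
        refine lintegral_mono fun p => ?_
        refine (ENNReal.ofReal_le_ofReal
          (exp_sub_le_integral_exp_inner_gradient hG hF k p.1 p.2)).trans ?_
        rw [ofReal_integral_eq_lintegral_ofReal _ (ae_of_all _ fun _ => (Real.exp_pos _).le)]
        refine Continuous.integrableOn_Icc ?_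
        simp only [ContinuousLinearMap.rotation_apply]
        fun_prop
    _ = ∫⁻ u in Set.Icc (0 : ℝ) 1, (∫⁻ p,
          h (ContinuousLinearMap.rotation (Real.pi / 2 * u) p) ∂(μ.prod μ)) := by
        rw [lintegral_lintegral_swap]
        exact (hh.comp hrot.measurable).aemeasurable
    _ = ∫⁻ u in Set.Icc (0 : ℝ) 1, ∫⁻ p, h p ∂(μ.prod μ) := by
        -- A rotation preserves the law of a pair of independent standard Gaussian vectors, so the
        -- inner integral does not depend on `u`.
        refine lintegral_congr fun u => ?_
        rw [← lintegral_map hh (by fun_prop),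
          IsGaussian.map_rotation_eq_self (integral_id_stdGaussian (E := E))]
    _ = ∫⁻ p, h p ∂(μ.prod μ) := by simp
    _ = ∫⁻ x, ENNReal.ofReal (Real.exp (‖κ • G x‖ ^ 2 / 2)) ∂μ := by
        -- For a fixed first component the exponent is linear in the second, independent one.
        rw [lintegral_prod _ hh.aemeasurable]
        exact lintegral_congr fun x => lintegral_exp_inner_stdGaussian (κ • G x)
    _ ≤ ∫⁻ _, ENNReal.ofReal (Real.exp (k ^ 2 * Real.pi ^ 2 * Λ ^ 2 / 8)) ∂μ := by
        refine lintegral_mono fun x => ENNReal.ofReal_le_ofReal (Real.exp_le_exp.2 ?_)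
        have h1 : ‖G x‖ ^ 2 ≤ Λ ^ 2 := pow_le_pow_left₀ (norm_nonneg _) (hΛ x) 2
        rw [norm_smul, mul_pow, Real.norm_eq_abs, sq_abs]
        have : κ ^ 2 = k ^ 2 * Real.pi ^ 2 / 4 := by simp only [κ]; ring
        rw [this]
        nlinarith [mul_le_mul_of_nonneg_left h1 (by positivity : 0 ≤ k ^ 2 * Real.pi ^ 2 / 8)]
    _ = _ := by simp

/-- Deviation of a smooth Lipschitz function of a standard Gaussian vector above its root mean
square. -/
theorem measure_stdGaussian_ge_le {F : E → ℝ} {G : E → E} (hG : Continuous G)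
    (hF : ∀ x, HasGradientAt F (G x) x) {Λ : ℝ} (hΛ0 : 0 < Λ) (hΛ : ∀ x, ‖G x‖ ≤ Λ) {ρ t : ℝ}
    (hρ : 0 < ρ) (ht : 0 ≤ t)
    (hmean : ∫⁻ x, ENNReal.ofReal (F x ^ 2) ∂(stdGaussian E) ≤ ENNReal.ofReal (ρ ^ 2)) :
    stdGaussian E {x | 2 * ρ + t ≤ F x} ≤ ENNReal.ofReal (2 * Real.exp (-(t ^ 2 / (5 * Λ ^ 2)))) := by
  set μ := stdGaussian E
  have hFc : Continuous F := continuous_iff_continuousAt.2 fun x => (hF x).continuousAt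
  -- Markov's inequality for `F ^ 2`.
  have hB : μ {x | 2 * ρ < F x} ≤ ENNReal.ofReal (1 / 4) := by
    have h1 := mul_meas_ge_le_lintegral₀ (μ := μ) (f := fun x => ENNReal.ofReal (F x ^ 2))
      (by fun_prop) (ENNReal.ofReal (4 * ρ ^ 2))
    have h2 : ENNReal.ofReal (4 * ρ ^ 2) * μ {x | 2 * ρ < F x} ≤ ENNReal.ofReal (ρ ^ 2) := by
      refine le_trans (mul_le_mul_right (measure_mono fun x hx => ?_) _) (h1.trans hmean)
      refine ENNReal.ofReal_le_ofReal ?_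
      have : 2 * ρ < F x := hx
      nlinarith
    rw [mul_comm] at h2
    have h3 := ENNReal.le_div_iff_mul_le (a := μ {x | 2 * ρ < F x}) (b := ENNReal.ofReal (4 * ρ ^ 2))
      (c := ENNReal.ofReal (ρ ^ 2)) (Or.inl (ENNReal.ofReal_pos.2 (by positivity)).ne')
      (Or.inl ENNReal.ofReal_ne_top)
    refine (h3.2 h2).trans ?_
    rw [← ENNReal.ofReal_div_of_pos (by positivity)]
    refine ENNReal.ofReal_le_ofReal (le_of_eq ?_)
    field_simp
  have hA : ENNReal.ofReal (1 / 2) ≤ μ {x | F x ≤ 2 * ρ} := by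
    have h1 : μ {x | F x ≤ 2 * ρ} + μ {x | 2 * ρ < F x} = 1 := by
      have := measure_add_measure_compl (μ := μ) (s := {x | F x ≤ 2 * ρ})
        (measurableSet_le hFc.measurable measurable_const)
      simpa [Set.compl_def] using this
    by_contra! hlt
    have : μ {x | F x ≤ 2 * ρ} + μ {x | 2 * ρ < F x}
        < ENNReal.ofReal (1 / 2) + ENNReal.ofReal (1 / 4) :=
      ENNReal.add_lt_add_of_lt_of_le (by finiteness) hlt hB
    rw [h1, ← ENNReal.ofReal_add (by norm_num) (by norm_num)] at this
    exact absurd this (not_lt.2 (by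
      rw [← ENNReal.ofReal_one]
      exact ENNReal.ofReal_le_ofReal (by norm_num)))
  -- This `k` minimizes `k ^ 2 * π ^ 2 * Λ ^ 2 / 8 - k * t`; the minimum is `-2 * t ^ 2 / (π ^ 2 * Λ
  -- ^ 2)`, and `π ^ 2 ≤ 10` gives the constant 5.
  set k := 4 * t / (Real.pi ^ 2 * Λ ^ 2) with hk
  have hk0 : 0 ≤ k := by positivity
  have hMP := lintegral_exp_sub_le_of_hasGradientAt hG hF hΛ k
  have hm := mul_meas_ge_le_lintegral₀ (μ := μ.prod μ)
    (f := fun p => ENNReal.ofReal (Real.exp (k * (F p.2 - F p.1)))) (by fun_prop)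
    (ENNReal.ofReal (Real.exp (k * t)))
  -- If the first of two independent copies is at most `2 * ρ` and the second at least `2 * ρ + t`,
  -- they differ by at least `t`. The first event has probability at least one half, so it costs
  -- only a factor 2.
  have hprod : μ {x | F x ≤ 2 * ρ} * μ {x | 2 * ρ + t ≤ F x} ≤
      μ.prod μ {p | ENNReal.ofReal (Real.exp (k * t)) ≤
        ENNReal.ofReal (Real.exp (k * (F p.2 - F p.1)))} := by
    rw [← Measure.prod_prod]
    refine measure_mono fun p hp => ENNReal.ofReal_le_ofReal (Real.exp_le_exp.2 ?_)
    have h1 : F p.1 ≤ 2 * ρ := hp.1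
    have h2 : 2 * ρ + t ≤ F p.2 := hp.2
    exact mul_le_mul_of_nonneg_left (by linarith) hk0
  have hall : ENNReal.ofReal (Real.exp (k * t) / 2) * μ {x | 2 * ρ + t ≤ F x} ≤
      ENNReal.ofReal (Real.exp (k ^ 2 * Real.pi ^ 2 * Λ ^ 2 / 8)) := by
    refine le_trans ?_ (hm.trans hMP)
    rw [div_eq_mul_one_div, ENNReal.ofReal_mul (by positivity), mul_assoc]
    exact mul_le_mul_right ((mul_le_mul_left hA _).trans hprod) _
  rw [mul_comm] at hall
  refine ((ENNReal.le_div_iff_mul_le (Or.inl (ENNReal.ofReal_pos.2 (by positivity)).ne')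
      (Or.inl ENNReal.ofReal_ne_top)).2 hall).trans ?_
  rw [← ENNReal.ofReal_div_of_pos (by positivity)]
  refine ENNReal.ofReal_le_ofReal ?_
  rw [div_div_eq_mul_div, mul_comm, mul_div_assoc, ← Real.exp_sub]
  refine mul_le_mul_of_nonneg_left (Real.exp_le_exp.2 ?_) (by norm_num)
  have hpi : Real.pi ^ 2 ≤ 10 := by nlinarith [Real.pi_lt_d2, Real.pi_pos]
  have : k ^ 2 * Real.pi ^ 2 * Λ ^ 2 / 8 - k * t = -(t ^ 2 / ((Real.pi ^ 2 / 2) * Λ ^ 2)) := by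
    rw [hk]; field_simp; ring
  rw [this, neg_le_neg_iff]
  gcongr
  linarith

end GaussianConcentration

/-! ### The squared excess of a Gaussian over a threshold. -/

/-- The exponential moments of the square of a standard Gaussian. -/
theorem integral_exp_mul_sq_gaussianReal {s : ℝ} (hs : s < 1 / 2) :
    ∫ x, Real.exp (s * x ^ 2) ∂(gaussianReal 0 1) = (Real.sqrt (1 - 2 * s))⁻¹ := by
  rw [integral_gaussianReal_eq_integral_smul one_ne_zero]
  have h1 : ∀ x : ℝ, gaussianPDFReal 0 1 x • Real.exp (s * x ^ 2)
      = (Real.sqrt (2 * Real.pi))⁻¹ * Real.exp (-(1 / 2 - s) * x ^ 2) := by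
    intro x
    rw [gaussianPDFReal, smul_eq_mul, mul_assoc, ← Real.exp_add]
    simp only [NNReal.coe_one, mul_one]
    congr 2
    ring
  simp_rw [h1]
  rw [integral_const_mul, integral_gaussian, ← Real.sqrt_inv, ← Real.sqrt_mul (by positivity),
    ← Real.sqrt_inv]
  congr 1
  have : 1 - 2 * s ≠ 0 := by linarith
  have : 1 / 2 - s ≠ 0 := by linarith
  field_simp

theorem integrable_exp_mul_sq_gaussianReal {s : ℝ} (hs : s < 1 / 2) :
    Integrable (fun x => Real.exp (s * x ^ 2)) (gaussianReal 0 1) := by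
  by_contra h
  have h1 := integral_exp_mul_sq_gaussianReal hs
  rw [integral_undef h] at h1
  have : 0 < (Real.sqrt (1 - 2 * s))⁻¹ := inv_pos.2 (Real.sqrt_pos.2 (by linarith))
  linarith

/-- The distance from `y` to the interval `[-T, T]`. -/
noncomputable def excess (T y : ℝ) : ℝ := max (|y| - T) 0

theorem excess_nonneg (T y : ℝ) : 0 ≤ excess T y := le_max_right _ _

theorem continuous_excess (T : ℝ) : Continuous (excess T) := by
  unfold excess; fun_prop

/-- Soft thresholding at level `T`. -/
noncomputable def softThreshold (T y : ℝ) : ℝ := max (y - T) 0 - max (-y - T) 0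

theorem continuous_softThreshold (T : ℝ) : Continuous (softThreshold T) := by
  unfold softThreshold; fun_prop

theorem excess_sq_eq {T : ℝ} (hT : 0 ≤ T) (y : ℝ) :
    excess T y ^ 2 = max (y - T) 0 ^ 2 + max (-y - T) 0 ^ 2 := by
  unfold excess
  rcases abs_cases y with ⟨h, h'⟩ | ⟨h, h'⟩ <;> rw [h]
  · rw [max_eq_right (a := -y - T) (by linarith)]; ring
  · rw [max_eq_right (a := y - T) (by linarith)]; ring

theorem softThreshold_sq {T : ℝ} (hT : 0 ≤ T) (y : ℝ) :
    softThreshold T y ^ 2 = excess T y ^ 2 := by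
  rw [excess_sq_eq hT, softThreshold]
  rcases le_total 0 y with h | h
  · rw [max_eq_right (a := -y - T) (by linarith)]; ring
  · rw [max_eq_right (a := y - T) (by linarith)]; ring

/-- Squaring removes the kink at 0. This is why the squared excess, and not the excess itself,
enters the function to which Gaussian concentration is applied. -/
theorem hasDerivAt_max_zero_sq (x : ℝ) :
    HasDerivAt (fun x : ℝ => max x 0 ^ 2) (2 * max x 0) x := by
  rcases lt_trichotomy x 0 with h | rfl | h
  · rw [max_eq_right h.le, mul_zero]
    refine (hasDerivAt_const x (0 : ℝ)).congr_of_eventuallyEq ?_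
    filter_upwards [gt_mem_nhds h] with y hy
    simp [max_eq_right hy.le]
  · rw [hasDerivAt_iff_tendsto_slope_zero]
    have h1 : Filter.Tendsto (fun t : ℝ => max t 0) (nhdsWithin 0 {0}ᶜ) (nhds (2 * max 0 0)) := by
      have : Continuous fun t : ℝ => max t 0 := by fun_prop
      simpa using (this.tendsto 0).mono_left nhdsWithin_le_nhds
    refine h1.congr' ?_
    filter_upwards [self_mem_nhdsWithin] with t ht
    have ht : t ≠ 0 := ht
    rcases le_total t 0 with h | h
    · simp [h]
    · simp [h]
      field_simp
  · rw [max_eq_left h.le]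
    refine ((hasDerivAt_pow 2 x).congr_of_eventuallyEq ?_).congr_deriv (by simp)
    filter_upwards [lt_mem_nhds h] with y hy
    simp [max_eq_left (le_of_lt hy)]

theorem hasDerivAt_excess_sq {T : ℝ} (hT : 0 ≤ T) (y : ℝ) :
    HasDerivAt (fun y => excess T y ^ 2) (2 * softThreshold T y) y := by
  simp_rw [excess_sq_eq hT]
  have h1 := (hasDerivAt_max_zero_sq (y - T)).comp y ((hasDerivAt_id y).sub_const T)
  have h2 := (hasDerivAt_max_zero_sq (-y - T)).comp y ((hasDerivAt_id y).neg.sub_const T)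
  refine (h1.add h2).congr_deriv ?_
  unfold softThreshold
  ring

theorem excess_sq_le (T y : ℝ) (hT : 0 ≤ T) :
    excess T y ^ 2 ≤ 8 * Real.exp (-(T ^ 2 / 8)) * Real.exp (1 / 4 * y ^ 2) := by
  unfold excess
  rcases le_total (|y|) T with h | h
  · rw [max_eq_right (by linarith)]
    simp only [ne_eq, OfNat.ofNat_ne_zero, not_false_eq_true, zero_pow]
    positivity
  · rw [max_eq_left (by linarith), mul_assoc, ← Real.exp_add]
    have h0 : (|y| - T) ^ 2 ≤ y ^ 2 := by
      rw [← sq_abs y]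
      exact pow_le_pow_left₀ (by linarith) (by linarith) 2
    have h1 : T ^ 2 ≤ y ^ 2 := by
      rw [← sq_abs y]
      exact pow_le_pow_left₀ hT h 2
    -- `y ^ 2 ≤ 8 * exp (y ^ 2 / 8)`, and since `T ^ 2 ≤ y ^ 2`, another factor `exp ((y ^ 2 - T ^
    -- 2) / 8)` may be inserted.
    have h2 : y ^ 2 / 8 + 1 ≤ Real.exp (y ^ 2 / 8) := Real.add_one_le_exp _
    have h3 : Real.exp (y ^ 2 / 8) ≤ Real.exp (-(T ^ 2 / 8) + 1 / 4 * y ^ 2) :=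
      Real.exp_le_exp.2 (by linarith)
    linarith

theorem lintegral_excess_sq_gaussianReal_le {T : ℝ} (hT : 0 ≤ T) :
    ∫⁻ y, ENNReal.ofReal (excess T y ^ 2) ∂(gaussianReal 0 1)
      ≤ ENNReal.ofReal (12 * Real.exp (-(T ^ 2 / 8))) := by
  have hi := (integrable_exp_mul_sq_gaussianReal (s := 1 / 4) (by norm_num)).const_mul
    (8 * Real.exp (-(T ^ 2 / 8)))
  refine (lintegral_mono fun y => ENNReal.ofReal_le_ofReal (excess_sq_le T y hT)).trans ?_
  rw [← ofReal_integral_eq_lintegral_ofReal hi (ae_of_all _ fun _ => by positivity),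
    integral_const_mul, integral_exp_mul_sq_gaussianReal (by norm_num)]
  refine ENNReal.ofReal_le_ofReal ?_
  -- The moment at `s = 1 / 4` is `√2`, and `8 * (3 / 2) = 12`.
  have h1 : (Real.sqrt (1 - 2 * (1 / 4)))⁻¹ ≤ 3 / 2 := by
    rw [inv_le_comm₀ (Real.sqrt_pos.2 (by norm_num)) (by norm_num)]
    exact Real.le_sqrt_of_sq_le (by norm_num)
  nlinarith [Real.exp_pos (-(T ^ 2 / 8))]

/-! ### Distance to a cube of the vector of inner products with a Gaussian. -/

section

variable {E : Type*} [NormedAddCommGroup E] [InnerProductSpace ℝ E]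
  {κ : Type*} [Fintype κ]

/-- Duality: the synthesis map `c ↦ ∑ p, c p • b p` is the adjoint of the analysis map `x ↦ (⟨b p,
x⟩)`, so it has the same norm. Cauchy–Schwarz is applied to `‖v‖ ^ 2 = ∑ p, c p * ⟨b p, v⟩`. -/
theorem norm_sum_smul_le {b : κ → E} {Λ : ℝ} (hΛ : 0 ≤ Λ)
    (hb : ∀ x, ∑ p, inner ℝ (b p) x ^ 2 ≤ Λ ^ 2 * ‖x‖ ^ 2) (c : κ → ℝ) :
    ‖∑ p, c p • b p‖ ≤ Λ * Real.sqrt (∑ p, c p ^ 2) := by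
  set v := ∑ p, c p • b p with hv
  have h1 : ‖v‖ ^ 2 = ∑ p, c p * inner ℝ (b p) v := by
    rw [← real_inner_self_eq_norm_sq]
    conv_lhs => rw [hv, sum_inner]
    simp_rw [real_inner_smul_left]
    rfl
  have h2 : ‖v‖ ^ 2 ≤ Real.sqrt (∑ p, c p ^ 2) * (Λ * ‖v‖) := by
    rw [h1]
    refine (Real.sum_mul_le_sqrt_mul_sqrt _ _ _).trans ?_
    gcongr
    exact Real.sqrt_le_iff.2 ⟨by positivity, by simpa [mul_pow] using hb v⟩
  by_contra! h
  have h3 : 0 < ‖v‖ := lt_of_le_of_lt (by positivity) h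
  nlinarith

variable [FiniteDimensional ℝ E] [MeasurableSpace E] [BorelSpace E]

theorem map_inner_stdGaussian {b : E} (hb : ‖b‖ = 1) :
    (stdGaussian E).map (fun x => inner ℝ b x) = gaussianReal 0 1 := by
  have h := IsGaussian.map_eq_gaussianReal (μ := stdGaussian E) (innerSL ℝ b)
  rw [integral_strongDual_stdGaussian, variance_dual_stdGaussian, innerSL_apply_norm, hb] at h
  simpa using h

/-- For most Gaussian vectors `x`, the vector of the inner products of `x` with unit vectors `b p`
is close to the cube `[-T, T]^κ`. -/
theorem measure_sum_excess_sq_ge_le {b : κ → E} (hb1 : ∀ p, ‖b p‖ = 1) {Λ : ℝ} (hΛ : 0 < Λ)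
    (hb : ∀ x, ∑ p, inner ℝ (b p) x ^ 2 ≤ Λ ^ 2 * ‖x‖ ^ 2) {T η t : ℝ} (hT : 0 ≤ T) (hη : 0 < η)
    (hTη : Fintype.card κ * (12 * Real.exp (-(T ^ 2 / 8))) ≤ η) (ht : 0 ≤ t) :
    stdGaussian E {x | (2 * Real.sqrt (2 * η) + t) ^ 2 ≤ ∑ p, excess T (inner ℝ (b p) x) ^ 2}
      ≤ ENNReal.ofReal (2 * Real.exp (-(t ^ 2 / (5 * Λ ^ 2)))) := by
  set S : E → ℝ := fun x => ∑ p, excess T (inner ℝ (b p) x) ^ 2 with hS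
  have hS0 : ∀ x, 0 ≤ S x := fun x => Finset.sum_nonneg fun p _ => sq_nonneg _
  -- The summand `η` keeps the square root away from 0, so `F` is differentiable everywhere. It is
  -- as large as the bound for the mean of `S`, so it only doubles the bound for the mean of `F ^
  -- 2`.
  set F : E → ℝ := fun x => Real.sqrt (η + S x) with hF
  have hF0 : ∀ x, 0 < F x := fun x => Real.sqrt_pos.2 (by linarith [hS0 x])
  set G : E → E := fun x => (F x)⁻¹ • ∑ p, softThreshold T (inner ℝ (b p) x) • b p with hG
  have hScont : Continuous S := by
    have := continuous_excess T
    fun_prop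
  have hGc : Continuous G := by
    have h1 : Continuous fun x => (F x)⁻¹ :=
      (Real.continuous_sqrt.comp (continuous_const.add hScont)).inv₀ fun x => (hF0 x).ne'
    have := continuous_softThreshold T
    fun_prop
  have hGrad : ∀ x, HasGradientAt F (G x) x := by
    intro x
    have h1 : ∀ p, HasFDerivAt (fun x => excess T (inner ℝ (b p) x) ^ 2)
        ((2 * softThreshold T (inner ℝ (b p) x)) • innerSL ℝ (b p)) x := fun p =>
      (hasDerivAt_excess_sq hT _).comp_hasFDerivAt x (innerSL ℝ (b p)).hasFDerivAt
    have h2 : HasFDerivAt (fun x => η + S x)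
        (∑ p, (2 * softThreshold T (inner ℝ (b p) x)) • innerSL ℝ (b p)) x :=
      (HasFDerivAt.fun_sum fun p _ => h1 p).const_add η
    have h3 := h2.sqrt (by linarith [hS0 x])
    rw [hasGradientAt_iff_hasFDerivAt]
    refine h3.congr_fderiv ?_
    ext y
    have : F x = Real.sqrt (η + S x) := rfl
    simp [hG, ← this, Finset.mul_sum]
    refine Finset.sum_congr rfl fun p _ => ?_
    ring
  have hGn : ∀ x, ‖G x‖ ≤ Λ := by
    intro x
    have h1 := norm_sum_smul_le hΛ.le hb (fun p => softThreshold T (inner ℝ (b p) x))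
    simp_rw [softThreshold_sq hT] at h1
    have h2 : Real.sqrt (∑ p, excess T (inner ℝ (b p) x) ^ 2) ≤ F x :=
      Real.sqrt_le_sqrt (by simp only [hS]; linarith)
    rw [hG, norm_smul, norm_inv, Real.norm_of_nonneg (hF0 x).le, inv_mul_le_iff₀ (hF0 x)]
    refine h1.trans ?_
    rw [mul_comm]
    exact mul_le_mul_of_nonneg_right h2 hΛ.le
  have hmean : ∫⁻ x, ENNReal.ofReal (F x ^ 2) ∂(stdGaussian E)
      ≤ ENNReal.ofReal (Real.sqrt (2 * η) ^ 2) := by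
    rw [Real.sq_sqrt (by positivity)]
    have h1 : ∀ x, ENNReal.ofReal (F x ^ 2) = ENNReal.ofReal η +
        ∑ p, ENNReal.ofReal (excess T (inner ℝ (b p) x) ^ 2) := by
      intro x
      rw [hF, Real.sq_sqrt (by linarith [hS0 x]), ENNReal.ofReal_add hη.le (hS0 x),
        ENNReal.ofReal_sum_of_nonneg fun p _ => sq_nonneg _]
    have hm := (continuous_excess T).measurable
    simp_rw [h1]
    rw [lintegral_add_left (by fun_prop), lintegral_finsetSum _ (by fun_prop)]
    have h2 : ∀ p, ∫⁻ x, ENNReal.ofReal (excess T (inner ℝ (b p) x) ^ 2) ∂(stdGaussian E)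
        ≤ ENNReal.ofReal (12 * Real.exp (-(T ^ 2 / 8))) := by
      intro p
      refine le_trans (le_of_eq ?_) (lintegral_excess_sq_gaussianReal_le hT)
      rw [← map_inner_stdGaussian (hb1 p), lintegral_map (by fun_prop) (by fun_prop)]
    refine (add_le_add_right (Finset.sum_le_sum fun p _ => h2 p) _).trans ?_
    simp only [lintegral_const, measure_univ, mul_one, Finset.sum_const, Finset.card_univ,
      nsmul_eq_mul]
    rw [← ENNReal.ofReal_natCast, ← ENNReal.ofReal_mul (by positivity),
      ← ENNReal.ofReal_add hη.le (by positivity)]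
    exact ENNReal.ofReal_le_ofReal (by linarith)
  refine le_trans (measure_mono fun x hx => ?_)
    (measure_stdGaussian_ge_le hGc hGrad hΛ hGn (Real.sqrt_pos.2 (by positivity)) ht hmean)
  have hx' : (2 * Real.sqrt (2 * η) + t) ^ 2 ≤ S x := hx
  exact Real.le_sqrt_of_sq_le (by linarith)

end

/-! ### A fast Walsh--Hadamard transform with constant geometry -/

/-- One step of the transform, on `2 * H` cells. -/
noncomputable def butterfly (H : ℕ) (x : ℕ → ℝ) (i : ℕ) : ℝ :=
  if i < H then x (i + i) + x (i + i + 1) else x ((i - H) + (i - H)) - x ((i - H) + (i - H) + 1)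

theorem sum_range_two_mul (f : ℕ → ℝ) (H : ℕ) :
    ∑ i ∈ Finset.range (2 * H), f i = ∑ i ∈ Finset.range H, (f (i + i) + f (i + i + 1)) := by
  induction H with
  | zero => simp
  | succ H ih =>
    rw [Finset.sum_range_succ, ← ih, show 2 * (H + 1) = 2 * H + 1 + 1 by ring,
      Finset.sum_range_succ, Finset.sum_range_succ, two_mul]
    ring

/-- The parallelogram identity on each pair of neighbouring cells. -/
theorem sum_butterfly_sq (H : ℕ) (x : ℕ → ℝ) :
    ∑ i ∈ Finset.range (2 * H), butterfly H x i ^ 2 = 2 * ∑ i ∈ Finset.range (2 * H), x i ^ 2 := by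
  rw [sum_range_two_mul (fun i => x i ^ 2), two_mul H, Finset.sum_range_add, Finset.mul_sum,
    ← Finset.sum_add_distrib]
  refine Finset.sum_congr rfl fun i hi => ?_
  have hi : i < H := Finset.mem_range.1 hi
  simp only [butterfly, hi, if_true, not_lt.2 (Nat.le_add_right H i), if_false,
    Nat.add_sub_cancel_left]
  ring

theorem sum_iterate_butterfly_sq (H t : ℕ) (x : ℕ → ℝ) :
    ∑ i ∈ Finset.range (2 * H), (butterfly H)^[t] x i ^ 2
      = 2 ^ t * ∑ i ∈ Finset.range (2 * H), x i ^ 2 := by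
  induction t with
  | zero => simp
  | succ t ih =>
    rw [Function.iterate_succ_apply', sum_butterfly_sq, ih]
    ring

theorem butterfly_add (H : ℕ) (x y : ℕ → ℝ) :
    butterfly H (x + y) = butterfly H x + butterfly H y := by
  funext i
  simp only [butterfly, Pi.add_apply]
  split_ifs <;> ring

theorem butterfly_smul (H : ℕ) (c : ℝ) (x : ℕ → ℝ) :
    butterfly H (c • x) = c • butterfly H x := by
  funext i
  simp only [butterfly, Pi.smul_apply, smul_eq_mul]
  split_ifs <;> ring

theorem iterate_butterfly_add (H t : ℕ) (x y : ℕ → ℝ) :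
    (butterfly H)^[t] (x + y) = (butterfly H)^[t] x + (butterfly H)^[t] y := by
  induction t with
  | zero => rfl
  | succ t ih => simp only [Function.iterate_succ_apply', ih, butterfly_add]

theorem iterate_butterfly_smul (H t : ℕ) (c : ℝ) (x : ℕ → ℝ) :
    (butterfly H)^[t] (c • x) = c • (butterfly H)^[t] x := by
  induction t with
  | zero => rfl
  | succ t ih => simp only [Function.iterate_succ_apply', ih, butterfly_smul]

/-- Here `c` is the number of blocks of length `2 ^ t`. After `t` steps, cell `i` is a signed sum
over the block with number `i % c`. The two cells combined in the next step belong to the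
neighbouring blocks `2 * (i % c)` and `2 * (i % c) + 1`, which together form one block of double
length. The signs are not identified further, since only their squares matter. -/
theorem exists_sign_iterate_butterfly (H t : ℕ) : ∀ c : ℕ, 2 * H = 2 ^ t * c →
    ∃ s : ℕ → ℕ → ℝ, (∀ i u, s i u ^ 2 = 1) ∧ ∀ (x : ℕ → ℝ) (i : ℕ), i < 2 * H →
      (butterfly H)^[t] x i = ∑ u ∈ Finset.range (2 ^ t), s i u * x (2 ^ t * (i % c) + u) := by
  induction t with
  | zero =>
    intro c hc
    refine ⟨fun _ _ => 1, by simp, fun x i hi => ?_⟩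
    simp [Nat.mod_eq_of_lt (by omega : i < c)]
  | succ t ih =>
    intro c hc
    obtain ⟨s, hs, hx⟩ := ih (2 * c) (by rw [hc]; ring)
    have hH : H = 2 ^ t * c := by
      have : 2 * H = 2 * (2 ^ t * c) := by rw [hc]; ring
      omega
    -- The first half of the block takes its signs from the left input cell. The second half takes
    -- them from the right one, negated if `i` lies in the upper half of the output.
    refine ⟨fun i u => if u < 2 ^ t then s (if i < H then i + i else (i - H) + (i - H)) u else
      (if i < H then 1 else -1) *
        s (if i < H then i + i + 1 else (i - H) + (i - H) + 1) (u - 2 ^ t), ?_, ?_⟩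
    · intro i u
      dsimp only
      split_ifs <;> simp [hs]
    · intro x i hi
      have hsplit : (2 : ℕ) ^ (t + 1) = 2 ^ t + 2 ^ t := by ring
      have key : ∀ i', i' < H → i' % c = i % c → ∀ e : ℝ,
          (butterfly H)^[t] x (i' + i') + e * (butterfly H)^[t] x (i' + i' + 1) =
          ∑ u ∈ Finset.range (2 ^ t + 2 ^ t), (if u < 2 ^ t then s (i' + i') u else
            e * s (i' + i' + 1) (u - 2 ^ t)) * x ((2 ^ t + 2 ^ t) * (i % c) + u) := by
        intro i' hi' hmod e
        rw [hx x _ (by omega), hx x _ (by omega), Finset.sum_range_add, Finset.mul_sum]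
        have e1 : (i' + i') % (2 * c) = 2 * (i % c) := by
          rw [← two_mul, Nat.mul_mod_mul_left, hmod]
        have hc0 : 0 < c := by
          rcases Nat.eq_zero_or_pos c with h | h
          · subst h; omega
          · exact h
        have e2 : (i' + i' + 1) % (2 * c) = 2 * (i % c) + 1 := by
          have := Nat.mod_lt i hc0
          rw [Nat.add_mod, e1, Nat.mod_eq_of_lt (by omega : 1 < 2 * c), Nat.mod_eq_of_lt (by omega)]
        rw [e1, e2]
        congr 1
        · refine Finset.sum_congr rfl fun u hu => ?_
          rw [if_pos (Finset.mem_range.1 hu)]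
          congr 2
          ring
        · refine Finset.sum_congr rfl fun u hu => ?_
          rw [if_neg (by omega), Nat.add_sub_cancel_left, mul_assoc]
          congr 3
          ring
      rw [Function.iterate_succ_apply', hsplit]
      by_cases h : i < H
      · have := key i h rfl 1
        simp only [one_mul] at this
        simp only [butterfly, h, if_true, one_mul]
        exact this
      · have := key (i - H) (by omega) (by
          obtain ⟨j, rfl⟩ := Nat.exists_eq_add_of_le (not_lt.1 h)
          rw [Nat.add_sub_cancel_left, hH, mul_comm, Nat.mul_add_mod]) (-1)
        simp only [butterfly, h, if_false]
        rw [← this]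
        ring

theorem sum_range_mul_eq (f : ℕ → ℝ) (D m : ℕ) :
    ∑ q ∈ Finset.range (D * m), f q
      = ∑ j ∈ Finset.range m, ∑ u ∈ Finset.range D, f (D * j + u) := by
  induction m with
  | zero => simp
  | succ m ih => rw [Nat.mul_succ, Finset.sum_range_add, ih, Finset.sum_range_succ]

/-! ### Concentration of sums of squares of Gaussians -/

instance : IsProbabilityMeasure
    ((gaussianReal 0 1).prod (volume.restrict (Set.Icc (0 : ℝ) 1))) := by
  have : IsProbabilityMeasure (volume.restrict (Set.Icc (0 : ℝ) 1)) := by constructor; simp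
  infer_instance

theorem iIndepFun_tapeLaw {β : Type*} [MeasurableSpace β] {f : ℝ × ℝ → β} (hf : Measurable f) :
    iIndepFun (fun (p : ℕ) (ω : Tape) => f (ω p)) tapeLaw :=
  iIndepFun_infinitePi fun _ => hf

theorem map_gauss_tapeLaw (p : ℕ) : tapeLaw.map (fun ω : Tape => (ω p).1) = gaussianReal 0 1 := by
  have : IsProbabilityMeasure (volume.restrict (Set.Icc (0 : ℝ) 1)) := by constructor; simp
  have h1 : tapeLaw.map (fun ω : Tape => ω p) = _ := Measure.infinitePi_map_eval _ p
  have h2 := Measure.map_map (μ := tapeLaw) (g := Prod.fst) (f := fun ω : Tape => ω p)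
    measurable_fst (measurable_pi_apply p)
  rw [h1, Measure.map_fst_prod] at h2
  simpa [Function.comp_def] using h2.symm

/-- With `u = 2 * t` this bounds the centered moment `exp (-t) / √(1 - 2 * t)` of a squared Gaussian
by `exp (2 * t ^ 2)`. -/
theorem one_le_one_sub_mul_exp {u : ℝ} (h2 : u ≤ 1 / 2) :
    1 ≤ (1 - u) * Real.exp (u + u ^ 2) := by
  rcases le_total u 0 with h | h
  · have := Real.add_one_le_exp (u + u ^ 2)
    nlinarith [pow_nonneg (neg_nonneg.2 h) 3]
  · have h3 := Real.quadratic_le_exp_of_nonneg (x := u + u ^ 2) (by positivity)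
    have h4 : u ≤ (1 - u) * (1 + u) ^ 2 / 2 := by nlinarith [mul_nonneg h h]
    nlinarith [mul_le_mul_of_nonneg_left h4 (sq_nonneg u)]

theorem mgf_gauss_sq_sub_one_le (p : ℕ) {t : ℝ} (ht : t ≤ 1 / 4) :
    Integrable (fun ω : Tape => Real.exp (t * ((ω p).1 ^ 2 - 1))) tapeLaw ∧
    mgf (fun ω : Tape => (ω p).1 ^ 2 - 1) tapeLaw t ≤ Real.exp (2 * t ^ 2) := by
  have he : ∀ x : ℝ, Real.exp (t * (x ^ 2 - 1)) = Real.exp (-t) * Real.exp (t * x ^ 2) := by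
    intro x
    rw [← Real.exp_add]; congr 1; ring
  have hi : Integrable (fun x : ℝ => Real.exp (t * (x ^ 2 - 1))) (gaussianReal 0 1) := by
    simp_rw [he]
    exact (integrable_exp_mul_sq_gaussianReal (by linarith)).const_mul _
  constructor
  · rw [← map_gauss_tapeLaw p] at hi
    exact hi.comp_measurable (measurable_fst.comp (measurable_pi_apply p))
  · have h3 : mgf (fun ω : Tape => (ω p).1 ^ 2 - 1) tapeLaw t
        = ∫ x, Real.exp (t * (x ^ 2 - 1)) ∂(gaussianReal 0 1) := by
      rw [← map_gauss_tapeLaw p, integral_map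
        (f := fun x => Real.exp (t * (x ^ 2 - 1)))
        (by fun_prop : Measurable fun ω : Tape => (ω p).1).aemeasurable (by fun_prop)]
      rfl
    rw [h3]
    simp_rw [he]
    rw [integral_const_mul, integral_exp_mul_sq_gaussianReal (by linarith)]
    have h4 := one_le_one_sub_mul_exp (u := 2 * t) (by linarith)
    have h5 : 0 < 1 - 2 * t := by linarith
    have h6 : 1 ≤ Real.sqrt (1 - 2 * t) * Real.exp (t + 2 * t ^ 2) := by
      rw [← Real.sqrt_sq (Real.exp_pos (t + 2 * t ^ 2)).le, ← Real.sqrt_mul h5.le, Real.one_le_sqrt,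
        ← Real.exp_nat_mul]
      convert h4 using 3
      push_cast; ring
    rw [mul_inv_le_iff₀ (Real.sqrt_pos.2 h5)]
    calc Real.exp (-t) ≤ Real.exp (-t) * (Real.sqrt (1 - 2 * t) * Real.exp (t + 2 * t ^ 2)) :=
          le_mul_of_one_le_right (Real.exp_pos _).le h6
      _ = Real.exp (-t + (t + 2 * t ^ 2)) * Real.sqrt (1 - 2 * t) := by
          rw [Real.exp_add (-t)]; ring
      _ = _ := by congr 2; ring

/-- The sum of the squares of independent standard Gaussians is close to its mean. -/
theorem measure_abs_sum_gauss_sq_sub_ge_le (s : Finset ℕ) {η : ℝ} (h0 : 0 ≤ η) (h1 : η ≤ 1) :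
    tapeLaw {ω : Tape | s.card * η ≤ |∑ p ∈ s, (ω p).1 ^ 2 - s.card|}
      ≤ ENNReal.ofReal (2 * Real.exp (-(s.card * η ^ 2 / 8))) := by
  set X : ℕ → Tape → ℝ := fun p ω => (ω p).1 ^ 2 - 1 with hX
  have hind : iIndepFun X tapeLaw :=
    iIndepFun_tapeLaw (f := fun x : ℝ × ℝ => x.1 ^ 2 - 1) (by fun_prop)
  have hmeas : ∀ p, Measurable (X p) := fun p => by simp only [hX]; fun_prop
  have hsum : ∀ ω : Tape, (∑ p ∈ s, X p) ω = ∑ p ∈ s, (ω p).1 ^ 2 - s.card := by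
    intro ω
    simp [hX]
  have hmgf : ∀ t : ℝ, t ≤ 1 / 4 →
      Integrable (fun ω => Real.exp (t * (∑ p ∈ s, X p) ω)) tapeLaw ∧
      mgf (∑ p ∈ s, X p) tapeLaw t ≤ Real.exp (s.card * (2 * t ^ 2)) := by
    intro t ht
    refine ⟨hind.integrable_exp_mul_sum hmeas fun p _ => (mgf_gauss_sq_sub_one_le p ht).1, ?_⟩
    rw [hind.mgf_sum hmeas, Real.exp_nat_mul]
    exact (Finset.prod_le_prod (fun _ _ => mgf_nonneg)
      fun p _ => (mgf_gauss_sq_sub_one_le p ht).2).trans (by simp)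
  -- With `n = s.card`, the value `t = η / 4` minimizes `2 * n * t ^ 2 - t * n * η`, with minimum
  -- `-n * η ^ 2 / 8`; the hypothesis `η ≤ 1` ensures `t ≤ 1 / 4`. The lower tail uses `-η / 4`.
  have hup := measure_ge_le_exp_mul_mgf (X := ∑ p ∈ s, X p) (μ := tapeLaw) (s.card * η)
    (t := η / 4) (by linarith) (hmgf (η / 4) (by linarith)).1
  have hlo := measure_le_le_exp_mul_mgf (X := ∑ p ∈ s, X p) (μ := tapeLaw) (-(s.card * η))
    (t := -(η / 4)) (by linarith) (hmgf (-(η / 4)) (by linarith)).1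
  have hup' : tapeLaw.real {ω | s.card * η ≤ (∑ p ∈ s, X p) ω}
      ≤ Real.exp (-(s.card * η ^ 2 / 8)) := by
    refine hup.trans ((mul_le_mul_of_nonneg_left (hmgf (η / 4) (by linarith)).2
      (Real.exp_pos _).le).trans (le_of_eq ?_))
    rw [← Real.exp_add]; congr 1; ring
  have hlo' : tapeLaw.real {ω | (∑ p ∈ s, X p) ω ≤ -(s.card * η)}
      ≤ Real.exp (-(s.card * η ^ 2 / 8)) := by
    refine hlo.trans ((mul_le_mul_of_nonneg_left (hmgf (-(η / 4)) (by linarith)).2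
      (Real.exp_pos _).le).trans (le_of_eq ?_))
    rw [← Real.exp_add]; congr 1; ring
  have hsub : {ω : Tape | s.card * η ≤ |∑ p ∈ s, (ω p).1 ^ 2 - s.card|} ⊆
      {ω | s.card * η ≤ (∑ p ∈ s, X p) ω} ∪ {ω | (∑ p ∈ s, X p) ω ≤ -(s.card * η)} := by
    intro ω hω
    simp only [Set.mem_union, Set.mem_ofPred_eq, hsum] at hω ⊢
    rcases le_abs.1 hω with h | h
    · exact Or.inl h
    · exact Or.inr (by linarith)
  rw [← ofReal_measureReal]
  refine ENNReal.ofReal_le_ofReal ?_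
  refine (measureReal_mono hsub).trans ((measureReal_union_le _ _).trans ?_)
  linarith

/-! ### From sign vectors to all vectors -/

section Flat

variable {ι κ : Type*} [Fintype κ]

theorem excess_convexOn (T : ℝ) : ConvexOn ℝ Set.univ (excess T) := by
  have h : ConvexOn ℝ Set.univ fun y : ℝ => |y| := convexOn_univ_norm
  exact (h.add_const (-T)).sup (convexOn_const 0 convex_univ)

theorem excess_mul {a : ℝ} (ha : 0 ≤ a) (T y : ℝ) : excess (a * T) (a * y) = a * excess T y := by
  unfold excess
  rw [abs_mul, abs_of_nonneg ha, mul_max_of_nonneg _ _ ha, mul_zero, mul_sub]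

/-- The vectors whose image under `Y` is close to the cube `[-T, T]^κ`. -/
def nearCube (Y : (ι → ℝ) →ₗ[ℝ] (κ → ℝ)) (T ρ : ℝ) : Set (ι → ℝ) :=
  {z | ∑ p, excess T (Y z p) ^ 2 ≤ ρ}

/-- The excess is convex and nonnegative, so its square is convex. Convexity is what carries bounds
from sign vectors to their convex hull. -/
theorem convex_nearCube (Y : (ι → ℝ) →ₗ[ℝ] (κ → ℝ)) (T ρ : ℝ) : Convex ℝ (nearCube Y T ρ) := by
  have h1 : ∀ p, ConvexOn ℝ Set.univ fun z => excess T (Y z p) ^ 2 := by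
    intro p
    have h2 := ((excess_convexOn T).pow (fun _ _ => excess_nonneg T _) 2).comp_linearMap
      ((LinearMap.proj p).comp Y)
    simpa [Function.comp_def] using h2
  have h2 : ConvexOn ℝ Set.univ fun z => ∑ p, excess T (Y z p) ^ 2 := by
    classical
    refine Finset.induction_on (motive := fun s =>
      ConvexOn ℝ Set.univ fun z => ∑ p ∈ s, excess T (Y z p) ^ 2) Finset.univ
      (by simpa using convexOn_const (0 : ℝ) convex_univ) fun p s hp ih => ?_
    simp_rw [Finset.sum_insert hp]
    exact (h1 p).add ih
  simpa [nearCube] using h2.convex_le ρ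

variable [Fintype ι]

/-- The number of nonzero entries of a vector of signs. -/
def suppCard (σ : ι → SignType) : ℕ := (Finset.univ.filter fun k => σ k ≠ 0).card

/-- The unit vector in the direction of a vector of signs. -/
noncomputable def signVec (σ : ι → SignType) (k : ι) : ℝ := (σ k : ℝ) / Real.sqrt (suppCard σ)

/-- With `b = |U| ^ (-1/2)`, the box `[-b, b] ^ U` is the convex hull of its vertices, and every
vertex is the unit vector of a sign pattern with support `U`. -/
theorem mem_nearCube_of_flat {Y : (ι → ℝ) →ₗ[ℝ] (κ → ℝ)} {T ρ : ℝ} (hT : 0 ≤ T) (hρ : 0 ≤ ρ)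
    (h : ∀ σ : ι → SignType, σ ≠ 0 → signVec σ ∈ nearCube Y T ρ) (U : Finset ι) {w : ι → ℝ}
    (hw0 : ∀ k, k ∉ U → w k = 0) (hw : ∀ k ∈ U, |w k| ≤ (Real.sqrt U.card)⁻¹) :
    w ∈ nearCube Y T ρ := by
  classical
  set b := (Real.sqrt U.card)⁻¹ with hb
  let t : ι → Set ℝ := fun k => if k ∈ U then {-b, b} else {0}
  have hmem : w ∈ convexHull ℝ (Set.univ.pi t) := by
    refine mem_convexHull_pi fun k _ => ?_
    by_cases hk : k ∈ U
    · have hb0 : -b ≤ b := by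
        have : 0 ≤ b := by positivity
        linarith
      simp only [t, hk, if_true, convexHull_pair, segment_eq_Icc hb0]
      exact abs_le.1 (hw k hk)
    · simp [t, hk, hw0 k hk]
  refine convexHull_min ?_ (convex_nearCube Y T ρ) hmem
  intro v hv
  -- For empty `U` the only vertex is 0, which the hypothesis on nonzero sign vectors does not
  -- cover.
  rcases U.eq_empty_or_nonempty with rfl | hU
  · have : v = 0 := by
      funext k
      simpa [t] using hv k (Set.mem_univ k)
    simp [nearCube, this, excess, hT, hρ]
  let σ : ι → SignType := fun k => SignType.sign (v k)
  have hbpos : 0 < b := inv_pos.2 (Real.sqrt_pos.2 (by exact_mod_cast hU.card_pos))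
  have hσ : ∀ k, (σ k : ℝ) * b = v k := by
    intro k
    have := hv k (Set.mem_univ k)
    by_cases hk : k ∈ U
    · simp only [t, hk, if_true, Set.mem_insert_iff, Set.mem_singleton_iff] at this
      rcases this with h | h <;> simp [σ, h, Left.sign_neg, sign_pos hbpos]
    · simp only [t, hk, if_false, Set.mem_singleton_iff] at this
      simp [σ, this]
  have hsupp : (Finset.univ.filter fun k => σ k ≠ 0) = U := by
    ext k
    have h1 := hv k (Set.mem_univ k)
    by_cases hk : k ∈ U
    · simp only [t, hk, if_true, Set.mem_insert_iff, Set.mem_singleton_iff] at h1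
      rcases h1 with h1 | h1 <;> simp [σ, h1, hbpos.ne', hk]
    · simp only [t, hk, if_false, Set.mem_singleton_iff] at h1
      simp [σ, h1, hk]
  have hv' : v = signVec σ := by
    funext k
    rw [signVec, suppCard, hsupp, div_eq_mul_inv, ← hσ k]
  rw [hv']
  refine h σ fun h0 => ?_
  rw [← hsupp] at hU
  simp [h0] at hU

/-- Every unit vector is a combination of few flat vectors, so that closeness to a cube for sign
vectors implies closeness to a somewhat larger cube for all unit vectors. -/
theorem mem_nearCube_of_sum_sq_le_one {Y : (ι → ℝ) →ₗ[ℝ] (κ → ℝ)} {T ρ : ℝ} (hT : 0 ≤ T)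
    (hρ : 0 ≤ ρ) (h : ∀ σ : ι → SignType, σ ≠ 0 → signVec σ ∈ nearCube Y T ρ) {L : ℕ}
    (hL : Fintype.card ι ≤ 2 ^ L) {z : ι → ℝ} (hz : ∑ k, z k ^ 2 ≤ 1) :
    z ∈ nearCube Y (2 * (L + 1) * T) ((2 * (L + 1)) ^ 2 * ρ) := by
  classical
  have hz1 : ∀ k, |z k| ≤ 1 := fun k => by
    have h1 := Finset.single_le_sum (f := fun k => z k ^ 2) (fun _ _ => sq_nonneg _)
      (Finset.mem_univ k)
    exact abs_le_one_iff_mul_self_le_one.2 (by nlinarith)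
  -- The dyadic level of an entry, cut off at `L`: entries below `2 ^ (-L)` all share the last
  -- level.
  let lev : ι → ℕ := fun k => Nat.findGreatest (fun l => |z k| ≤ (2 ^ l)⁻¹) L
  have hlev : ∀ k, |z k| ≤ (2 ^ lev k)⁻¹ := fun k =>
    Nat.findGreatest_spec (P := fun l => |z k| ≤ (2 ^ l)⁻¹) (Nat.zero_le L) (by simpa using hz1 k)
  have hlevL : ∀ k, lev k ≤ L := fun k => Nat.findGreatest_le L
  have hlev' : ∀ k, lev k < L → (2 ^ (lev k + 1))⁻¹ < |z k| := fun k hk =>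
    not_le.1 (Nat.findGreatest_is_greatest (P := fun l => |z k| ≤ (2 ^ l)⁻¹) (Nat.lt_succ_self _) hk)
  -- An entry of level `l` may be twice as large as its lower bound `2 ^ (-(l + 1))`; halving
  -- compensates for this.
  let w : ℕ → ι → ℝ := fun l k => if lev k = l then z k / 2 else 0
  have hw : ∀ l ∈ Finset.range (L + 1), w l ∈ nearCube Y T ρ := by
    intro l hl
    have hl : l ≤ L := Nat.lt_succ_iff.1 (Finset.mem_range.1 hl)
    set U := Finset.univ.filter fun k => lev k = l with hU
    refine mem_nearCube_of_flat hT hρ h U (fun k hk => ?_) fun k hk => ?_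
    · simp only [hU, Finset.mem_filter, Finset.mem_univ, true_and] at hk
      simp [w, hk]
    · have hU0 : 0 < U.card := Finset.card_pos.2 ⟨k, hk⟩
      have hk : lev k = l := (Finset.mem_filter.1 hk).2
      simp only [w, hk, if_true]
      have h1 : |z k / 2| ≤ (2 ^ (l + 1))⁻¹ := by
        rw [abs_div, abs_two, pow_succ, mul_inv, div_eq_mul_inv]
        have := hlev k
        rw [hk] at this
        gcongr
      refine h1.trans ?_
      gcongr
      rw [Real.sqrt_le_iff]
      refine ⟨by positivity, ?_⟩
      rcases hl.lt_or_eq with hl | rfl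
      -- Below the last level, each of the `|U|` entries has square at least `4 ^ (-(l + 1))`, and
      -- the squares sum to at most 1; hence `√|U| ≤ 2 ^ (l + 1)`.
      · have h2 : U.card • ((2 : ℝ) ^ (l + 1))⁻¹ ^ 2 ≤ ∑ k ∈ U, z k ^ 2 := by
          refine Finset.card_nsmul_le_sum _ _ _ fun j hj => ?_
          have hj : lev j = l := (Finset.mem_filter.1 hj).2
          have := hlev' j (by omega)
          rw [← sq_abs (z j), ← hj]
          exact pow_le_pow_left₀ (by positivity) this.le 2
        have h3 : ∑ k ∈ U, z k ^ 2 ≤ 1 :=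
          (Finset.sum_le_univ_sum_of_nonneg fun _ => sq_nonneg _).trans hz
        have h4 := h2.trans h3
        rwa [nsmul_eq_mul, inv_pow, mul_inv_le_iff₀ (by positivity), one_mul] at h4
      -- The last level has no lower bound for its entries, but its cardinality is at most `2 ^ L`.
      · have h2 : (U.card : ℝ) ≤ 2 ^ l := by exact_mod_cast (Finset.card_le_univ U).trans hL
        have h3 : (1 : ℝ) ≤ 2 ^ l := one_le_pow₀ (by norm_num)
        have h4 : ((2 : ℝ) ^ (l + 1)) ^ 2 = 4 * (2 ^ l) ^ 2 := by ring
        nlinarith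
  have havg : ∑ l ∈ Finset.range (L + 1), ((L : ℝ) + 1)⁻¹ • w l ∈ nearCube Y T ρ := by
    refine (convex_nearCube Y T ρ).sum_mem (fun _ _ => by positivity) ?_ hw
    simp
    field_simp
  have hzeq : z = (2 * ((L : ℝ) + 1)) • ∑ l ∈ Finset.range (L + 1), ((L : ℝ) + 1)⁻¹ • w l := by
    funext k
    rw [← Finset.smul_sum]
    simp only [Pi.smul_apply, Finset.sum_apply, smul_eq_mul, w, Finset.sum_ite_eq,
      Finset.mem_range, Nat.lt_succ_iff, hlevL k, if_true]
    field_simp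
  simp only [nearCube, Set.mem_ofPred_eq] at havg ⊢
  conv_lhs => rw [hzeq]
  simp only [map_smul, Pi.smul_apply, smul_eq_mul] at havg ⊢
  simp_rw [excess_mul (by positivity : 0 ≤ 2 * ((L : ℝ) + 1)), mul_pow _ (excess _ _),
    ← Finset.mul_sum]
  gcongr

/-- The bound for unit vectors, rescaled: the excess is homogeneous in threshold and argument
jointly. -/
theorem sum_excess_sq_le_of_signVec {Y : (ι → ℝ) →ₗ[ℝ] (κ → ℝ)} {T ρ : ℝ} (hT : 0 ≤ T)
    (hρ : 0 ≤ ρ) (h : ∀ σ : ι → SignType, σ ≠ 0 → signVec σ ∈ nearCube Y T ρ) {L : ℕ}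
    (hL : Fintype.card ι ≤ 2 ^ L) {z : ι → ℝ} {N : ℝ} (hN : 0 ≤ N) (hz : ∑ k, z k ^ 2 = N ^ 2) :
    ∑ p, excess (2 * (L + 1) * T * N) (Y z p) ^ 2 ≤ (2 * (L + 1)) ^ 2 * ρ * N ^ 2 := by
  rcases hN.eq_or_lt with rfl | hN
  · have : z = 0 := by
      funext k
      rw [zero_pow two_ne_zero, Finset.sum_eq_zero_iff_of_nonneg fun _ _ => sq_nonneg _] at hz
      exact pow_eq_zero_iff two_ne_zero |>.1 (hz k (Finset.mem_univ k))
    simp [this, excess]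
  · have h1 := mem_nearCube_of_sum_sq_le_one hT hρ h hL (z := N⁻¹ • z) (by
      simp only [Pi.smul_apply, smul_eq_mul, mul_pow, ← Finset.mul_sum, hz]
      exact le_of_eq (by field_simp))
    simp only [nearCube, Set.mem_ofPred_eq, map_smul, Pi.smul_apply, smul_eq_mul] at h1
    have h2 : ∀ p, excess (2 * (L + 1) * T * N) (Y z p)
        = N * excess (2 * (L + 1) * T) (N⁻¹ * Y z p) := by
      intro p
      rw [← excess_mul hN.le, mul_inv_cancel_left₀ hN.ne', mul_comm N]
    simp_rw [h2, mul_pow N, ← Finset.mul_sum]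
    rw [mul_comm]
    gcongr

/-- A weighted count of sign vectors. -/
theorem sum_prod_sign_weights_le (n : ℕ) (hn : 0 < n) :
    ∑ σ : Fin n → SignType, ((4 * n : ℝ)⁻¹) ^ suppCard σ ≤ 2 := by
  have h1 : ∀ σ : Fin n → SignType, ((4 * n : ℝ)⁻¹) ^ suppCard σ
      = ∏ k, if σ k ≠ 0 then ((4 * n : ℝ)⁻¹) else 1 := by
    intro σ
    rw [suppCard, Finset.prod_ite, Finset.prod_const, Finset.prod_const_one, mul_one]
  simp_rw [h1]
  -- The weights are products over the coordinates, so the sum factors into `(1 + 2 / (4 * n)) ^ n`.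
  rw [← Fintype.piFinset_univ, ← Finset.prod_univ_sum (fun _ : Fin n => (Finset.univ : Finset SignType))
    (fun _ s => if s ≠ 0 then ((4 * n : ℝ)⁻¹) else 1)]
  have h2 : ∑ s : SignType, (if s ≠ 0 then ((4 * n : ℝ)⁻¹) else 1) = 1 + (2 * n : ℝ)⁻¹ := by
    have hu : (Finset.univ : Finset SignType) = {0, -1, 1} := rfl
    rw [hu]
    simp
    ring
  simp only [h2, Finset.prod_const, Finset.card_univ, Fintype.card_fin]
  have h3 : 1 + (2 * n : ℝ)⁻¹ ≤ Real.exp ((2 * n : ℝ)⁻¹) := by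
    rw [add_comm]; exact Real.add_one_le_exp _
  have hn' : (0 : ℝ) < n := by exact_mod_cast hn
  calc (1 + (2 * n : ℝ)⁻¹) ^ n ≤ Real.exp ((2 * n : ℝ)⁻¹) ^ n := by gcongr
    _ = Real.exp (1 / 2) := by
      rw [← Real.exp_nat_mul]; congr 1; field_simp
    _ ≤ 2 := by
      have h4 : Real.exp (1 / 2) ^ 2 = Real.exp 1 := by
        rw [← Real.exp_nat_mul]; norm_num
      nlinarith [Real.exp_one_lt_d9, Real.exp_pos (1 / 2)]

end Flat

/-! ### The random embedding -/

/-- The coordinates of `x`, copied into all blocks of length `D` and multiplied by `g`. -/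
noncomputable def scaledCopies (D d : ℕ) (g x : ℕ → ℝ) (p : ℕ) : ℝ :=
  if p % D < d then g p * x (p % D) else 0

/-- The embedding of the vector `x 0, ..., x (d - 1)` determined by the numbers `g`. -/
noncomputable def embed (H L d : ℕ) (g x : ℕ → ℝ) : ℕ → ℝ :=
  (butterfly H)^[L] (scaledCopies (2 ^ L) d g x)

/-- A vector as a sequence of numbers. -/
noncomputable def coords {d : ℕ} (z : Fin d → ℝ) (k : ℕ) : ℝ := if h : k < d then z ⟨k, h⟩ else 0

theorem coords_of_lt {d : ℕ} (z : Fin d → ℝ) {k : ℕ} (h : k < d) : coords z k = z ⟨k, h⟩ :=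
  dif_pos h

/-- The embedding as a linear map. -/
noncomputable def embedLin (H L d : ℕ) (g : ℕ → ℝ) : (Fin d → ℝ) →ₗ[ℝ] (Fin (2 * H) → ℝ) where
  toFun z p := embed H L d g (coords z) p
  map_add' x y := by
    have h : scaledCopies (2 ^ L) d g (coords (x + y))
        = scaledCopies (2 ^ L) d g (coords x) + scaledCopies (2 ^ L) d g (coords y) := by
      funext p
      simp only [scaledCopies, coords, Pi.add_apply]
      split_ifs <;> ring
    funext p
    simp only [embed, h, iterate_butterfly_add, Pi.add_apply]
  map_smul' c x := by
    have h : scaledCopies (2 ^ L) d g (coords (c • x))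
        = c • scaledCopies (2 ^ L) d g (coords x) := by
      funext p
      simp only [scaledCopies, coords, Pi.smul_apply, smul_eq_mul]
      split_ifs <;> ring
    funext p
    simp only [embed, h, iterate_butterfly_smul, Pi.smul_apply, RingHom.id_apply]

theorem sum_range_coords {d D : ℕ} (hd : d ≤ D) (f : ℕ → ℝ → ℝ) (hf : ∀ u, f u 0 = 0)
    (z : Fin d → ℝ) :
    ∑ u ∈ Finset.range D, f u (if u < d then coords z u else 0) = ∑ k : Fin d, f k (z k) := by
  rw [← Finset.sum_subset (Finset.range_subset_range.2 hd), Finset.sum_range]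
  · refine Finset.sum_congr rfl fun k _ => ?_
    rw [if_pos k.2, coords_of_lt z k.2]
  · intro u _ hu
    rw [if_neg (by simpa using hu), hf]

theorem scaledCopies_block {D d : ℕ} (g x : ℕ → ℝ) {j u : ℕ} (hu : u < D) :
    scaledCopies D d g x (D * j + u) = g (D * j + u) * (if u < d then x u else 0) := by
  rw [scaledCopies, Nat.mul_add_mod, Nat.mod_eq_of_lt hu]
  split_ifs <;> simp

/-- Every step of the transform doubles the sum of squares, so the result is a diagonal quadratic
form in `z`. Controlling its `d` coefficients controls the lengths of all images at once. -/
theorem sum_embed_sq {H L d m : ℕ} (hd : d ≤ 2 ^ L) (hm : 2 * H = 2 ^ L * m) (g : ℕ → ℝ)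
    (z : Fin d → ℝ) :
    ∑ p, embedLin H L d g z p ^ 2
      = 2 ^ L * ∑ k : Fin d, z k ^ 2 * ∑ j ∈ Finset.range m, g (2 ^ L * j + k) ^ 2 := by
  have h1 : ∑ p, embedLin H L d g z p ^ 2
      = ∑ p ∈ Finset.range (2 * H), embed H L d g (coords z) p ^ 2 :=
    Fin.sum_univ_eq_sum_range (fun p => embed H L d g (coords z) p ^ 2) (2 * H)
  rw [h1]
  unfold embed
  rw [sum_iterate_butterfly_sq, hm, sum_range_mul_eq]
  congr 1
  simp_rw [Finset.mul_sum]
  rw [Finset.sum_comm (s := Finset.univ)]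
  refine Finset.sum_congr rfl fun j _ => ?_
  rw [← sum_range_coords hd (fun u y => y ^ 2 * g (2 ^ L * j + u) ^ 2) (by simp)]
  refine Finset.sum_congr rfl fun u hu => ?_
  rw [scaledCopies_block g _ (Finset.mem_range.1 hu)]
  ring

/-- Each coordinate of the embedding of `z` is the inner product of the vector of the seeds with a
vector of the same length as `z`. -/
theorem exists_embed_eq_inner {H L d m : ℕ} (hd : d ≤ 2 ^ L) (hm : 2 * H = 2 ^ L * m)
    (z : Fin d → ℝ) :
    ∃ b : Fin (2 * H) → EuclideanSpace ℝ (Fin (2 * H)), (∀ p, ‖b p‖ ^ 2 = ∑ k, z k ^ 2) ∧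
      ∀ (g : ℕ → ℝ) p, embedLin H L d g z p =
        inner ℝ (b p) (WithLp.toLp 2 fun q : Fin (2 * H) => g q) := by
  obtain ⟨s, hs, hx⟩ := exists_sign_iterate_butterfly H L m hm
  set D := 2 ^ L with hD
  have hD0 : 0 < D := by positivity
  -- Row `p` vanishes outside block `p % m`, where it consists of the entries of `z` up to sign.
  let β : ℕ → ℕ → ℝ := fun p q =>
    if q / D = p % m then s p (q % D) * (if q % D < d then coords z (q % D) else 0) else 0
  have hβ : ∀ p j u, u < D → β p (D * j + u) =
      if j = p % m then s p u * (if u < d then coords z u else 0) else 0 := by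
    intro p j u hu
    simp only [β, Nat.mul_add_mod, Nat.mod_eq_of_lt hu, Nat.mul_add_div hD0, Nat.div_eq_of_lt hu,
      add_zero]
  have hr : ∀ f : ℕ → ℝ, ∑ q ∈ Finset.range (2 * H), f q
      = ∑ j ∈ Finset.range m, ∑ u ∈ Finset.range D, f (D * j + u) := fun f => by
    rw [hm, sum_range_mul_eq]
  have hmod : ∀ p, p < 2 * H → p % m ∈ Finset.range m := by
    intro p hp
    refine Finset.mem_range.2 (Nat.mod_lt _ (Nat.pos_of_ne_zero fun h => ?_))
    rw [h, mul_zero] at hm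
    omega
  refine ⟨fun p => WithLp.toLp 2 fun q => β p q, fun p => ?_, fun g p => ?_⟩
  · rw [EuclideanSpace.real_norm_sq_eq]
    simp only
    rw [Fin.sum_univ_eq_sum_range (fun q => β p q ^ 2) (2 * H), hr,
      Finset.sum_eq_single_of_mem _ (hmod p p.2)]
    · rw [← sum_range_coords hd (fun _ y => y ^ 2) (by simp)]
      refine Finset.sum_congr rfl fun u hu => ?_
      rw [hβ _ _ _ (Finset.mem_range.1 hu), if_pos rfl, mul_pow, hs, one_mul]
    · intro j _ hj
      refine Finset.sum_eq_zero fun u hu => ?_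
      rw [hβ _ _ _ (Finset.mem_range.1 hu), if_neg hj, zero_pow two_ne_zero]
  · have h1 : inner ℝ (WithLp.toLp 2 fun q : Fin (2 * H) => β p q)
        (WithLp.toLp 2 fun q : Fin (2 * H) => g q) = ∑ q : Fin (2 * H), β p q * g q := by
      simp [PiLp.inner_apply, mul_comm]
    rw [h1, Fin.sum_univ_eq_sum_range (fun q => β p q * g q) (2 * H), hr,
      Finset.sum_eq_single_of_mem _ (hmod p p.2)]
    · change (butterfly H)^[L] _ _ = _
      rw [hx _ _ p.2]
      refine Finset.sum_congr rfl fun u hu => ?_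
      rw [hβ _ _ _ (Finset.mem_range.1 hu), if_pos rfl,
        scaledCopies_block g _ (Finset.mem_range.1 hu)]
      ring
    · intro j _ hj
      refine Finset.sum_eq_zero fun u hu => ?_
      rw [hβ _ _ _ (Finset.mem_range.1 hu), if_neg hj, zero_mul]

/-- The Gaussian seeds of the embedding, as read from the tape. -/
def seeds (ω : Tape) (p : ℕ) : ℝ := (ω p).1

theorem map_seeds_tapeLaw (n : ℕ) :
    tapeLaw.map (fun ω : Tape => (WithLp.toLp 2 fun q : Fin n => seeds ω q : EuclideanSpace ℝ (Fin n)))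
      = stdGaussian (EuclideanSpace ℝ (Fin n)) := by
  have h1 : iIndepFun (fun (q : Fin n) (ω : Tape) => seeds ω q) tapeLaw :=
    (iIndepFun_tapeLaw measurable_fst).precomp Fin.val_injective
  have hm : ∀ q : Fin n, Measurable fun ω : Tape => seeds ω q := fun q =>
    measurable_fst.comp (measurable_pi_apply _)
  have h2 := (iIndepFun_iff_map_fun_eq_pi_map fun q => (hm q).aemeasurable).1 h1
  have h3 : ∀ q : Fin n, tapeLaw.map (fun ω : Tape => seeds ω q) = gaussianReal 0 1 :=
    fun q => map_gauss_tapeLaw q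
  simp_rw [h3] at h2
  rw [← map_pi_eq_stdGaussian, ← h2, Measure.map_map (by fun_prop) (measurable_pi_lambda _ hm)]
  rfl

/-! ### The probability of good seeds. -/

/-- Seeds for which the embedding is nearly isometric, and for which no embedded sign vector has
many large coordinates. -/
structure GoodSeeds (H L d m : ℕ) (η T ρ : ℝ) (g : ℕ → ℝ) : Prop where
  column : ∀ k < d, |∑ j ∈ Finset.range m, g (2 ^ L * j + k) ^ 2 - m| < m * η
  flat : ∀ σ : Fin d → SignType, σ ≠ 0 → signVec σ ∈ nearCube (embedLin H L d g) T ρ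

theorem suppCard_pos {d : ℕ} {σ : Fin d → SignType} (hσ : σ ≠ 0) : 0 < suppCard σ := by
  obtain ⟨k, hk⟩ := Function.ne_iff.1 hσ
  exact Finset.card_pos.2 ⟨k, Finset.mem_filter.2 ⟨Finset.mem_univ _, hk⟩⟩

theorem sum_signVec_sq {d : ℕ} {σ : Fin d → SignType} (hσ : σ ≠ 0) :
    ∑ k, signVec σ k ^ 2 = 1 := by
  have hs : (0 : ℝ) < suppCard σ := by exact_mod_cast suppCard_pos hσ
  have h1 : ∀ k, signVec σ k ^ 2 = if σ k ≠ 0 then (suppCard σ : ℝ)⁻¹ else 0 := by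
    intro k
    rw [signVec, div_pow, Real.sq_sqrt hs.le]
    rcases h : σ k <;> simp
  simp_rw [h1]
  rw [← Finset.sum_filter, Finset.sum_const, nsmul_eq_mul]
  exact mul_inv_cancel₀ hs.ne'

theorem signVec_sq_le {d : ℕ} {σ : Fin d → SignType} (k : Fin d) :
    signVec σ k ^ 2 ≤ (suppCard σ : ℝ)⁻¹ := by
  rw [signVec, div_pow, Real.sq_sqrt (Nat.cast_nonneg _), div_eq_mul_inv]
  refine mul_le_of_le_one_left (by positivity) ?_
  rcases σ k <;> simp

/-- The sparser the vector, the larger its Lipschitz constant `√(D / s)`, but the fewer such vectors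
there are. A deviation `t` with `t ^ 2` of order `D * log (d / δ)` suffices for every support size
`s`. -/
theorem measure_signVec_not_mem_nearCube_le {H L d m : ℕ} (hd0 : 0 < d) (hd : d ≤ 2 ^ L)
    (hm : 2 * H = 2 ^ L * m) (hm0 : 0 < m) {δ : ℝ} (hδ0 : 0 < δ) (hδ : δ < 1 / 2) {T : ℝ}
    (hT0 : 0 ≤ T) (hT : T ^ 2 = 8 * Real.log (12 * m)) {σ : Fin d → SignType} (hσ : σ ≠ 0) :
    tapeLaw {ω | signVec σ ∉ nearCube (embedLin H L d (seeds ω)) T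
        (14 * 2 ^ L * Real.log (32 * d / δ))}
      ≤ ENNReal.ofReal (δ / 4 * ((4 * d : ℝ)⁻¹) ^ suppCard σ) := by
  obtain ⟨b, hb, hbe⟩ := exists_embed_eq_inner hd hm (signVec σ)
  have hsn := suppCard_pos hσ
  have hs : (0 : ℝ) < suppCard σ := by exact_mod_cast hsn
  have hd1 : (1 : ℝ) ≤ d := by exact_mod_cast hd0
  set s : ℝ := (suppCard σ : ℝ) with hsdef
  set D : ℝ := 2 ^ L with hD
  have hD0 : 0 < D := by positivity
  have hm0' : (0 : ℝ) < m := by exact_mod_cast hm0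
  have hb1 : ∀ p, ‖b p‖ = 1 := fun p => by
    have h1 := hb p
    rw [sum_signVec_sq hσ] at h1
    exact (pow_eq_one_iff_of_nonneg (norm_nonneg _) two_ne_zero).1 h1
  -- The coefficient of each seed in the quadratic form is at most `D / s`, because the squares of
  -- the entries of the sign vector are at most `1 / s`.
  have hbΛ : ∀ x, ∑ p, inner ℝ (b p) x ^ 2 ≤ Real.sqrt (D / s) ^ 2 * ‖x‖ ^ 2 := by
    intro x
    let g : ℕ → ℝ := fun q => if h : q < 2 * H then x ⟨q, h⟩ else 0
    have hgx : (WithLp.toLp 2 fun q : Fin (2 * H) => g q) = x := by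
      ext q
      simp [g]
    have h1 := sum_embed_sq hd hm g (signVec σ)
    simp_rw [hbe, hgx] at h1
    rw [h1, Real.sq_sqrt (by positivity), EuclideanSpace.real_norm_sq_eq]
    have h2 : ∑ q : Fin (2 * H), x q ^ 2 = ∑ q ∈ Finset.range (2 * H), g q ^ 2 := by
      rw [Finset.sum_range]
      simp [g]
    rw [h2, hm, sum_range_mul_eq, div_mul_eq_mul_div, ← mul_div_assoc', div_eq_mul_inv]
    refine mul_le_mul_of_nonneg_left ?_ hD0.le
    calc ∑ k : Fin d, signVec σ k ^ 2 * ∑ j ∈ Finset.range m, g (2 ^ L * j + k) ^ 2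
        ≤ ∑ k : Fin d, s⁻¹ * ∑ j ∈ Finset.range m, g (2 ^ L * j + k) ^ 2 := by
          gcongr with k
          exact signVec_sq_le k
      _ = (∑ j ∈ Finset.range m, ∑ k : Fin d, g (2 ^ L * j + k) ^ 2) * s⁻¹ := by
          rw [← Finset.mul_sum, Finset.sum_comm, mul_comm]
      _ ≤ _ := by
          gcongr with j
          rw [Fin.sum_univ_eq_sum_range (fun k => g (2 ^ L * j + k) ^ 2) d]
          exact Finset.sum_le_sum_of_subset_of_nonneg (Finset.range_subset_range.2 hd)
            fun _ _ _ => sq_nonneg _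
  have hl4 : 4 ≤ Real.log (32 * d / δ) := by
    rw [Real.le_log_iff_exp_le (by positivity)]
    have h1 : Real.exp 4 = Real.exp 1 ^ 4 := by rw [← Real.exp_nat_mul]; norm_num
    have h2 : Real.exp 1 ^ 4 ≤ 2.7182818286 ^ 4 :=
      pow_le_pow_left₀ (Real.exp_pos 1).le Real.exp_one_lt_d9.le 4
    rw [h1, le_div_iff₀ hδ0]
    norm_num at h2
    nlinarith
  set l4 := Real.log (4 * d) with hl4def
  set l8 := Real.log (8 / δ) with hl8def
  have hl : Real.log (32 * d / δ) = l4 + l8 := by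
    rw [← Real.log_mul (by positivity) (by positivity)]; congr 1; ring
  have h40 : 0 ≤ l4 := Real.log_nonneg (by linarith)
  have h80 : 0 ≤ l8 := Real.log_nonneg (by rw [le_div_iff₀ hδ0]; linarith)
  -- Chosen so that `2 * exp (-t ^ 2 / (5 * D / s))` equals `2 * (4 * d) ^ (-s) * (δ / 8)`.
  set t := Real.sqrt (5 * (D / s) * (s * l4 + l8)) with ht
  have ht2 : t ^ 2 = 5 * (D / s) * (s * l4 + l8) := Real.sq_sqrt (by positivity)
  -- The threshold `T ^ 2 = 8 * log (12 * m)` makes the expected squared excess of all `D * m`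
  -- coordinates at most `D`.
  have hη : Fintype.card (Fin (2 * H)) * (12 * Real.exp (-(T ^ 2 / 8))) ≤ D := by
    rw [Fintype.card_fin, hm, hT, mul_div_cancel_left₀ _ (by norm_num : (8 : ℝ) ≠ 0), Real.exp_neg,
      Real.exp_log (by positivity)]
    push_cast
    rw [← hD]
    exact le_of_eq (by field_simp)
  have hmain := measure_sum_excess_sq_ge_le hb1 (Real.sqrt_pos.2 (div_pos hD0 hs)) hbΛ hT0 hD0 hη
    (Real.sqrt_nonneg _ : 0 ≤ t)
  have hcont : Continuous fun x : EuclideanSpace ℝ (Fin (2 * H)) =>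
      ∑ p, excess T (inner ℝ (b p) x) ^ 2 := by
    have := continuous_excess T
    fun_prop
  rw [← map_seeds_tapeLaw, Measure.map_apply _ (measurableSet_le measurable_const hcont.measurable)]
    at hmain
  swap
  · have hm : ∀ q : Fin (2 * H), Measurable fun ω : Tape => seeds ω q := fun q =>
      measurable_fst.comp (measurable_pi_apply _)
    fun_prop
  refine (measure_mono fun ω hω => ?_).trans (hmain.trans (ENNReal.ofReal_le_ofReal (le_of_eq ?_)))
  · have hω : ¬ (∑ p, excess T (embedLin H L d (seeds ω) (signVec σ) p) ^ 2
      ≤ 14 * D * Real.log (32 * d / δ)) := hω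
    change _ ≤ ∑ p, excess T (inner ℝ (b p) _) ^ 2
    simp_rw [hbe] at hω
    refine le_trans ?_ (not_le.1 hω).le
    have hsq : Real.sqrt (2 * D) ^ 2 = 2 * D := Real.sq_sqrt (by positivity)
    have ht3 : t ^ 2 ≤ 5 * D * (l4 + l8) := by
      rw [ht2]
      have h1 : D / s * (s * l4 + l8) = D * (l4 + l8 / s) := by field_simp
      have hs1 : (1 : ℝ) ≤ s := by rw [hsdef]; exact_mod_cast hsn
      have h2 : l8 / s ≤ l8 := div_le_self h80 hs1
      rw [mul_assoc, h1, mul_assoc]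
      gcongr
    rw [hl] at hl4 ⊢
    -- `(2 * √(2 * D) + t) ^ 2 ≤ 16 * D + 2 * t ^ 2 ≤ 16 * D + 10 * D * l`, where `l` is the
    -- logarithm; this is at most `14 * D * l` because `l ≥ 4`.
    nlinarith [sq_nonneg (2 * Real.sqrt (2 * D) - t)]
  · rw [ht2, Real.sq_sqrt (by positivity)]
    have h1 : 5 * (D / s) * (s * l4 + l8) / (5 * (D / s)) = s * l4 + l8 := by field_simp
    rw [h1, neg_add, Real.exp_add, hl8def, Real.exp_neg (Real.log _), Real.exp_log (by positivity),
      ← mul_neg, hsdef, Real.exp_nat_mul, Real.exp_neg, hl4def, Real.exp_log (by positivity)]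
    field_simp
    norm_num

/-- Half of `δ` goes to the `d` column sums, `δ / (2 * d)` each. The other half goes to the sign
vectors, whose weights sum to at most 2. -/
theorem measure_not_goodSeeds_le {H L d m : ℕ} (hd0 : 0 < d) (hd : d ≤ 2 ^ L)
    (hm : 2 * H = 2 ^ L * m) (hm0 : 0 < m) {δ : ℝ} (hδ0 : 0 < δ) (hδ : δ < 1 / 2) {T : ℝ}
    (hT0 : 0 ≤ T) (hT : T ^ 2 = 8 * Real.log (12 * m)) {η : ℝ} (hη0 : 0 ≤ η) (hη1 : η ≤ 1)
    (hmη : 8 * Real.log (4 * d / δ) ≤ m * η ^ 2) :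
    tapeLaw {ω | ¬ GoodSeeds H L d m η T (14 * 2 ^ L * Real.log (32 * d / δ)) (seeds ω)}
      ≤ ENNReal.ofReal δ := by
  have hd1 : (0 : ℝ) < d := by exact_mod_cast hd0
  have hsub : {ω | ¬ GoodSeeds H L d m η T (14 * 2 ^ L * Real.log (32 * d / δ)) (seeds ω)} ⊆
      (⋃ k ∈ Finset.range d, {ω : Tape | m * η ≤
        |∑ j ∈ Finset.range m, seeds ω (2 ^ L * j + k) ^ 2 - m|}) ∪
      ⋃ σ ∈ (Finset.univ.filter fun σ : Fin d → SignType => σ ≠ 0),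
        {ω | signVec σ ∉ nearCube (embedLin H L d (seeds ω)) T
          (14 * 2 ^ L * Real.log (32 * d / δ))} := by
    intro ω hω
    by_contra hcon
    simp only [Set.mem_union, Set.mem_iUnion, not_or, not_exists, Set.mem_ofPred_eq, not_le,
      Finset.mem_range, Finset.mem_filter, Finset.mem_univ, true_and, not_not] at hcon
    exact hω ⟨fun k hk => hcon.1 k hk, fun σ hσ => hcon.2 σ hσ⟩
  have hcol : ∀ k ∈ Finset.range d, tapeLaw {ω : Tape | m * η ≤
      |∑ j ∈ Finset.range m, seeds ω (2 ^ L * j + k) ^ 2 - m|} ≤ ENNReal.ofReal (δ / (2 * d)) := by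
    intro k _
    have hinj : Function.Injective fun j => 2 ^ L * j + k := fun i j hij => by
      have : 2 ^ L * i = 2 ^ L * j := Nat.add_right_cancel hij
      exact Nat.eq_of_mul_eq_mul_left (by positivity) this
    have h1 := measure_abs_sum_gauss_sq_sub_ge_le
      ((Finset.range m).map ⟨fun j => 2 ^ L * j + k, hinj⟩) hη0 hη1
    simp only [Finset.card_map, Finset.card_range, Finset.sum_map, Function.Embedding.coeFn_mk]
      at h1
    refine h1.trans (ENNReal.ofReal_le_ofReal ?_)
    have h2 : Real.exp (-(m * η ^ 2 / 8)) ≤ Real.exp (-(Real.log (4 * d / δ))) :=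
      Real.exp_le_exp.2 (by linarith)
    rw [Real.exp_neg (Real.log _), Real.exp_log (by positivity)] at h2
    refine (mul_le_mul_of_nonneg_left h2 zero_le_two).trans (le_of_eq ?_)
    field_simp
    norm_num
  refine (measure_mono hsub).trans ((measure_union_le _ _).trans ?_)
  refine (add_le_add ((measure_biUnion_finset_le _ _).trans (Finset.sum_le_sum hcol))
    ((measure_biUnion_finset_le _ _).trans (Finset.sum_le_sum fun σ hσ =>
      measure_signVec_not_mem_nearCube_le hd0 hd hm hm0 hδ0 hδ hT0 hT
        (Finset.mem_filter.1 hσ).2))).trans ?_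
  rw [← ENNReal.ofReal_sum_of_nonneg fun _ _ => by positivity,
    ← ENNReal.ofReal_sum_of_nonneg fun _ _ => by positivity, ← ENNReal.ofReal_add
      (Finset.sum_nonneg fun _ _ => by positivity) (Finset.sum_nonneg fun _ _ => by positivity)]
  refine ENNReal.ofReal_le_ofReal ?_
  have h1 := sum_prod_sign_weights_le d hd0
  have h2 : ∑ σ ∈ (Finset.univ.filter fun σ : Fin d → SignType => σ ≠ 0),
      δ / 4 * ((4 * d : ℝ)⁻¹) ^ suppCard σ ≤ δ / 4 * 2 := by
    refine (Finset.sum_le_univ_sum_of_nonneg fun _ => by positivity).trans ?_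
    rw [← Finset.mul_sum]
    gcongr
  have h3 : ∑ _k ∈ Finset.range d, δ / (2 * d) = δ / 2 := by
    rw [Finset.sum_const, Finset.card_range, nsmul_eq_mul]
    field_simp
  linarith

/-! ### Uniform sampling -/

theorem measurable_pick (k : ℕ) : Measurable fun u : ℝ => pick u k := by
  unfold pick
  exact (Nat.measurable_floor.comp (measurable_id.mul_const _)).min measurable_const

theorem pick_lt {k : ℕ} (hk : 0 < k) (u : ℝ) : pick u k < k := by
  unfold pick; omega

theorem volume_pick_eq {k i : ℕ} (hi : i < k) :
    (volume.restrict (Set.Icc (0 : ℝ) 1)) {u | pick u k = i} = ENNReal.ofReal (1 / k) := by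
  have hk : (0 : ℝ) < k := by exact_mod_cast (Nat.zero_le i).trans_lt hi
  have hik : (i : ℝ) + 1 ≤ k := by exact_mod_cast hi
  have h1 : {u : ℝ | pick u k = i} =ᵐ[volume.restrict (Set.Icc (0 : ℝ) 1)]
      Set.Ico ((i : ℝ) / k) ((i + 1) / k) := by
    -- On `[0, 1]`, the cap `k - 1` in `pick` takes effect only at `u = 1`, a null set.
    have h2 : ∀ᵐ u ∂(volume.restrict (Set.Icc (0 : ℝ) 1)), u ≠ 1 := by
      refine ae_restrict_of_ae ?_
      simp [ae_iff]
    filter_upwards [h2, ae_restrict_mem measurableSet_Icc] with u hu1 hu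
    have hu1 : u < 1 := lt_of_le_of_ne hu.2 hu1
    have h3 : ⌊u * k⌋₊ < k := by
      rw [Nat.floor_lt (mul_nonneg hu.1 hk.le)]
      nlinarith
    have h4 : pick u k = ⌊u * k⌋₊ := by unfold pick; omega
    refine propext ?_
    change pick u k = i ↔ u ∈ Set.Ico ((i : ℝ) / k) ((i + 1) / k)
    rw [h4, Nat.floor_eq_iff (mul_nonneg hu.1 hk.le), Set.mem_Ico, div_le_iff₀ hk, lt_div_iff₀ hk]
  rw [measure_congr h1, Measure.restrict_apply measurableSet_Ico, Set.inter_eq_left.2,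
    Real.volume_Ico]
  · congr 1; field_simp; ring
  · intro u hu
    refine ⟨le_trans (by positivity) hu.1, hu.2.le.trans ?_⟩
    rw [div_le_one hk]; exact hik

/-- The element of `{0, ..., M - 1}` drawn with the entry `t` of the tape. -/
noncomputable def sample (M : ℕ) (ω : Tape) (t : ℕ) : ℕ := pick (ω t).2 M

theorem measurable_sample (M t : ℕ) : Measurable fun ω : Tape => sample M ω t :=
  (measurable_pick M).comp (measurable_snd.comp (measurable_pi_apply t))

theorem map_unif_tapeLaw (p : ℕ) :
    tapeLaw.map (fun ω : Tape => (ω p).2) = volume.restrict (Set.Icc (0 : ℝ) 1) := by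
  have : IsProbabilityMeasure (volume.restrict (Set.Icc (0 : ℝ) 1)) := by constructor; simp
  have h1 : tapeLaw.map (fun ω : Tape => ω p) = _ := Measure.infinitePi_map_eval _ p
  have h2 := Measure.map_map (μ := tapeLaw) (g := Prod.snd) (f := fun ω : Tape => ω p)
    measurable_snd (measurable_pi_apply p)
  rw [h1, Measure.map_snd_prod] at h2
  simpa [Function.comp_def] using h2.symm

theorem measure_sample_eq {M i : ℕ} (hi : i < M) (t : ℕ) :
    tapeLaw {ω | sample M ω t = i} = ENNReal.ofReal (1 / M) := by
  rw [← volume_pick_eq hi, ← map_unif_tapeLaw t]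
  exact (Measure.map_apply (by fun_prop : Measurable fun ω : Tape => (ω t).2)
    (measurable_pick M (measurableSet_singleton i))).symm

theorem measure_sample_mem_le {M : ℕ} (B : Finset ℕ) (hB : B ⊆ Finset.range M) (t : ℕ) :
    tapeLaw {ω | sample M ω t ∈ B} ≤ ENNReal.ofReal (B.card / M) := by
  have h1 : {ω : Tape | sample M ω t ∈ B} ⊆ ⋃ i ∈ B, {ω | sample M ω t = i} := by
    intro ω hω
    simpa using hω
  refine (measure_mono h1).trans ((measure_biUnion_finset_le _ _).trans ?_)
  rw [Finset.sum_congr rfl fun i hi => measure_sample_eq (Finset.mem_range.1 (hB hi)) t,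
    ← ENNReal.ofReal_sum_of_nonneg fun _ _ => by positivity]
  refine ENNReal.ofReal_le_ofReal (le_of_eq ?_)
  rw [Finset.sum_const, nsmul_eq_mul]
  ring

theorem integral_sample {M : ℕ} (hM : 0 < M) (f : ℕ → ℝ) (t : ℕ) :
    ∫ ω, f (sample M ω t) ∂tapeLaw = (∑ p ∈ Finset.range M, f p) / M := by
  have h1 : ∀ ω : Tape, f (sample M ω t)
      = ∑ p ∈ Finset.range M, Set.indicator {ω | sample M ω t = p} (fun _ => f p) ω := by
    intro ω
    rw [Finset.sum_eq_single_of_mem (sample M ω t) (Finset.mem_range.2 (pick_lt hM _))]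
    · simp
    · intro p _ hp
      rw [Set.indicator_of_notMem]
      exact fun h => hp h.symm
  have hms : ∀ p, MeasurableSet {ω : Tape | sample M ω t = p} := fun p =>
    measurable_sample M t (measurableSet_singleton p)
  simp_rw [h1]
  rw [integral_finsetSum _ fun p _ => (integrable_const (f p)).indicator (hms p), Finset.sum_div]
  refine Finset.sum_congr rfl fun p hp => ?_
  rw [integral_indicator_const _ (hms p), measureReal_def,
    measure_sample_eq (Finset.mem_range.1 hp), ENNReal.toReal_ofReal (by positivity), smul_eq_mul]
  ring

/-- The mean of `y ^ 2` over the `G` samples drawn from position `s` of the tape on. -/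
noncomputable def groupMean (M G : ℕ) (y : ℕ → ℝ) (ω : Tape) (s : ℕ) : ℝ :=
  (∑ t ∈ Finset.range G, y (sample M ω (s + t)) ^ 2) / G

/-- The mean of few bounded samples is close to its expectation. -/
theorem measure_sample_mean_ge_le {M G : ℕ} (hM : 0 < M) (hG : 0 < G) {h : ℕ → ℝ} {b e : ℝ}
    (h0 : ∀ p, 0 ≤ h p) (hb : ∀ p, h p ≤ b) (he : (∑ p ∈ Finset.range M, h p) / M = e) {c : ℝ}
    (hc : 0 < c) (s : ℕ) :
    tapeLaw {ω | c ≤ |(∑ t ∈ Finset.range G, h (sample M ω (s + t))) / G - e|}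
      ≤ ENNReal.ofReal (b * e / (G * c ^ 2)) := by
  have hG' : (0 : ℝ) < G := by exact_mod_cast hG
  have hb0 : 0 ≤ b := (h0 0).trans (hb 0)
  let X : ℕ → Tape → ℝ := fun t ω => h (sample M ω (s + t))
  have hind : iIndepFun X tapeLaw :=
    (iIndepFun_tapeLaw (f := fun x : ℝ × ℝ => h (pick x.2 M))
      (measurable_from_nat.comp ((measurable_pick M).comp measurable_snd))).precomp
      (add_right_injective s)
  have hmeas : ∀ t, Measurable (X t) := fun t => measurable_from_nat.comp (measurable_sample M _)
  have hmem : ∀ t, MemLp (X t) 2 tapeLaw := fun t =>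
    memLp_of_bounded (ae_of_all _ fun ω => ⟨h0 _, hb _⟩) (hmeas t).aestronglyMeasurable 2
  -- The variance is at most the second moment, and `h ^ 2 ≤ b * h`.
  have hvar1 : ∀ t, variance (X t) tapeLaw ≤ b * e := by
    intro t
    refine (variance_le_expectation_sq (hmeas t).aestronglyMeasurable).trans ?_
    have h1 : ∫ ω, (X t ^ 2) ω ∂tapeLaw = (∑ p ∈ Finset.range M, h p ^ 2) / M :=
      integral_sample hM (fun p => h p ^ 2) (s + t)
    rw [h1, ← he, mul_div_assoc', Finset.mul_sum]
    gcongr with p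
    rw [sq]
    exact mul_le_mul_of_nonneg_right (hb p) (h0 p)
  have hvar : variance (∑ t ∈ Finset.range G, X t) tapeLaw ≤ G * (b * e) := by
    rw [IndepFun.variance_sum (fun t _ => hmem t) fun i _ j _ hij => hind.indepFun hij]
    refine (Finset.sum_le_sum fun t _ => hvar1 t).trans (le_of_eq ?_)
    simp
  have hmean : ∫ ω, (∑ t ∈ Finset.range G, X t) ω ∂tapeLaw = G * e := by
    simp only [Finset.sum_apply]
    rw [integral_finsetSum _ fun t _ => (hmem t).integrable (by norm_num)]
    have h1 : ∀ t, ∫ ω, X t ω ∂tapeLaw = e := fun t => (integral_sample hM h (s + t)).trans he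
    simp [h1]
  have hch := meas_ge_le_variance_div_sq (memLp_finsetSum' (Finset.range G) fun t _ => hmem t)
    (mul_pos hG' hc)
  rw [hmean] at hch
  refine (measure_mono fun ω hω => ?_).trans (hch.trans (ENNReal.ofReal_le_ofReal ?_))
  · have hω : c ≤ |(∑ t ∈ Finset.range G, h (sample M ω (s + t))) / G - e| := hω
    simp only [Set.mem_ofPred_eq, Finset.sum_apply]
    change G * c ≤ |∑ t ∈ Finset.range G, h (sample M ω (s + t)) - G * e|
    have h2 : ∑ t ∈ Finset.range G, h (sample M ω (s + t)) - G * e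
        = G * ((∑ t ∈ Finset.range G, h (sample M ω (s + t))) / G - e) := by field_simp
    rw [h2, abs_mul, abs_of_pos hG']
    gcongr
  · refine (div_le_div_of_nonneg_right hvar (by positivity)).trans (le_of_eq ?_)
    field_simp

/-! ### Sampling the coordinates of a vector with few large entries. -/

/-- The square of `y`, replaced by zero if it is large. -/
noncomputable def truncSq (τ y : ℝ) : ℝ := if |y| ≤ 2 * τ then y ^ 2 else 0

theorem truncSq_nonneg (τ y : ℝ) : 0 ≤ truncSq τ y := by
  unfold truncSq; split_ifs <;> positivity

theorem truncSq_le {τ : ℝ} (y : ℝ) : truncSq τ y ≤ 4 * τ ^ 2 := by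
  unfold truncSq
  split_ifs with h
  · rw [← sq_abs]
    nlinarith [abs_nonneg y]
  · positivity

/-- Truncation happens at twice the threshold because beyond `2 * τ` the excess is at least half of
`|y|`, and at least `τ`. So the bound on the squared excesses controls both the mass and the number
of the truncated entries. -/
theorem le_excess_sq {τ y : ℝ} (hτ : 0 < τ) (h : 2 * τ < |y|) :
    y ^ 2 ≤ 4 * excess τ y ^ 2 ∧ τ ^ 2 ≤ excess τ y ^ 2 := by
  have h2 : |y| - τ ≤ excess τ y := le_max_left _ _
  rw [← sq_abs y]
  constructor <;> nlinarith

/-- The indices of the large entries of `y`. -/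
noncomputable def largeSet (M : ℕ) (τ : ℝ) (y : ℕ → ℝ) : Finset ℕ :=
  (Finset.range M).filter fun p => 2 * τ < |y p|

theorem card_largeSet_mul_le {M : ℕ} {y : ℕ → ℝ} {τ E : ℝ} (hτ : 0 < τ)
    (hE : ∑ p ∈ Finset.range M, excess τ (y p) ^ 2 ≤ E) : (largeSet M τ y).card * τ ^ 2 ≤ E := by
  have h1 := Finset.card_nsmul_le_sum (largeSet M τ y) (fun p => excess τ (y p) ^ 2) (τ ^ 2)
    fun p hp => (le_excess_sq hτ (Finset.mem_filter.1 hp).2).2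
  rw [nsmul_eq_mul] at h1
  exact h1.trans ((Finset.sum_le_sum_of_subset_of_nonneg (Finset.filter_subset _ _)
      fun _ _ _ => sq_nonneg _).trans hE)

theorem sum_truncSq_mem {M : ℕ} {y : ℕ → ℝ} {τ E : ℝ} (hτ : 0 < τ)
    (hE : ∑ p ∈ Finset.range M, excess τ (y p) ^ 2 ≤ E) :
    ∑ p ∈ Finset.range M, y p ^ 2 - 4 * E ≤ ∑ p ∈ Finset.range M, truncSq τ (y p) ∧
      ∑ p ∈ Finset.range M, truncSq τ (y p) ≤ ∑ p ∈ Finset.range M, y p ^ 2 := by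
  constructor
  · rw [sub_le_iff_le_add]
    refine le_trans ?_ (add_le_add_right (mul_le_mul_of_nonneg_left hE zero_le_four) _)
    rw [Finset.mul_sum, ← Finset.sum_add_distrib]
    refine Finset.sum_le_sum fun p _ => ?_
    by_cases hp : |y p| ≤ 2 * τ
    · simp only [truncSq, hp, if_true]
      have := sq_nonneg (excess τ (y p))
      linarith
    · simp only [truncSq, hp, if_false, zero_add]
      exact (le_excess_sq hτ (not_le.1 hp)).1
  · refine Finset.sum_le_sum fun p _ => ?_
    unfold truncSq
    split_ifs
    exacts [le_rfl, sq_nonneg _]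

/-- If `y` has few large coordinates, then the mean of few random squares of coordinates of `y` is
close to the mean of all of them with large probability. -/
theorem measure_groupMean_not_mem_le {M G : ℕ} (hM : 0 < M) (hG : 0 < G) {y : ℕ → ℝ}
    {N ε τ E : ℝ} (hN : 0 < N) (hε : 0 < ε) (hε1 : ε < 1 / 2) (hτ : 0 < τ)
    (hmean : |∑ p ∈ Finset.range M, y p ^ 2 - M * N ^ 2| ≤ ε / 8 * (M * N ^ 2))
    (hE : ∑ p ∈ Finset.range M, excess τ (y p) ^ 2 ≤ E) (hE1 : 4 * E ≤ ε / 8 * (M * N ^ 2))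
    (hE2 : 32 * (G * E) ≤ M * τ ^ 2) (hGτ : 2 ^ 14 * τ ^ 2 ≤ G * (ε ^ 2 * N ^ 2)) (s : ℕ) :
    tapeLaw {ω | groupMean M G y ω s ∉ Set.Icc ((1 - ε / 2) * N ^ 2) ((1 + ε / 2) * N ^ 2)}
      ≤ ENNReal.ofReal (1 / 16) := by
  have hM' : (0 : ℝ) < M := by exact_mod_cast hM
  have hG' : (0 : ℝ) < G := by exact_mod_cast hG
  have hv : 0 < N ^ 2 := by positivity
  set v := N ^ 2 with hvdef
  have hεv : 0 < ε * v := mul_pos hε hv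
  set e := (∑ p ∈ Finset.range M, truncSq τ (y p)) / M with he
  obtain ⟨ht1, ht2⟩ := sum_truncSq_mem hτ hE
  have hcard := card_largeSet_mul_le hτ hE
  set B := largeSet M τ y with hB
  obtain ⟨hm1, hm2⟩ := abs_le.1 hmean
  have he1 : (1 - ε / 4) * v ≤ e := by
    rw [he, le_div_iff₀ hM']
    linarith
  have he2 : e ≤ (1 + ε / 8) * v := by
    rw [he, div_le_iff₀ hM']
    linarith
  have he0 : 0 ≤ e := div_nonneg (Finset.sum_nonneg fun p _ => truncSq_nonneg _ _) hM'.le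
  have hch := measure_sample_mean_ge_le hM hG (h := fun p => truncSq τ (y p)) (b := 4 * τ ^ 2)
    (e := e) (fun p => truncSq_nonneg _ _) (fun p => truncSq_le _) rfl (c := ε / 8 * v)
    (by positivity) s
  -- If no sample hits a large entry, the group mean equals the mean of the truncated squares. That
  -- one has expectation within `ε / 4 * v` of `v`, and it deviates from it by less than `ε / 8 *
  -- v`.
  have hsub : {ω | groupMean M G y ω s ∉ Set.Icc ((1 - ε / 2) * v) ((1 + ε / 2) * v)} ⊆
      {ω | ε / 8 * v ≤ |(∑ t ∈ Finset.range G, truncSq τ (y (sample M ω (s + t)))) / G - e|} ∪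
      ⋃ t ∈ Finset.range G, {ω | sample M ω (s + t) ∈ B} := by
    intro ω hω
    by_contra hcon
    simp only [Set.mem_union, Set.mem_iUnion, not_or, not_exists, Set.mem_ofPred_eq, not_le]
      at hcon
    obtain ⟨hc1, hc2⟩ := hcon
    have h1 : groupMean M G y ω s
        = (∑ t ∈ Finset.range G, truncSq τ (y (sample M ω (s + t)))) / G := by
      unfold groupMean
      congr 1
      refine Finset.sum_congr rfl fun t ht => ?_
      have h2 := hc2 t ht
      rw [hB, largeSet, Finset.mem_filter, not_and] at h2
      have h3 := not_lt.1 (h2 (Finset.mem_range.2 (pick_lt hM _)))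
      simp [truncSq, h3]
    rw [← h1] at hc1
    obtain ⟨h3, h4⟩ := abs_lt.1 hc1
    exact hω ⟨by linarith, by linarith⟩
  refine (measure_mono hsub).trans ((measure_union_le _ _).trans ?_)
  refine (add_le_add hch ((measure_biUnion_finset_le _ _).trans (Finset.sum_le_sum fun t _ =>
    measure_sample_mem_le B (Finset.filter_subset _ _) (s + t)))).trans ?_
  rw [← ENNReal.ofReal_sum_of_nonneg fun _ _ => by positivity,
    ← ENNReal.ofReal_add (by positivity) (Finset.sum_nonneg fun _ _ => by positivity)]
  refine ENNReal.ofReal_le_ofReal ?_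
  rw [Finset.sum_const, Finset.card_range, nsmul_eq_mul]
  -- Since `e ≤ 2 * v`, the Chebyshev bound is at most `512 * τ ^ 2 / (G * ε ^ 2 * v)`, and `512 / 2
  -- ^ 14 = 1 / 32`.
  have h1 : 4 * τ ^ 2 * e / (G * (ε / 8 * v) ^ 2) ≤ 1 / 32 := by
    rw [div_le_iff₀ (by positivity)]
    have h2 : e ≤ 2 * v := by nlinarith
    have h3 : 4 * τ ^ 2 * e ≤ 4 * τ ^ 2 * (2 * v) := by gcongr
    have h4 := mul_le_mul_of_nonneg_right hGτ hv.le
    have h5 : G * (ε / 8 * v) ^ 2 = G * (ε ^ 2 * v) * v / 64 := by ring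
    rw [h5]
    linarith
  have h2 : G * (B.card / M : ℝ) ≤ 1 / 32 := by
    rw [mul_div_assoc', div_le_iff₀ hM']
    refine le_of_mul_le_mul_right ?_ (sq_pos_of_pos hτ)
    have h3 := mul_le_mul_of_nonneg_left hcard hG'.le
    linarith
  linarith

/-! ### Majorities of independent groups -/

/-- The groups read disjoint segments of the tape. Reindexing the used entries injectively by pairs
and currying shows that their joint law is a product over the groups. -/
theorem iIndepFun_blocks (G s R : ℕ) :
    iIndepFun (fun (r : Fin R) (ω : Tape) (t : Fin G) => ω (s + r * G + t)) tapeLaw := by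
  have hinj : Function.Injective fun q : Fin R × Fin G => s + q.1 * G + q.2 := by
    rintro ⟨r, t⟩ ⟨r', t'⟩ h
    have h : s + r * G + t = s + r' * G + t' := h
    have ht := t.2
    have ht' := t'.2
    have h1 : (r : ℕ) = r' := by
      rcases lt_trichotomy (r : ℕ) r' with h1 | h1 | h1
      · have := Nat.mul_le_mul_right G h1
        rw [Nat.succ_mul] at this
        omega
      · exact h1
      · have := Nat.mul_le_mul_right G h1
        rw [Nat.succ_mul] at this
        omega
    have h2 : (t : ℕ) = t' := by rw [h1] at h; omega
    exact Prod.ext (Fin.ext h1) (Fin.ext h2)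
  have hmap : ∀ ν : Measure (ℝ × ℝ), ν = (gaussianReal 0 1).prod (volume.restrict (Set.Icc (0 : ℝ) 1)) →
      tapeLaw.map (fun ω (q : Fin R × Fin G) => ω (s + q.1 * G + q.2))
      = Measure.infinitePi fun _ => ν := by
    rintro ν rfl
    exact Measure.map_infinitePi_infinitePi_of_inj hinj
  have hcurry : tapeLaw.map (fun ω (r : Fin R) (t : Fin G) => ω (s + r * G + t))
      = Measure.infinitePi fun _ => Measure.infinitePi fun _ =>
        (gaussianReal 0 1).prod (volume.restrict (Set.Icc (0 : ℝ) 1)) := by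
    rw [← Measure.infinitePi_map_curry, ← hmap _ rfl, Measure.map_map (by fun_prop) (by fun_prop)]
    rfl
  rw [iIndepFun_iff_map_fun_eq_infinitePi_map (by fun_prop), hcurry]
  congr 1
  funext r
  have h2 := congrArg (fun μ => μ.map (fun f => f r)) hcurry
  rw [Measure.map_map (by fun_prop) (by fun_prop), Measure.infinitePi_map_eval] at h2
  exact h2.symm

open Classical in
/-- If each of `R` independent events has probability at most `1 / 16`, then the probability that at
least half of them occur is at most `2 ^ (-R)`. -/
theorem measure_majority_le {Ω β : Type*} [MeasurableSpace Ω] [MeasurableSpace β] {μ : Measure Ω}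
    [IsProbabilityMeasure μ] {R : ℕ} {W : Fin R → Ω → β} (hW : ∀ r, Measurable (W r))
    (hind : iIndepFun W μ) {B : Set β} (hB : MeasurableSet B)
    (h : ∀ r, μ {ω | W r ω ∈ B} ≤ ENNReal.ofReal (1 / 16)) :
    μ {ω | R ≤ 2 * (Finset.univ.filter fun r => W r ω ∈ B).card} ≤ ENNReal.ofReal ((2 ^ R)⁻¹) := by
  -- A bad event has weight 16, so the mean of `f` is at most `1 + 15 / 16`. If at least half of the
  -- events occur, the product of the weights is at least `16 ^ (R / 2) = 4 ^ R`; Markov's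
  -- inequality gives `2 ^ R / 4 ^ R`.
  let f : β → ℝ := fun b => 1 + Set.indicator B (fun _ => 15) b
  have hf : Measurable f := measurable_const.add (measurable_const.indicator hB)
  have hf1 : ∀ b, 1 ≤ f b ∧ f b ≤ 16 := by
    intro b
    by_cases hb : b ∈ B <;> simp [f, hb]
    norm_num
  have hint : ∀ r, ∫ ω, f (W r ω) ∂μ ≤ 2 := by
    intro r
    have hm : MeasurableSet {ω | W r ω ∈ B} := hW r hB
    have h1 : ∀ ω, f (W r ω) = 1 + Set.indicator {ω | W r ω ∈ B} (fun _ => 15) ω := fun ω => rfl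
    simp_rw [h1]
    rw [integral_add (integrable_const _) ((integrable_const _).indicator hm),
      integral_indicator_const _ hm]
    have h2 : μ.real {ω | W r ω ∈ B} ≤ 1 / 16 :=
      ENNReal.toReal_le_of_le_ofReal (by norm_num) (h r)
    simp
    linarith
  have hprod := hind.integral_fun_prod_comp (f := fun _ => f) (fun r => (hW r).aemeasurable)
    fun r => hf.aestronglyMeasurable
  have hle : ∫ ω, ∏ r, f (W r ω) ∂μ ≤ 2 ^ R := by
    rw [hprod]
    refine (Finset.prod_le_prod (fun r _ => integral_nonneg fun ω => ?_) fun r _ => hint r).trans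
      (by simp)
    exact zero_le_one.trans (hf1 _).1
  have hpow : ∀ ω, ∏ r, f (W r ω) = 16 ^ (Finset.univ.filter fun r => W r ω ∈ B).card := by
    intro ω
    rw [← Finset.prod_const, Finset.prod_filter]
    refine Finset.prod_congr rfl fun r _ => ?_
    by_cases hb : W r ω ∈ B <;> simp [f, hb]
    norm_num
  have hintg : Integrable (fun ω => ∏ r, f (W r ω)) μ := by
    refine Integrable.of_bound (C := 16 ^ R) ?_ (ae_of_all _ fun ω => ?_)
    · exact (Finset.measurable_fun_prod _ fun r _ => hf.comp (hW r)).aestronglyMeasurable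
    · rw [Real.norm_of_nonneg (Finset.prod_nonneg fun r _ => zero_le_one.trans (hf1 _).1)]
      refine (Finset.prod_le_prod (fun r _ => zero_le_one.trans (hf1 _).1)
        fun r _ => (hf1 _).2).trans (by simp)
  have hmk := mul_meas_ge_le_integral_of_nonneg (ae_of_all _ fun ω => Finset.prod_nonneg
    fun r _ => zero_le_one.trans (hf1 (W r ω)).1) hintg (4 ^ R)
  rw [← ofReal_measureReal]
  refine ENNReal.ofReal_le_ofReal ?_
  have hsub : {ω | R ≤ 2 * (Finset.univ.filter fun r => W r ω ∈ B).card} ⊆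
      {ω | 4 ^ R ≤ ∏ r, f (W r ω)} := by
    intro ω hω
    have hω : R ≤ 2 * (Finset.univ.filter fun r => W r ω ∈ B).card := hω
    change (4 : ℝ) ^ R ≤ _
    rw [hpow, show (16 : ℝ) = 4 ^ 2 by norm_num, ← pow_mul]
    exact pow_le_pow_right₀ (by norm_num) hω
  refine (measureReal_mono hsub).trans ?_
  have h4 : (4 : ℝ) ^ R * μ.real {ω | 4 ^ R ≤ ∏ r, f (W r ω)} ≤ 2 ^ R := hmk.trans hle
  rw [← one_div, le_div_iff₀ (by positivity)]
  have h2 : (4 : ℝ) ^ R = 2 ^ R * 2 ^ R := by rw [← mul_pow]; norm_num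
  refine le_of_mul_le_mul_left (a := (2 : ℝ) ^ R) ?_ (by positivity)
  calc _ = (4 : ℝ) ^ R * μ.real {ω | 4 ^ R ≤ ∏ r, f (W r ω)} := by rw [h2]; ring
    _ ≤ 2 ^ R * 1 := by linarith

/-! ### Approximate medians by bisection -/

open Classical in
/-- The number of indices `r < R` with `a r ≤ v`. -/
noncomputable def countLe (R : ℕ) (a : ℕ → ℝ) (v : ℝ) : ℕ :=
  ((Finset.range R).filter fun r => a r ≤ v).card

/-- One step of the search for a median of `a 0, ..., a (R - 1)`. -/
noncomputable def bisectStep (R : ℕ) (a : ℕ → ℝ) (p : ℝ × ℝ) : ℝ × ℝ :=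
  if countLe R a ((p.1 + p.2) / 2) + countLe R a ((p.1 + p.2) / 2) < R
  then ((p.1 + p.2) / 2, p.2) else (p.1, (p.1 + p.2) / 2)

/-- An approximate median of the nonnegative numbers `a 0, ..., a (R - 1)`. -/
noncomputable def approxMedian (R K : ℕ) (a : ℕ → ℝ) : ℝ :=
  ((bisectStep R a)^[K] (0, ∑ r ∈ Finset.range R, a r)).2

/-- The invariant of the bisection: fewer than half of the numbers lie at or below the lower end
unless it is still 0, and at least half lie at or below the upper end. The sum of all numbers is a
valid initial upper end, since they are nonnegative. -/
theorem iterate_bisectStep (R : ℕ) {a : ℕ → ℝ} (ha : ∀ r, 0 ≤ a r) (K : ℕ) :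
    let p := (bisectStep R a)^[K] (0, ∑ r ∈ Finset.range R, a r)
    (p.1 = 0 ∨ 2 * countLe R a p.1 < R) ∧ R ≤ 2 * countLe R a p.2 ∧
      p.2 - p.1 = (∑ r ∈ Finset.range R, a r) / 2 ^ K := by
  induction K with
  | zero =>
    refine ⟨Or.inl rfl, ?_, by simp⟩
    have h1 : countLe R a (∑ r ∈ Finset.range R, a r) = R := by
      rw [countLe, Finset.filter_true_of_mem, Finset.card_range]
      exact fun r hr => Finset.single_le_sum (fun r _ => ha r) hr
    simp only [Function.iterate_zero, id_eq, h1]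
    omega
  | succ K ih =>
    simp only [Function.iterate_succ_apply']
    set p := (bisectStep R a)^[K] (0, ∑ r ∈ Finset.range R, a r)
    obtain ⟨h1, h2, h3⟩ := ih
    have h4 : (∑ r ∈ Finset.range R, a r) / 2 ^ (K + 1) = (p.2 - p.1) / 2 := by
      rw [h3, pow_succ]; field_simp
    unfold bisectStep
    split_ifs with h
    · exact ⟨Or.inr (by dsimp only; omega), h2, by rw [h4]; ring⟩
    · exact ⟨h1, by dsimp only; omega, by rw [h4]; ring⟩

open Classical in
/-- If more than half of the numbers lie in an interval, then so does the approximate median, up to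
the accuracy of the bisection. -/
theorem approxMedian_mem {R K : ℕ} {a : ℕ → ℝ} (ha : ∀ r, 0 ≤ a r) {g₁ g₂ b : ℝ} (hg : 0 ≤ g₂)
    (hbad : 2 * ((Finset.range R).filter fun r => a r ∉ Set.Icc g₁ g₂).card < R)
    (hb : ∀ r < R, a r ≤ b) :
    g₁ ≤ approxMedian R K a ∧ approxMedian R K a ≤ g₂ + R * b / 2 ^ K := by
  obtain ⟨h1, h2, h3⟩ := iterate_bisectStep R ha K
  unfold approxMedian
  set p := (bisectStep R a)^[K] (0, ∑ r ∈ Finset.range R, a r)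
  have hsum : ∑ r ∈ Finset.range R, a r ≤ R * b := by
    refine (Finset.sum_le_sum fun r hr => hb r (Finset.mem_range.1 hr)).trans ?_
    simp
  constructor
  -- If the upper end were below `g₁`, the at least `R / 2` numbers at or below it would all be bad.
  · by_contra! hlt
    have : countLe R a p.2 ≤ ((Finset.range R).filter fun r => a r ∉ Set.Icc g₁ g₂).card := by
      refine Finset.card_le_card (Finset.monotone_filter_right _ fun r _ hr h => ?_)
      exact absurd (h.1.trans hr) (not_le.2 hlt)
    omega
  -- If the lower end were above `g₂`, the more than `R / 2` numbers above it would all be bad.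
  · have h4 : p.1 ≤ g₂ := by
      rcases h1 with h1 | h1
      · rw [h1]; exact hg
      · by_contra! hlt
        have h5 : ((Finset.range R).filter fun r => ¬ a r ≤ p.1).card ≤
            ((Finset.range R).filter fun r => a r ∉ Set.Icc g₁ g₂).card := by
          refine Finset.card_le_card (Finset.monotone_filter_right _ fun r _ hr h => ?_)
          exact hr (h.2.trans hlt.le)
        have h6 := Finset.card_filter_add_card_filter_not (s := Finset.range R)
          (fun r => a r ≤ p.1)
        rw [Finset.card_range] at h6
        unfold countLe at h1
        omega
    have h5 : (∑ r ∈ Finset.range R, a r) / 2 ^ K ≤ R * b / 2 ^ K := by gcongr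
    linarith

/-! ### The estimator -/

/-- The estimate of the square of a length obtained from the embedded vector `y` with `R` groups of
`G` samples, drawn from position `s` of the tape on. -/
noncomputable def estimate (M G R K : ℕ) (y : ℕ → ℝ) (ω : Tape) (s : ℕ) : ℝ :=
  approxMedian R K fun r => groupMean M G y ω (s + r * G)

theorem groupMean_nonneg (M G : ℕ) (y : ℕ → ℝ) (ω : Tape) (s : ℕ) : 0 ≤ groupMean M G y ω s :=
  div_nonneg (Finset.sum_nonneg fun _ _ => sq_nonneg _) (Nat.cast_nonneg _)

theorem groupMean_le {M G : ℕ} (hM : 0 < M) {y : ℕ → ℝ} {b : ℝ}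
    (hb : ∑ p ∈ Finset.range M, y p ^ 2 ≤ b) (ω : Tape) (s : ℕ) : groupMean M G y ω s ≤ b := by
  have hb0 : 0 ≤ b := (Finset.sum_nonneg fun _ _ => sq_nonneg _).trans hb
  refine div_le_of_le_mul₀ (Nat.cast_nonneg _) hb0 ?_
  refine (Finset.sum_le_sum (g := fun _ => b) fun t _ => ?_).trans (by simp [mul_comm])
  exact (Finset.single_le_sum (f := fun p => y p ^ 2) (fun _ _ => sq_nonneg _)
    (Finset.mem_range.2 (pick_lt hM _))).trans hb

/-- Half of the error `ε` is granted to the group means and half to the bisection. The latter starts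
from an interval of length at most `R * (2 * M * N ^ 2)`, which `hK` shrinks to `ε / 2 * N ^ 2`. -/
theorem measure_estimate_not_mem_le {M G R K : ℕ} (hM : 0 < M) {y : ℕ → ℝ} {N ε : ℝ}
    (hε : 0 < ε) (hsum : ∑ p ∈ Finset.range M, y p ^ 2 ≤ 2 * M * N ^ 2)
    (hK : 4 * R * M ≤ ε * 2 ^ K)
    (hgroup : ∀ s, tapeLaw {ω | groupMean M G y ω s ∉
      Set.Icc ((1 - ε / 2) * N ^ 2) ((1 + ε / 2) * N ^ 2)} ≤ ENNReal.ofReal (1 / 16)) (s : ℕ) :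
    tapeLaw {ω | ¬ ((1 - ε) * N ^ 2 ≤ estimate M G R K y ω s ∧
      estimate M G R K y ω s ≤ (1 + ε) * N ^ 2)} ≤ ENNReal.ofReal ((2 ^ R)⁻¹) := by
  classical
  set I := Set.Icc ((1 - ε / 2) * N ^ 2) ((1 + ε / 2) * N ^ 2) with hI
  let f : (Fin G → ℝ × ℝ) → ℝ := fun b => (∑ t, y (pick (b t).2 M) ^ 2) / G
  have hf : Measurable f := by
    refine (Finset.measurable_fun_sum _ fun t _ => ?_).div_const _
    exact (measurable_from_nat (f := fun i => y i ^ 2)).comp ((measurable_pick M).comp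
      (measurable_snd.comp (measurable_pi_apply t)))
  have hfW : ∀ ω r, f (fun t : Fin G => ω (s + r * G + t)) = groupMean M G y ω (s + r * G) := by
    intro ω r
    simp only [f, groupMean, Finset.sum_range, sample]
  have hmaj := measure_majority_le (fun r => by fun_prop) (iIndepFun_blocks G s R)
    (B := {b | f b ∉ I}) (hf measurableSet_Icc).compl fun r => by
      simpa only [Set.mem_ofPred_eq, hfW] using hgroup (s + r * G)
  refine (measure_mono fun ω hω => ?_).trans hmaj
  change R ≤ 2 * _
  by_contra! hlt
  simp only [Set.mem_ofPred_eq, hfW] at hlt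
  have hcard : (Finset.univ.filter fun r : Fin R => groupMean M G y ω (s + r * G) ∉ I).card
      = ((Finset.range R).filter fun r => groupMean M G y ω (s + r * G) ∉ I).card := by
    rw [Finset.card_filter, Finset.card_filter, Finset.sum_range]
  rw [hcard] at hlt
  have hmed := approxMedian_mem (K := K) (a := fun r => groupMean M G y ω (s + r * G))
    (fun r => groupMean_nonneg _ _ _ _ _) (by positivity) hlt
    fun r _ => groupMean_le hM hsum ω _
  refine hω ⟨le_trans ?_ hmed.1, hmed.2.trans ?_⟩
  · nlinarith [sq_nonneg N]
  · have h1 : R * (2 * M * N ^ 2) / 2 ^ K ≤ ε / 2 * N ^ 2 := by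
      rw [div_le_iff₀ (by positivity)]
      nlinarith [mul_le_mul_of_nonneg_right hK (sq_nonneg N)]
    linarith

/-- For good seeds, the estimator finds the length of every vector. -/
theorem GoodSeeds.measure_estimate_le {H L d m G R K : ℕ} {ε T l : ℝ} {g : ℕ → ℝ}
    (hg : GoodSeeds H L d m (ε / 8) T (14 * 2 ^ L * l) g) (hd : d ≤ 2 ^ L)
    (hm : 2 * H = 2 ^ L * m) (hm0 : 0 < m) (hG : 0 < G) (hε : 0 < ε) (hε1 : ε < 1 / 2)
    (hT : 0 < T) (hl : 0 ≤ l) (hml : 448 * (2 * (L + 1)) ^ 2 * l ≤ ε * m)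
    (hGl : 448 * (G * l) ≤ m * T ^ 2) (hGε : 2 ^ 14 * ((2 * (L + 1)) ^ 2 * T ^ 2) ≤ G * ε ^ 2)
    (hK : 4 * R * (2 * H : ℕ) ≤ ε * 2 ^ K) (z : Fin d → ℝ) {N : ℝ} (hN : 0 ≤ N)
    (hzN : ∑ k, z k ^ 2 = N ^ 2) (s : ℕ) :
    tapeLaw {ω | ¬ ((1 - ε) * N ^ 2 ≤ estimate (2 * H) G R K (embed H L d g (coords z)) ω s ∧
      estimate (2 * H) G R K (embed H L d g (coords z)) ω s ≤ (1 + ε) * N ^ 2)}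
      ≤ ENNReal.ofReal ((2 ^ R)⁻¹) := by
  set y := embed H L d g (coords z) with hy
  have hm' : (0 : ℝ) < m := by exact_mod_cast hm0
  have hMm : ((2 * H : ℕ) : ℝ) = 2 ^ L * m := by rw [hm]; push_cast; ring
  set M := 2 * H with hMdef
  have hM : 0 < M := by rw [hm]; positivity
  have hfin : ∀ f : ℝ → ℝ, ∑ p, f (embedLin H L d g z p) = ∑ p ∈ Finset.range M, f (y p) :=
    fun f => Fin.sum_univ_eq_sum_range (fun p => f (y p)) M
  have hmean : |∑ p ∈ Finset.range M, y p ^ 2 - M * N ^ 2| ≤ ε / 8 * (M * N ^ 2) := by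
    rw [← hfin fun x => x ^ 2, sum_embed_sq hd hm, hMm, ← hzN]
    have h1 : 2 ^ L * ∑ k : Fin d, z k ^ 2 * ∑ j ∈ Finset.range m, g (2 ^ L * j + k) ^ 2
        - 2 ^ L * m * ∑ k, z k ^ 2
        = 2 ^ L * ∑ k : Fin d, z k ^ 2 * (∑ j ∈ Finset.range m, g (2 ^ L * j + k) ^ 2 - m) := by
      simp_rw [mul_sub, Finset.sum_sub_distrib, ← Finset.sum_mul]
      ring
    have h2 : |∑ k : Fin d, z k ^ 2 * (∑ j ∈ Finset.range m, g (2 ^ L * j + k) ^ 2 - m)|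
        ≤ ∑ k : Fin d, z k ^ 2 * (m * (ε / 8)) := by
      refine (Finset.abs_sum_le_sum_abs _ _).trans (Finset.sum_le_sum fun k _ => ?_)
      rw [abs_mul, abs_of_nonneg (sq_nonneg _)]
      exact mul_le_mul_of_nonneg_left (hg.column k k.2).le (sq_nonneg _)
    rw [h1, abs_mul, abs_of_nonneg (by positivity : (0 : ℝ) ≤ 2 ^ L)]
    refine (mul_le_mul_of_nonneg_left h2 (by positivity)).trans (le_of_eq ?_)
    rw [← Finset.sum_mul]
    ring
  have hsum : ∑ p ∈ Finset.range M, y p ^ 2 ≤ 2 * M * N ^ 2 := by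
    have h1 := (abs_le.1 hmean).2
    have h2 : (0 : ℝ) ≤ M * N ^ 2 := by positivity
    nlinarith
  refine measure_estimate_not_mem_le hM hε hsum hK (fun s => ?_) s
  rcases hN.eq_or_lt with rfl | hN
  -- For `N = 0` the image is zero and every group mean is exact; the sampling lemma needs `N > 0`.
  · have h0 : ∀ s ω, groupMean M G y ω s = 0 := fun s ω =>
      le_antisymm (groupMean_le hM (hsum.trans (by simp)) ω s) (groupMean_nonneg _ _ _ _ _)
    simp [h0]
  · have hexc := sum_excess_sq_le_of_signVec hT.le (by positivity) hg.flat
      (by rwa [Fintype.card_fin]) hN.le hzN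
    rw [hfin fun x => excess (2 * (L + 1) * T * N) x ^ 2] at hexc
    set a : ℝ := 2 * (L + 1) with ha
    have ha0 : 0 < a := by positivity
    have hN2 : 0 < N ^ 2 := by positivity
    -- Here `τ = a * T * N` and `E = a ^ 2 * (14 * 2 ^ L * l) * N ^ 2`. The constant 448 is `4 * 14
    -- * 8` in the bound for the truncated mass and `32 * 14` in the bound for hitting a large
    -- entry.
    refine measure_groupMean_not_mem_le hM hG hN hε hε1 (by positivity) hmean hexc ?_ ?_ ?_ s
    · rw [hMm]
      have h1 := mul_le_mul_of_nonneg_right hml (by positivity : 0 ≤ 2 ^ L * N ^ 2 / 8)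
      linarith
    · rw [hMm]
      have h1 := mul_le_mul_of_nonneg_right hGl (by positivity : 0 ≤ a ^ 2 * N ^ 2 * 2 ^ L)
      linarith
    · have h1 := mul_le_mul_of_nonneg_right hGε hN2.le
      linarith

/-! ### Program logic -/

/-- Started in memory `M` with `s` entries of the tape consumed, `p` halts within `T` steps in a
state that satisfies `Q`. -/
def Prog.Wp (ω : Tape) (p : Prog) (M : Mem) (s T : ℕ) (Q : Mem → ℕ → Prop) : Prop :=
  ∃ M' s' t, Exec ω p M s M' s' t ∧ t ≤ T ∧ Q M' s'

infixr:60 " ;; " => Prog.seq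

namespace Prog.Wp

variable {ω : Tape} {M : Mem} {s T T' : ℕ} {Q Q' : Mem → ℕ → Prop} {p q : Prog}

theorem mono (h : p.Wp ω M s T Q) (hT : T ≤ T') (hQ : ∀ M' s', Q M' s' → Q' M' s') :
    p.Wp ω M s T' Q' := by
  obtain ⟨M', s', t, h1, h2, h3⟩ := h
  exact ⟨M', s', t, h1, h2.trans hT, hQ _ _ h3⟩

theorem skip (h : Q M s) : Prog.skip.Wp ω M s 1 Q := ⟨M, s, 1, .skip M s, le_rfl, h⟩

theorem setNat {a : ℕ} {i e : NatExp} (h : Q (M.setNat a (i.eval M) (e.eval M)) s) :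
    (Prog.setNat a i e).Wp ω M s (i.cost + e.cost + 1) Q :=
  ⟨_, _, _, .setNat a i e M s, le_rfl, h⟩

theorem setReal {a : ℕ} {i : NatExp} {e : RealExp}
    (h : Q (M.setReal a (i.eval M) (e.eval M)) s) :
    (Prog.setReal a i e).Wp ω M s (i.cost + e.cost + 1) Q :=
  ⟨_, _, _, .setReal a i e M s, le_rfl, h⟩

theorem gauss {a : ℕ} {i : NatExp} (h : Q (M.setReal a (i.eval M) (ω s).1) (s + 1)) :
    (Prog.gauss a i).Wp ω M s (i.cost + 1) Q :=
  ⟨_, _, _, .gauss a i M s, le_rfl, h⟩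

theorem unif {a : ℕ} {i k : NatExp}
    (h : Q (M.setNat a (i.eval M) (pick (ω s).2 (k.eval M))) (s + 1)) :
    (Prog.unif a i k).Wp ω M s (i.cost + k.cost + 1) Q :=
  ⟨_, _, _, .unif a i k M s, le_rfl, h⟩

theorem seq (h : p.Wp ω M s T fun M' s' => q.Wp ω M' s' T' Q) : (p ;; q).Wp ω M s (T + T') Q := by
  obtain ⟨M', s', t, h1, h2, M'', s'', t', h3, h4, h5⟩ := h
  exact ⟨_, _, _, .seq h1 h3, add_le_add h2 h4, h5⟩

theorem branch {b : Test} (h1 : b.holds M → p.Wp ω M s T Q) (h2 : ¬ b.holds M → q.Wp ω M s T Q) :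
    (Prog.branch b p q).Wp ω M s (b.cost + 1 + T) Q := by
  by_cases hb : b.holds M
  · obtain ⟨M', s', t, h3, h4, h5⟩ := h1 hb
    exact ⟨_, _, _, .branch_pos q hb h3, by omega, h5⟩
  · obtain ⟨M', s', t, h3, h4, h5⟩ := h2 hb
    exact ⟨_, _, _, .branch_neg p hb h3, by omega, h5⟩

/-- A loop that runs `n` times. -/
theorem loop {b : Test} {B : ℕ} (n : ℕ) (I : ℕ → Mem → ℕ → Prop)
    (hstep : ∀ k M s, k < n → I k M s → b.holds M ∧ p.Wp ω M s B (I (k + 1)))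
    (hend : ∀ M s, I n M s → ¬ b.holds M) (h0 : I 0 M s) :
    (Prog.loop b p).Wp ω M s (n * (b.cost + 1 + B) + (b.cost + 1)) (I n) := by
  have key : ∀ j k M s, k + j = n → I k M s →
      (Prog.loop b p).Wp ω M s (j * (b.cost + 1 + B) + (b.cost + 1)) (I n) := by
    intro j
    induction j with
    | zero =>
      intro k M s hk hI
      obtain rfl : k = n := hk
      exact ⟨M, s, _, .loop_done p s (hend M s hI), by omega, hI⟩
    | succ j ih =>
      intro k M s hk hI
      obtain ⟨hb, M', s', t, h1, h2, h3⟩ := hstep k M s (by omega) hI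
      obtain ⟨M'', s'', t', h4, h5, h6⟩ := ih (k + 1) M' s' (by omega) h3
      refine ⟨M'', s'', _, .loop_step hb h1 h4, ?_, h6⟩
      rw [Nat.succ_mul]
      omega
  exact key n 0 M s (by omega) h0

end Prog.Wp

/-- The natural-number variable stored in cell `0` of the array `a`. -/
abbrev NatExp.var (a : ℕ) : NatExp := .get a (.const 0)

/-- The real variable stored in cell `0` of the array `a`. -/
abbrev RealExp.var (a : ℕ) : RealExp := .get a (.const 0)

/-- Assignment to a natural-number variable. -/
abbrev Prog.letNat (a : ℕ) (e : NatExp) : Prog := .setNat a (.const 0) e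

/-- Assignment to a real variable. -/
abbrev Prog.letReal (a : ℕ) (e : RealExp) : Prog := .setReal a (.const 0) e

/-- A counted loop, with counter `c` and bound `n`. -/
def Prog.for (c : ℕ) (n : NatExp) (p : Prog) : Prog :=
  .letNat c (.const 0) ;; .loop (.natLt (.var c) n) (p ;; .letNat c (.add (.var c) (.const 1)))

theorem Mem.setNat_nat (M : Mem) (a i v b j : ℕ) :
    (M.setNat a i v).nat b j = if b = a ∧ j = i then v else M.nat b j := rfl

theorem Mem.setNat_nat_of_ne (M : Mem) {a b : ℕ} (i v : ℕ) (h : b ≠ a) :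
    (M.setNat a i v).nat b = M.nat b := by
  funext j
  simp [Mem.setNat_nat, h]

@[simp]
theorem Mem.setNat_real (M : Mem) (a i v : ℕ) : (M.setNat a i v).real = M.real := rfl

theorem Mem.setReal_real (M : Mem) (a i : ℕ) (v : ℝ) (b j : ℕ) :
    (M.setReal a i v).real b j = if b = a ∧ j = i then v else M.real b j := rfl

theorem Mem.setReal_real_of_ne (M : Mem) {a b : ℕ} (i : ℕ) (v : ℝ) (h : b ≠ a) :
    (M.setReal a i v).real b = M.real b := by
  funext j
  simp [Mem.setReal_real, h]

@[simp]
theorem Mem.setReal_nat (M : Mem) (a i : ℕ) (v : ℝ) : (M.setReal a i v).nat = M.nat := rfl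

/-- `M'` agrees with `M` outside of the natural-number arrays in `A` and the real arrays in `B`. -/
structure Mem.Agree (A B : List ℕ) (M M' : Mem) : Prop where
  nat : ∀ b, b ∉ A → M'.nat b = M.nat b
  real : ∀ b, b ∉ B → M'.real b = M.real b

namespace Mem.Agree

variable {A B : List ℕ} {M M' M'' : Mem}

theorem refl : Mem.Agree A B M M := ⟨fun _ _ => rfl, fun _ _ => rfl⟩

theorem trans (h : Mem.Agree A B M M') (h' : Mem.Agree A B M' M'') : Mem.Agree A B M M'' :=
  ⟨fun b hb => (h'.nat b hb).trans (h.nat b hb), fun b hb => (h'.real b hb).trans (h.real b hb)⟩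

theorem weaken {A' B' : List ℕ} (h : Mem.Agree A B M M') (hA : A ⊆ A') (hB : B ⊆ B') :
    Mem.Agree A' B' M M' :=
  ⟨fun b hb => h.nat b fun h' => hb (hA h'), fun b hb => h.real b fun h' => hb (hB h')⟩

theorem setNat (h : Mem.Agree A B M M') {a : ℕ} (ha : a ∈ A) (i v : ℕ) :
    Mem.Agree A B M (M'.setNat a i v) :=
  ⟨fun b hb => (M'.setNat_nat_of_ne i v fun h : b = a => hb (by rwa [h])).trans (h.nat b hb), h.real⟩

theorem setReal (h : Mem.Agree A B M M') {a : ℕ} (ha : a ∈ B) (i : ℕ) (v : ℝ) :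
    Mem.Agree A B M (M'.setReal a i v) :=
  ⟨h.nat, fun b hb => (M'.setReal_real_of_ne i v fun h : b = a => hb (by rwa [h])).trans (h.real b hb)⟩

end Mem.Agree

/-- `I k` speaks of the memory in which the counter already has the value `k`. The body must leave
the counter alone, and the invariant must determine the value of the bound, which is evaluated anew
in every round. -/
theorem Prog.Wp.for {ω : Tape} {M : Mem} {s c : ℕ} {n : NatExp} {p : Prog} {B : ℕ} (N : ℕ)
    (I : ℕ → Mem → ℕ → Prop) (h0 : I 0 (M.setNat c 0 0) s)
    (hn : ∀ k M s, I k M s → n.eval M = N)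
    (hb : ∀ k M s, k < N → M.nat c 0 = k → I k M s →
      p.Wp ω M s B fun M' s' => M'.nat c 0 = k ∧ I (k + 1) (M'.setNat c 0 (k + 1)) s') :
    (Prog.for c n p).Wp ω M s ((N + 1) * (B + n.cost + 14)) fun M' s' => I N M' s' := by
  have hstep : ∀ k M s, k < N → (M.nat c 0 = k ∧ I k M s) →
      (Test.natLt (.var c) n).holds M ∧
      (p ;; .letNat c (.add (.var c) (.const 1))).Wp ω M s (B + 6)
        fun M' s' => M'.nat c 0 = k + 1 ∧ I (k + 1) M' s' := by
    rintro k M s hk ⟨hc, hI⟩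
    refine ⟨?_, Prog.Wp.seq ((hb k M s hk hc hI).mono le_rfl ?_)⟩
    · simp only [Test.holds, NatExp.eval, hc, hn k M s hI]
      exact hk
    · rintro M' s' ⟨hc', hI'⟩
      refine Prog.Wp.setNat ?_
      simp only [NatExp.eval, hc']
      exact ⟨by simp [Mem.setNat_nat], hI'⟩
  have hl := Prog.Wp.loop (ω := ω) (M := M.setNat c 0 0) (s := s) N
    (fun k M s => M.nat c 0 = k ∧ I k M s) hstep
    (by rintro M s ⟨hc, hI⟩; simp [Test.holds, NatExp.eval, hc, hn N M s hI])
    ⟨by simp [Mem.setNat_nat], h0⟩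
  refine (Prog.Wp.seq (Prog.Wp.setNat hl)).mono ?_ fun M' s' h => h.2
  simp only [NatExp.cost, Test.cost]
  nlinarith

/-! ### Powers of two -/

theorem exists_le_two_pow (b : ℝ) : ∃ c : ℕ, b ≤ 2 ^ c :=
  (pow_unbounded_of_one_lt b one_lt_two).imp fun _ h => h.le

open Classical in
/-- The least natural number `c` with `b ≤ 2 ^ c`. -/
noncomputable def ceilLog (b : ℝ) : ℕ := Nat.find (exists_le_two_pow b)

theorem le_two_pow_ceilLog (b : ℝ) : b ≤ 2 ^ ceilLog b := by
  classical exact Nat.find_spec (exists_le_two_pow b)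

theorem two_pow_lt_of_lt_ceilLog {b : ℝ} {c : ℕ} (h : c < ceilLog b) : (2 : ℝ) ^ c < b := by
  classical exact not_le.1 (Nat.find_min (exists_le_two_pow b) h)

theorem two_pow_ceilLog_le {b : ℝ} (hb : 1 ≤ b) : (2 : ℝ) ^ ceilLog b ≤ 2 * b := by
  rcases h : ceilLog b with _ | c
  · simp only [pow_zero]; linarith
  · have := two_pow_lt_of_lt_ceilLog (h ▸ Nat.lt_succ_self c : c < ceilLog b)
    rw [pow_succ]
    linarith

/-- Computes the least power of two that is at least `b`, and its exponent. -/
def Prog.powTwo (w c : ℕ) (b : RealExp) : Prog :=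
  .letNat w (.const 1) ;; .letNat c (.const 0) ;;
    .loop (.realLt (.ofNat (.var w)) b)
      (.letNat w (.add (.var w) (.var w)) ;; .letNat c (.add (.var c) (.const 1)))

/-- Doubling against a real comparison replaces rounding and multiplication of natural numbers,
which the machine does not offer. By `hv`, the changes of the two loop variables do not affect the
bound. -/
theorem Prog.Wp.powTwo {ω : Tape} {M : Mem} {s w c : ℕ} {b : RealExp} (hwc : w ≠ c) {v : ℝ}
    (hv : ∀ M', Mem.Agree [w, c] [] M M' → b.eval M' = v) :
    (Prog.powTwo w c b).Wp ω M s ((ceilLog v + 1) * (b.cost + 24)) fun M' s' =>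
      s' = s ∧ Mem.Agree [w, c] [] M M' ∧ M'.nat w 0 = 2 ^ ceilLog v ∧ M'.nat c 0 = ceilLog v := by
  let I : ℕ → Mem → ℕ → Prop := fun k M' s' =>
    s' = s ∧ Mem.Agree [w, c] [] M M' ∧ M'.nat w 0 = 2 ^ k ∧ M'.nat c 0 = k
  have hstep : ∀ k M' s', k < ceilLog v → I k M' s' →
      (Test.realLt (.ofNat (.var w)) b).holds M' ∧
      (Prog.letNat w (.add (.var w) (.var w)) ;; .letNat c (.add (.var c) (.const 1))).Wp ω M' s'
        13 (I (k + 1)) := by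
    rintro k M' s' hk ⟨rfl, hA, hw, hc⟩
    refine ⟨?_, ?_⟩
    · simp only [Test.holds, RealExp.eval, NatExp.eval, hv M' hA, hw]
      push_cast
      exact two_pow_lt_of_lt_ceilLog hk
    · refine Prog.Wp.seq (T := 7) (T' := 6) (Prog.Wp.setNat (Prog.Wp.setNat ?_))
      refine ⟨rfl, (hA.setNat (by simp) _ _).setNat (by simp) _ _, ?_, ?_⟩
      · simp [Mem.setNat_nat, NatExp.eval, hwc, hw, pow_succ, mul_two]
      · simp [Mem.setNat_nat, NatExp.eval, hwc.symm, hc]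
  have hend : ∀ M' s', I (ceilLog v) M' s' → ¬ (Test.realLt (.ofNat (.var w)) b).holds M' := by
    rintro M' s' ⟨rfl, hA, hw, hc⟩
    simp only [Test.holds, RealExp.eval, NatExp.eval, hv M' hA, hw, not_lt]
    push_cast
    exact le_two_pow_ceilLog v
  have hl := Prog.Wp.loop (ω := ω) (M := (M.setNat w 0 1).setNat c 0 0) (s := s) _ I hstep hend
    ⟨rfl, (Mem.Agree.refl.setNat (by simp) _ _).setNat (by simp) _ _,
      by simp [Mem.setNat_nat, hwc], by simp [Mem.setNat_nat]⟩
  refine (Prog.Wp.seq (Prog.Wp.setNat (Prog.Wp.seq (Prog.Wp.setNat hl)))).mono ?_ fun M' s' h => h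
  simp only [NatExp.cost, RealExp.cost, Test.cost]
  nlinarith

/-! ### The embedding program

Natural-number variables: `0` dimension, `1` number of transform steps, `2` block length, `3` half of
the number of coordinates of an embedded vector, `4` that number, `5` number of samples per group,
`6` number of points, `7` end of the stored coordinates, from `8` on temporary.  Real arrays: `0` input,
`1` answers, `2` and `3` the parameters `ε` and `δ`, `4` seeds, `5` embedded points, `6` embedded input,
from `7` on temporary. -/

/-- Writes one cell of the scaled input to array `6`. -/
def fillCellProg : Prog :=
  .branch (.natLt (.var 9) (.var 0))
    (.setReal 6 (.var 8) (.mul (.get 4 (.var 8)) (.get 0 (.var 9))))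
    (.setReal 6 (.var 8) (.ofNat (.const 0)))

/-- Increments the position in the current block. -/
def nextProg : Prog :=
  .letNat 9 (.add (.var 9) (.const 1)) ;;
    .branch (.natLt (.var 9) (.var 2)) .skip (.letNat 9 (.const 0))

/-- Copies the scaled input to array `6`. -/
def fillProg : Prog := .letNat 9 (.const 0) ;; .for 8 (.var 4) (fillCellProg ;; nextProg)

/-- Two cells of one step of the transform. -/
def butterflyCellProg : Prog :=
  .setReal 7 (.var 8) (.add (.get 6 (.add (.var 8) (.var 8)))
      (.get 6 (.add (.add (.var 8) (.var 8)) (.const 1)))) ;;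
    .setReal 7 (.add (.var 3) (.var 8)) (.sub (.get 6 (.add (.var 8) (.var 8)))
      (.get 6 (.add (.add (.var 8) (.var 8)) (.const 1))))

/-- One step of the transform, from array `6` to array `7`. -/
def butterflyProg : Prog := .for 8 (.var 3) butterflyCellProg

/-- Copies array `7` to array `6`. -/
def copyBackProg : Prog := .for 8 (.var 4) (.setReal 6 (.var 8) (.get 7 (.var 8)))

/-- Embeds the input vector. -/
def embedProg : Prog := fillProg ;; .for 10 (.var 1) (butterflyProg ;; copyBackProg)

/-- The variables that describe the shape of the embedding. -/
structure Mem.Shape (M : Mem) (d L H : ℕ) : Prop where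
  dim : M.nat 0 0 = d
  steps : M.nat 1 0 = L
  block : M.nat 2 0 = 2 ^ L
  half : M.nat 3 0 = H
  size : M.nat 4 0 = 2 * H

theorem Mem.Shape.of_agree {M M' : Mem} {d L H : ℕ} (h : M.Shape d L H) {A B : List ℕ}
    (hA : Mem.Agree A B M M') (h0 : ∀ k < 5, k ∉ A) : M'.Shape d L H :=
  ⟨by rw [hA.nat 0 (h0 0 (by decide)), h.dim], by rw [hA.nat 1 (h0 1 (by decide)), h.steps],
    by rw [hA.nat 2 (h0 2 (by decide)), h.block], by rw [hA.nat 3 (h0 3 (by decide)), h.half],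
    by rw [hA.nat 4 (h0 4 (by decide)), h.size]⟩

theorem succ_mod_eq_ite (k : ℕ) {D : ℕ} (hD : 0 < D) :
    (k + 1) % D = if k % D + 1 < D then k % D + 1 else 0 := by
  have h1 : k + 1 = D * (k / D) + (k % D + 1) := by
    have := Nat.div_add_mod k D
    omega
  have h2 := Nat.mod_lt k hD
  rw [h1, Nat.mul_add_mod]
  clear h1
  split_ifs with h
  · exact Nat.mod_eq_of_lt h
  · rw [show k % D + 1 = D by omega, Nat.mod_self]

section

variable {ω : Tape} {M : Mem} {s d L H : ℕ}

theorem fillCellProg_wp (hS : M.Shape d L H) {k : ℕ} (h8 : M.nat 8 0 = k)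
    (h9 : M.nat 9 0 = k % 2 ^ L) :
    fillCellProg.Wp ω M s 20 fun M' s' => s' = s ∧
      M' = M.setReal 6 k (scaledCopies (2 ^ L) d (M.real 4) (M.real 0) k) := by
  refine (Prog.Wp.branch (T := 12) (fun h => ?_) fun h => ?_).mono (by decide) fun _ _ h => h
  · refine (Prog.Wp.setReal ?_).mono (by decide) fun _ _ h => h
    simp only [Test.holds, NatExp.eval, h9, hS.dim] at h
    simp [NatExp.eval, RealExp.eval, h8, h9, scaledCopies, h]
  · refine (Prog.Wp.setReal ?_).mono (by decide) fun _ _ h => h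
    simp only [Test.holds, NatExp.eval, h9, hS.dim] at h
    simp [NatExp.eval, RealExp.eval, h8, scaledCopies, h]

theorem nextProg_wp (hS : M.Shape d L H) {k : ℕ} (h9 : M.nat 9 0 = k % 2 ^ L) :
    nextProg.Wp ω M s 20 fun M' s' => s' = s ∧ Mem.Agree [9] [] M M' ∧
      M'.nat 9 0 = (k + 1) % 2 ^ L := by
  rw [succ_mod_eq_ite k (by positivity)]
  refine (Prog.Wp.seq (Prog.Wp.setNat (Prog.Wp.branch (T := 3) (fun h => ?_) fun h => ?_))).mono
    (by decide) fun _ _ h => h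
  all_goals simp [Test.holds, NatExp.eval, Mem.setNat_nat, h9, hS.block] at h
  · refine (Prog.Wp.skip ?_).mono (by decide) fun _ _ h => h
    exact ⟨rfl, Mem.Agree.refl.setNat (by decide) _ _, by
      simp [Mem.setNat_nat, NatExp.eval, h9, h]⟩
  · refine (Prog.Wp.setNat ?_).mono (by decide) fun _ _ h => h
    exact ⟨rfl, (Mem.Agree.refl.setNat (by decide) _ _).setNat (by decide) _ _, by
      simp [Mem.setNat_nat, NatExp.eval, h]⟩

theorem fillProg_wp (hS : M.Shape d L H) :
    fillProg.Wp ω M s ((2 * H + 1) * 56 + 3) fun M' s' => s' = s ∧ Mem.Agree [8, 9] [6] M M' ∧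
      ∀ p < 2 * H, M'.real 6 p = scaledCopies (2 ^ L) d (M.real 4) (M.real 0) p := by
  have hfor := Prog.Wp.for (ω := ω) (M := M.setNat 9 0 0) (s := s) (c := 8) (n := .var 4)
    (p := fillCellProg ;; nextProg) (B := 40) (2 * H)
    (fun k M' s' => s' = s ∧ Mem.Agree [8, 9] [6] M M' ∧ M'.nat 9 0 = k % 2 ^ L ∧
      ∀ p < k, M'.real 6 p = scaledCopies (2 ^ L) d (M.real 4) (M.real 0) p)
    ⟨rfl, (Mem.Agree.refl.setNat (by decide) _ _).setNat (by decide) _ _, by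
      simp [Mem.setNat_nat], by simp⟩
    (by
      rintro k M' s' ⟨-, hA, -⟩
      simp [NatExp.eval, hA.nat 4 (by decide), hS.size])
    (by
      rintro k M' s' hk hc ⟨rfl, hA, h9, h6⟩
      have hS' := hS.of_agree hA (by decide)
      refine Prog.Wp.seq (T := 20) (T' := 20) ((fillCellProg_wp hS' hc h9).mono le_rfl ?_)
      rintro M₁ s₁ ⟨rfl, rfl⟩
      have hA₁ : Mem.Agree [8, 9] [6] M' (M'.setReal 6 k
        (scaledCopies (2 ^ L) d (M'.real 4) (M'.real 0) k)) :=
        Mem.Agree.refl.setReal (by decide) _ _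
      refine (nextProg_wp (hS'.of_agree hA₁ (by decide)) (k := k) (by simpa using h9)).mono le_rfl ?_
      rintro M₂ s₂ ⟨rfl, hA₂, h9'⟩
      refine ⟨by rw [hA₂.nat 8 (by decide)]; simpa using hc, rfl,
        ((hA.trans hA₁).trans (hA₂.weaken (by decide) (by decide))).setNat (by decide) _ _,
        by simpa [Mem.setNat_nat] using h9', fun p hp => ?_⟩
      rw [Mem.setNat_real, hA₂.real 6 (by decide), Mem.setReal_real, hA.real 4 (by decide),
        hA.real 0 (by decide)]
      rcases eq_or_ne p k with rfl | hpk
      · simp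
      · simpa [hpk] using h6 p (by omega))
  refine (Prog.Wp.seq (Prog.Wp.setNat hfor)).mono ?_ fun M' s' h => ⟨h.1, h.2.1, h.2.2.2⟩
  simp only [NatExp.cost]
  omega

theorem butterflyProg_wp (hS : M.Shape d L H) :
    butterflyProg.Wp ω M s ((H + 1) * 70) fun M' s' => s' = s ∧ Mem.Agree [8] [7] M M' ∧
      ∀ p < 2 * H, M'.real 7 p = butterfly H (M.real 6) p := by
  have hfor := Prog.Wp.for (ω := ω) (M := M) (s := s) (c := 8) (n := .var 3)
    (p := butterflyCellProg) (B := 44) H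
    -- Round `k` writes the cells `k` and `H + k`. The target is a separate array because cells
    -- still to be read would otherwise be overwritten.
    (fun k M' s' => s' = s ∧ Mem.Agree [8] [7] M M' ∧
      ∀ p < 2 * H, (p < k ∨ H ≤ p ∧ p < H + k) → M'.real 7 p = butterfly H (M.real 6) p)
    ⟨rfl, Mem.Agree.refl.setNat (by decide) _ _, by omega⟩
    (by
      rintro k M' s' ⟨-, hA, -⟩
      simp [NatExp.eval, hA.nat 3 (by decide), hS.half])
    (by
      rintro k M' s' hk hc ⟨rfl, hA, h7⟩
      have hS' := hS.of_agree hA (by decide)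
      refine Prog.Wp.mono (Prog.Wp.seq (Prog.Wp.setReal (Prog.Wp.setReal ?_))) (by decide)
        fun _ _ h => h
      refine ⟨by simpa using hc, rfl, ((hA.setReal (by decide) _ _).setReal (by decide) _ _).setNat
        (by decide) _ _, fun p hp hpk => ?_⟩
      have h6 := hA.real 6 (by decide)
      simp only [NatExp.eval, RealExp.eval, Mem.setNat_real, Mem.setReal_real, hc, hS'.half,
        Mem.setReal_nat, h6]
      by_cases h1 : p = H + k
      · subst h1
        simp [butterfly]
      by_cases h2 : p = k
      · subst h2
        simp [show H ≠ 0 by omega, butterfly, hk]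
      simpa [h1, h2] using h7 p hp (by omega))
  refine hfor.mono ?_ fun M' s' h => ⟨h.1, h.2.1, fun p hp => h.2.2 p hp (by omega)⟩
  simp only [NatExp.cost]
  omega

theorem copyBackProg_wp (hS : M.Shape d L H) :
    copyBackProg.Wp ω M s ((2 * H + 1) * 30) fun M' s' => s' = s ∧ Mem.Agree [8] [6] M M' ∧
      ∀ p < 2 * H, M'.real 6 p = M.real 7 p := by
  have hfor := Prog.Wp.for (ω := ω) (M := M) (s := s) (c := 8) (n := .var 4)
    (p := .setReal 6 (.var 8) (.get 7 (.var 8))) (B := 8) (2 * H)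
    (fun k M' s' => s' = s ∧ Mem.Agree [8] [6] M M' ∧ ∀ p < k, M'.real 6 p = M.real 7 p)
    ⟨rfl, Mem.Agree.refl.setNat (by decide) _ _, by omega⟩
    (by
      rintro k M' s' ⟨-, hA, -⟩
      simp [NatExp.eval, hA.nat 4 (by decide), hS.size])
    (by
      rintro k M' s' hk hc ⟨rfl, hA, h6⟩
      refine Prog.Wp.mono (Prog.Wp.setReal ?_) (by decide) fun _ _ h => h
      refine ⟨by simpa using hc, rfl, (hA.setReal (by decide) _ _).setNat (by decide) _ _,
        fun p hp => ?_⟩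
      have h7 := hA.real 7 (by decide)
      simp only [NatExp.eval, RealExp.eval, Mem.setNat_real, Mem.setReal_real, hc, h7]
      by_cases h1 : p = k
      · simp [h1]
      simpa [h1] using h6 p (by omega))
  refine hfor.mono ?_ fun M' s' h => h
  simp only [NatExp.cost]
  omega

theorem butterfly_congr {x y : ℕ → ℝ} (h : ∀ p < 2 * H, x p = y p) {p : ℕ} (hp : p < 2 * H) :
    butterfly H x p = butterfly H y p := by
  unfold butterfly
  split_ifs
  · rw [h _ (by omega), h _ (by omega)]
  · rw [h _ (by omega), h _ (by omega)]

theorem embedProg_wp (hS : M.Shape d L H) :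
    embedProg.Wp ω M s ((L + 2) * (2 * H + 2) * 100) fun M' s' => s' = s ∧
      Mem.Agree [8, 9, 10] [6, 7] M M' ∧
      ∀ p < 2 * H, M'.real 6 p = embed H L d (M.real 4) (M.real 0) p := by
  have htime : (2 * H + 1) * 56 + 3 + (L + 1) * ((H + 1) * 70 + (2 * H + 1) * 30 + 16)
      ≤ (L + 2) * (2 * H + 2) * 100 := by nlinarith
  refine Prog.Wp.mono (Prog.Wp.seq ((fillProg_wp hS).mono le_rfl ?_)) htime fun _ _ h => h
  rintro M₁ s₁ ⟨rfl, hA₁, h₁⟩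
  have hfor := Prog.Wp.for (ω := ω) (M := M₁) (s := s₁) (c := 10) (n := .var 1)
    (p := butterflyProg ;; copyBackProg) (B := (H + 1) * 70 + (2 * H + 1) * 30) L
    (fun k M' s' => s' = s₁ ∧ Mem.Agree [8, 9, 10] [6, 7] M M' ∧ ∀ p < 2 * H, M'.real 6 p =
      (butterfly H)^[k] (scaledCopies (2 ^ L) d (M.real 4) (M.real 0)) p)
    ⟨rfl, (hA₁.weaken (by decide) (by decide)).setNat (by decide) _ _, h₁⟩
    (by
      rintro k M' s' ⟨-, hA, -⟩
      simp [NatExp.eval, hA.nat 1 (by decide), hS.steps])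
    (by
      rintro k M' s' hk hc ⟨rfl, hA, h6⟩
      have hS' := hS.of_agree hA (by decide)
      refine Prog.Wp.seq ((butterflyProg_wp hS').mono le_rfl ?_)
      rintro M₂ s₂ ⟨rfl, hA₂, h₂⟩
      refine (copyBackProg_wp (hS'.of_agree hA₂ (by decide))).mono le_rfl ?_
      rintro M₃ s₃ ⟨rfl, hA₃, h₃⟩
      refine ⟨by rw [hA₃.nat 10 (by decide), hA₂.nat 10 (by decide), hc], rfl,
        ((hA.trans (hA₂.weaken (by decide) (by decide))).trans
          (hA₃.weaken (by decide) (by decide))).setNat (by decide) _ _, fun p hp => ?_⟩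
      rw [Mem.setNat_real, h₃ p hp, h₂ p hp, Function.iterate_succ_apply']
      exact butterfly_congr h6 hp)
  refine hfor.mono ?_ fun M' s' h => h
  simp only [NatExp.cost]
  exact le_rfl

end

/-! ### Creation and insertion -/

/-- The number of steps of the transform. -/
noncomputable def stepCount (d : ℕ) : ℕ := ceilLog (d / 2) + 1

/-- The logarithmic factor in the size of the embedding. -/
noncomputable def logParam (d : ℕ) (δ : ℝ) : ℝ := Real.log (32 * d / δ)

/-- The binary logarithm of the number of blocks. -/
noncomputable def blockExp (d : ℕ) (ε δ : ℝ) : ℕ :=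
  ceilLog (16777216 * ((2 * (stepCount d + 1 : ℕ)) * (2 * (stepCount d + 1 : ℕ)) * logParam d δ)
    / (ε * ε))

/-- Half of the number of coordinates of an embedded vector. -/
noncomputable def halfSize (d : ℕ) (ε δ : ℝ) : ℕ := 2 ^ blockExp d ε δ * 2 ^ ceilLog ((d : ℝ) / 2)

/-- The square of the truncation threshold. -/
noncomputable def threshSq (d : ℕ) (ε δ : ℝ) : ℝ := 8 * Real.log (12 * 2 ^ blockExp d ε δ)

/-- The binary logarithm of the number of samples in a group. -/
noncomputable def groupExp (d : ℕ) (ε δ : ℝ) : ℕ :=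
  ceilLog (16384 * ((2 * (stepCount d + 1 : ℕ)) * (2 * (stepCount d + 1 : ℕ)) * threshSq d ε δ)
    / (ε * ε))

/-- Stores the parameters and the number of transform steps. -/
def initProg : Prog :=
  .letReal 2 (.var 0) ;; .letReal 3 (.get 0 (.const 1)) ;;
    .powTwo 2 1 (.div (.ofNat (.var 0)) (.ofNat (.const 2))) ;;
      .letNat 1 (.add (.var 1) (.const 1)) ;; .letNat 2 (.add (.var 2) (.var 2))

/-- Computes the number of blocks. -/
def blockProg : Prog :=
  .letReal 14 (.mul (.ofNat (.const 2)) (.ofNat (.add (.var 1) (.const 1)))) ;;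
    .letReal 15 (.log (.div (.mul (.ofNat (.const 32)) (.ofNat (.var 0))) (.var 3))) ;;
      .powTwo 22 23 (.div (.mul (.ofNat (.const 16777216))
        (.mul (.mul (.var 14) (.var 14)) (.var 15))) (.mul (.var 2) (.var 2)))

/-- Computes the size of the embedding. -/
def halfProg : Prog :=
  .letNat 3 (.var 22) ;; .for 21 (.sub (.var 1) (.const 1)) (.letNat 3 (.add (.var 3) (.var 3))) ;;
    .letNat 4 (.add (.var 3) (.var 3))

/-- Computes the number of samples in a group. -/
def groupSizeProg : Prog :=
  .letReal 16 (.mul (.ofNat (.const 8)) (.log (.mul (.ofNat (.const 12)) (.ofNat (.var 22))))) ;;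
    .powTwo 5 24 (.div (.mul (.ofNat (.const 16384))
      (.mul (.mul (.var 14) (.var 14)) (.var 16))) (.mul (.var 2) (.var 2)))

/-- Draws the seeds. -/
def seedProg : Prog := .for 8 (.var 4) (.gauss 4 (.var 8))

/-- Creates the data structure. -/
def createProg : Prog := initProg ;; blockProg ;; halfProg ;; groupSizeProg ;; seedProg

/-- Stores an embedded point. -/
def storeProg : Prog :=
  .for 8 (.var 4) (.setReal 5 (.add (.var 7) (.var 8)) (.get 6 (.var 8))) ;;
    .letNat 7 (.add (.var 7) (.var 4)) ;; .letNat 6 (.add (.var 6) (.const 1))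

/-- Inserts a point. -/
def insertProg : Prog := embedProg ;; storeProg

/-- The invariant of the data structure: `X` is the database and `g` are the seeds. -/
structure Mem.Ready (M : Mem) (d : ℕ) (ε δ : ℝ) (g : ℕ → ℝ)
    (X : List (EuclideanSpace ℝ (Fin d))) : Prop where
  shape : M.Shape d (stepCount d) (halfSize d ε δ)
  group : M.nat 5 0 = 2 ^ groupExp d ε δ
  count : M.nat 6 0 = X.length
  base : M.nat 7 0 = X.length * (2 * halfSize d ε δ)
  eps : M.real 2 0 = ε
  delta : M.real 3 0 = δ
  seeds : ∀ p < 2 * halfSize d ε δ, M.real 4 p = g p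
  points : ∀ (i : ℕ) (hi : i < X.length), ∀ p < 2 * halfSize d ε δ,
    M.real 5 (i * (2 * halfSize d ε δ) + p) =
      embed (halfSize d ε δ) (stepCount d) d g (coords X[i]) p

section

variable {ω : Tape} {M : Mem} {s d : ℕ} {ε δ : ℝ}

theorem initProg_wp (h0 : M.nat 0 0 = d) :
    initProg.Wp ω M s ((stepCount d + 1) * 40) fun M' s' => s' = s ∧ Mem.Agree [1, 2] [2, 3] M M' ∧
      M'.nat 1 0 = stepCount d ∧ M'.nat 2 0 = 2 ^ stepCount d ∧ M'.real 2 0 = M.real 0 0 ∧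
      M'.real 3 0 = M.real 0 1 := by
  refine Prog.Wp.mono (Prog.Wp.seq (Prog.Wp.setReal (Prog.Wp.seq (Prog.Wp.setReal
    (Prog.Wp.seq (T' := 15) ((Prog.Wp.powTwo (v := (d : ℝ) / 2) (by decide) ?_).mono le_rfl ?_))))))
    ?_ fun _ _ h => h
  · intro M' hA
    simp [NatExp.eval, RealExp.eval, hA.nat 0 (by decide), h0]
  · rintro M' s' ⟨rfl, hA, h2, h1⟩
    refine Prog.Wp.mono (Prog.Wp.seq (Prog.Wp.setNat (Prog.Wp.setNat ?_))) (by decide)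
      fun _ _ h => h
    refine ⟨rfl, ((((Mem.Agree.refl.setReal (by decide) _ _).setReal (by decide) _ _).trans
      (hA.weaken (by decide) (by decide))).setNat (by decide) _ _).setNat (by decide) _ _, ?_, ?_,
      ?_, ?_⟩
    · simp [NatExp.eval, Mem.setNat_nat, h1, stepCount]
    · simp [NatExp.eval, Mem.setNat_nat, h2, stepCount, pow_succ, mul_two]
    · simp [NatExp.eval, RealExp.eval, hA.real 2 (by decide), Mem.setReal_real]
    · simp [NatExp.eval, RealExp.eval, hA.real 3 (by decide), Mem.setReal_real]
  · simp only [NatExp.cost, RealExp.cost, stepCount]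
    omega

theorem blockProg_wp (h0 : M.nat 0 0 = d) (h1 : M.nat 1 0 = stepCount d) (h2 : M.real 2 0 = ε)
    (h3 : M.real 3 0 = δ) :
    blockProg.Wp ω M s ((blockExp d ε δ + 1) * 100) fun M' s' => s' = s ∧
      Mem.Agree [22, 23] [14, 15] M M' ∧ M'.nat 22 0 = 2 ^ blockExp d ε δ ∧
      M'.real 14 0 = 2 * (stepCount d + 1 : ℕ) := by
  refine Prog.Wp.mono (Prog.Wp.seq (Prog.Wp.setReal (Prog.Wp.seq (Prog.Wp.setReal
    ((Prog.Wp.powTwo (v := 16777216 * ((2 * (stepCount d + 1 : ℕ)) * (2 * (stepCount d + 1 : ℕ)) *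
      logParam d δ) / (ε * ε)) (by decide) ?_).mono le_rfl ?_)))))
    ?_ fun _ _ h => h
  · intro M' hA
    simp [NatExp.eval, RealExp.eval, hA.real 14 (by decide), hA.real 15 (by decide),
      hA.real 2 (by decide), h0, h1, h2, h3, Mem.setReal_real, logParam]
  · rintro M' s' ⟨rfl, hA, h22, -⟩
    refine ⟨rfl, ((Mem.Agree.refl.setReal (by decide) _ _).setReal (by decide) _ _).trans
      (hA.weaken (by decide) (by decide)), h22, ?_⟩
    simp [NatExp.eval, RealExp.eval, hA.real 14 (by decide), h1, Mem.setReal_real]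
  · simp only [NatExp.cost, RealExp.cost, blockExp]
    omega

theorem halfProg_wp (h1 : M.nat 1 0 = stepCount d) (h22 : M.nat 22 0 = 2 ^ blockExp d ε δ) :
    halfProg.Wp ω M s ((stepCount d + 1) * 40) fun M' s' => s' = s ∧ Mem.Agree [3, 4, 21] [] M M' ∧
      M'.nat 3 0 = halfSize d ε δ ∧ M'.nat 4 0 = 2 * halfSize d ε δ := by
  refine Prog.Wp.mono (Prog.Wp.seq (Prog.Wp.setNat (Prog.Wp.seq (T' := 7)
    ((Prog.Wp.for (B := 7) (ceilLog ((d : ℝ) / 2)) (fun k M' s' => s' = s ∧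
      Mem.Agree [3, 4, 21] [] M M' ∧ M'.nat 3 0 = 2 ^ blockExp d ε δ * 2 ^ k) ?_ ?_ ?_).mono
        le_rfl ?_)))) ?_ fun _ _ h => h
  · exact ⟨rfl, (Mem.Agree.refl.setNat (by decide) _ _).setNat (by decide) _ _, by
      simp [NatExp.eval, Mem.setNat_nat, h22]⟩
  · rintro k M' s' ⟨-, hA, -⟩
    simp [NatExp.eval, hA.nat 1 (by decide), h1, stepCount]
  · rintro k M' s' hk hc ⟨rfl, hA, h3⟩
    refine Prog.Wp.setNat ?_
    refine ⟨by simpa [Mem.setNat_nat] using hc, rfl, (hA.setNat (by decide) _ _).setNat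
      (by decide) _ _, ?_⟩
    simp [NatExp.eval, Mem.setNat_nat, h3, pow_succ, mul_two, mul_add]
  · rintro M' s' ⟨rfl, hA, h3⟩
    refine Prog.Wp.setNat ⟨rfl, hA.setNat (by decide) _ _, ?_, ?_⟩
    · simp [Mem.setNat_nat, h3, halfSize]
    · simp [NatExp.eval, Mem.setNat_nat, h3, halfSize, two_mul]
  · simp only [NatExp.cost, stepCount]
    omega

theorem groupSizeProg_wp (h2 : M.real 2 0 = ε) (h22 : M.nat 22 0 = 2 ^ blockExp d ε δ)
    (h14 : M.real 14 0 = 2 * (stepCount d + 1 : ℕ)) :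
    groupSizeProg.Wp ω M s ((groupExp d ε δ + 1) * 100) fun M' s' => s' = s ∧
      Mem.Agree [5, 24] [16] M M' ∧ M'.nat 5 0 = 2 ^ groupExp d ε δ := by
  refine Prog.Wp.mono (Prog.Wp.seq (Prog.Wp.setReal
    ((Prog.Wp.powTwo (v := 16384 * ((2 * (stepCount d + 1 : ℕ)) * (2 * (stepCount d + 1 : ℕ)) *
      threshSq d ε δ) / (ε * ε)) (by decide) ?_).mono le_rfl ?_)))
    ?_ fun _ _ h => h
  · intro M' hA
    simp [NatExp.eval, RealExp.eval, hA.real 14 (by decide), hA.real 16 (by decide),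
      hA.real 2 (by decide), h14, h22, h2, Mem.setReal_real, threshSq]
  · rintro M' s' ⟨rfl, hA, h5, -⟩
    exact ⟨rfl, (Mem.Agree.refl.setReal (by decide) _ _).trans
      (hA.weaken (by decide) (by decide)), h5⟩
  · simp only [NatExp.cost, RealExp.cost, groupExp]
    omega

/-- The earlier parts of the creation draw nothing, so this loop starts at position 0 of the tape
and seed `p` is entry `p`. -/
theorem seedProg_wp {N : ℕ} (h4 : M.nat 4 0 = N) :
    seedProg.Wp ω M 0 ((N + 1) * 20) fun M' _ => Mem.Agree [8] [4] M M' ∧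
      ∀ p < N, M'.real 4 p = (ω p).1 := by
  have hfor := Prog.Wp.for (ω := ω) (M := M) (s := 0) (c := 8) (n := .var 4)
    (p := .gauss 4 (.var 8)) (B := 3) N
    (fun k M' s' => s' = k ∧ Mem.Agree [8] [4] M M' ∧ ∀ p < k, M'.real 4 p = (ω p).1)
    ⟨rfl, Mem.Agree.refl.setNat (by decide) _ _, by omega⟩
    (by
      rintro k M' s' ⟨-, hA, -⟩
      simp [NatExp.eval, hA.nat 4 (by decide), h4])
    (by
      rintro k M' s' hk hc ⟨rfl, hA, h⟩
      refine Prog.Wp.gauss ?_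
      refine ⟨by simpa using hc, rfl, (hA.setReal (by decide) _ _).setNat (by decide) _ _,
        fun p hp => ?_⟩
      simp only [NatExp.eval, Mem.setNat_real, Mem.setReal_real, hc]
      by_cases h1 : p = s'
      · simp [h1]
      simpa [h1] using h p (by omega))
  refine hfor.mono ?_ fun M' s' h => h.2
  simp only [NatExp.cost]
  omega

theorem createProg_wp :
    createProg.Wp ω (inputMem d ε δ) 0 ((stepCount d + 1) * 40 + ((blockExp d ε δ + 1) * 100 +
      ((stepCount d + 1) * 40 + ((groupExp d ε δ + 1) * 100 + (2 * halfSize d ε δ + 1) * 20))))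
      fun M' _ => M'.Ready d ε δ (seeds ω) [] := by
  refine Prog.Wp.seq ((initProg_wp (by simp [inputMem])).mono le_rfl ?_)
  rintro M₁ s₁ ⟨rfl, hA₁, h1, h2, he, hd⟩
  have h0 : M₁.nat 0 0 = d := by simp [hA₁.nat 0 (by decide), inputMem]
  replace he : M₁.real 2 0 = ε := by simpa [inputMem] using he
  replace hd : M₁.real 3 0 = δ := by simpa [inputMem] using hd
  refine Prog.Wp.seq ((blockProg_wp h0 h1 he hd).mono le_rfl ?_)
  rintro M₂ s₂ ⟨rfl, hA₂, h22, h14⟩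
  refine Prog.Wp.seq ((halfProg_wp (by rw [hA₂.nat 1 (by decide), h1]) h22).mono le_rfl ?_)
  rintro M₃ s₃ ⟨rfl, hA₃, h3, h4⟩
  have hA₁₃ := (hA₂.weaken (A' := [3, 4, 21, 22, 23]) (by decide) (List.Subset.refl _)).trans
    (hA₃.weaken (by decide) (by decide))
  refine Prog.Wp.seq ((groupSizeProg_wp (by rw [hA₁₃.real 2 (by decide), he])
    (by rw [hA₃.nat 22 (by decide), h22]) (by rw [hA₃.real 14 (by decide), h14])).mono le_rfl ?_)
  rintro M₄ s₄ ⟨rfl, hA₄, h5⟩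
  refine (seedProg_wp (by rw [hA₄.nat 4 (by decide), h4])).mono le_rfl ?_
  rintro M₅ - ⟨hA₅, h⟩
  have hA₁₅ := ((hA₁₃.weaken (A' := [3, 4, 5, 8, 21, 22, 23, 24]) (B' := [4, 14, 15, 16])
    (by decide) (by decide)).trans (hA₄.weaken (by decide) (by decide))).trans
    (hA₅.weaken (by decide) (by decide))
  refine ⟨⟨?_, ?_, ?_, ?_, ?_⟩, ?_, ?_, ?_, ?_, ?_, h, by simp⟩
  · rw [hA₁₅.nat 0 (by decide), h0]
  · rw [hA₁₅.nat 1 (by decide), h1]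
  · rw [hA₁₅.nat 2 (by decide), h2]
  · rw [hA₅.nat 3 (by decide), hA₄.nat 3 (by decide), h3]
  · rw [hA₅.nat 4 (by decide), hA₄.nat 4 (by decide), h4]
  · rw [hA₅.nat 5 (by decide), h5]
  · rw [hA₁₅.nat 6 (by decide), hA₁.nat 6 (by decide)]; simp [inputMem]
  · rw [hA₁₅.nat 7 (by decide), hA₁.nat 7 (by decide)]; simp [inputMem]
  · rw [hA₁₅.real 2 (by decide), he]
  · rw [hA₁₅.real 3 (by decide), hd]

/-- `B` is the end of the stored coordinates. It is advanced by addition, so no product of an index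
and a size is ever computed. -/
theorem storeProg_wp {N B n : ℕ} (h4 : M.nat 4 0 = N) (h7 : M.nat 7 0 = B) (h6 : M.nat 6 0 = n) :
    storeProg.Wp ω M s ((N + 2) * 32) fun M' _ => Mem.Agree [6, 7, 8] [5] M M' ∧
      M'.nat 6 0 = n + 1 ∧ M'.nat 7 0 = B + N ∧ (∀ p < N, M'.real 5 (B + p) = M.real 6 p) ∧
      ∀ p < B, M'.real 5 p = M.real 5 p := by
  have hfor := Prog.Wp.for (ω := ω) (M := M) (s := s) (c := 8) (n := .var 4)
    (p := .setReal 5 (.add (.var 7) (.var 8)) (.get 6 (.var 8))) (B := 11) N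
    (fun k M' _ => Mem.Agree [8] [5] M M' ∧ (∀ p < k, M'.real 5 (B + p) = M.real 6 p) ∧
      ∀ p < B, M'.real 5 p = M.real 5 p)
    ⟨Mem.Agree.refl.setNat (by decide) _ _, by omega, fun _ _ => rfl⟩
    (by
      rintro k M' s' ⟨hA, -⟩
      simp [NatExp.eval, hA.nat 4 (by decide), h4])
    (by
      rintro k M' s' hk hc ⟨hA, h, h'⟩
      refine Prog.Wp.mono (Prog.Wp.setReal ?_) (by decide) fun _ _ h => h
      have h6' := hA.real 6 (by decide)
      refine ⟨by simpa using hc, (hA.setReal (by decide) _ _).setNat (by decide) _ _,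
        fun p hp => ?_, fun p hp => ?_⟩
      · simp only [NatExp.eval, RealExp.eval, Mem.setNat_real, Mem.setReal_real, hc,
          hA.nat 7 (by decide), h7, h6']
        by_cases h1 : p = k
        · simp [h1]
        simpa [h1] using h p (by omega)
      · simp only [NatExp.eval, RealExp.eval, Mem.setNat_real, Mem.setReal_real, hc,
          hA.nat 7 (by decide), h7]
        simpa [show p ≠ B + k by omega] using h' p hp)
  have htime : (N + 1) * (11 + 2 + 14) + (7 + 6) ≤ (N + 2) * 32 := by omega
  refine Prog.Wp.mono (Prog.Wp.seq (hfor.mono le_rfl ?_)) htime fun _ _ h => h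
  rintro M' s' ⟨hA, h, h'⟩
  refine Prog.Wp.seq (Prog.Wp.setNat (Prog.Wp.setNat ?_))
  refine ⟨((hA.weaken (by decide) (by decide)).setNat (by decide) _ _).setNat (by decide) _ _,
    ?_, ?_, h, h'⟩
  · simp [NatExp.eval, Mem.setNat_nat, hA.nat 6 (by decide), h6]
  · simp [NatExp.eval, Mem.setNat_nat, hA.nat 7 (by decide), hA.nat 4 (by decide), h7, h4]

theorem scaledCopies_congr {D d : ℕ} {g g' x x' : ℕ → ℝ} {p : ℕ} (hg : g p = g' p)
    (hx : ∀ k < d, x k = x' k) : scaledCopies D d g x p = scaledCopies D d g' x' p := by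
  unfold scaledCopies
  split_ifs with h
  · rw [hg, hx _ h]
  · rfl

/-- Memory determines the seeds only below `2 * H` and the vector only below `d`; nothing else
influences the relevant coordinates. -/
theorem embed_congr {H L d : ℕ} {g g' x x' : ℕ → ℝ} (hg : ∀ p < 2 * H, g p = g' p)
    (hx : ∀ k < d, x k = x' k) {p : ℕ} (hp : p < 2 * H) :
    embed H L d g x p = embed H L d g' x' p := by
  have h : ∀ k, ∀ p < 2 * H, (butterfly H)^[k] (scaledCopies (2 ^ L) d g x) p =
      (butterfly H)^[k] (scaledCopies (2 ^ L) d g' x') p := by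
    intro k
    induction k with
    | zero => exact fun p hp => scaledCopies_congr (hg p hp) hx
    | succ k ih =>
      intro p hp
      rw [Function.iterate_succ_apply', Function.iterate_succ_apply']
      exact butterfly_congr ih hp
  exact h L p hp

theorem Mem.Ready.load {M : Mem} {g : ℕ → ℝ} {X : List (EuclideanSpace ℝ (Fin d))}
    (h : M.Ready d ε δ g X) (x : EuclideanSpace ℝ (Fin d)) : (M.load x).Ready d ε δ g X := by
  obtain ⟨⟨h0, h1, h2, h3, h4⟩, h5, h6, h7, h8, h9, h10, h11⟩ := h
  exact ⟨⟨h0, h1, h2, h3, h4⟩, h5, h6, h7, by simpa [Mem.load] using h8,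
    by simpa [Mem.load] using h9, by simpa [Mem.load] using h10, by simpa [Mem.load] using h11⟩

/-- The embedding program applied to an argument of an insertion or a query. -/
theorem Mem.Ready.embedProg_wp {g : ℕ → ℝ} {X : List (EuclideanSpace ℝ (Fin d))}
    (h : M.Ready d ε δ g X) (x : EuclideanSpace ℝ (Fin d)) :
    embedProg.Wp ω (M.load x) s ((stepCount d + 2) * (2 * halfSize d ε δ + 2) * 100) fun M' s' =>
      s' = s ∧ M'.Ready d ε δ g X ∧ ∀ p < 2 * halfSize d ε δ,
        M'.real 6 p = embed (halfSize d ε δ) (stepCount d) d g (coords x) p := by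
  refine (_root_.embedProg_wp (h.load x).shape).mono le_rfl ?_
  rintro M' s' ⟨rfl, hA, h6⟩
  have h' := h.load x
  refine ⟨rfl, ⟨h'.shape.of_agree hA (by decide), ?_, ?_, ?_, ?_, ?_, ?_, ?_⟩, fun p hp => ?_⟩
  · rw [hA.nat 5 (by decide), h'.group]
  · rw [hA.nat 6 (by decide), h'.count]
  · rw [hA.nat 7 (by decide), h'.base]
  · rw [hA.real 2 (by decide), h'.eps]
  · rw [hA.real 3 (by decide), h'.delta]
  · rw [hA.real 4 (by decide)]; exact h'.seeds
  · rw [hA.real 5 (by decide)]; exact h'.points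
  · rw [h6 p hp]
    refine embed_congr h'.seeds (fun k hk => ?_) hp
    simp [Mem.load, hk, coords]

theorem insertProg_wp {g : ℕ → ℝ} {X : List (EuclideanSpace ℝ (Fin d))}
    (h : M.Ready d ε δ g X) (x : EuclideanSpace ℝ (Fin d)) :
    insertProg.Wp ω (M.load x) s ((stepCount d + 2) * (2 * halfSize d ε δ + 2) * 100 +
      (2 * halfSize d ε δ + 2) * 32) fun M' _ => M'.Ready d ε δ g (X ++ [x]) := by
  refine Prog.Wp.seq ((h.embedProg_wp x).mono le_rfl ?_)
  rintro M₁ s₁ ⟨-, h₁, hx⟩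
  refine (storeProg_wp h₁.shape.size h₁.base h₁.count).mono le_rfl ?_
  rintro M₂ - ⟨hA, h6, h7, hnew, hold⟩
  refine ⟨h₁.shape.of_agree hA (by decide), ?_, ?_, ?_, ?_, ?_, ?_, fun i hi p hp => ?_⟩
  · rw [hA.nat 5 (by decide), h₁.group]
  · rw [h6, List.length_append, List.length_singleton]
  · rw [h7, List.length_append, List.length_singleton]; ring
  · rw [hA.real 2 (by decide), h₁.eps]
  · rw [hA.real 3 (by decide), h₁.delta]
  · rw [hA.real 4 (by decide)]; exact h₁.seeds
  · rcases Nat.lt_or_ge i X.length with hiX | hiX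
    · rw [hold, h₁.points i hiX p hp, List.getElem_append_left hiX]
      calc i * (2 * halfSize d ε δ) + p < (i + 1) * (2 * halfSize d ε δ) := by
            rw [Nat.succ_mul i]; exact Nat.add_lt_add_left hp _
        _ ≤ _ := Nat.mul_le_mul_right _ hiX
    · obtain rfl : i = X.length := by
        rw [List.length_append, List.length_singleton] at hi; omega
      rw [hnew p hp, hx p hp]
      simp

end

/-! ### Queries -/

/-- Adds one sampled squared coordinate to the accumulator. -/
def sampleProg : Prog :=
  .unif 11 (.const 0) (.var 4) ;;
    .letReal 13 (.sub (.get 6 (.var 11)) (.get 5 (.add (.var 13) (.var 11)))) ;;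
      .letReal 8 (.add (.var 8) (.mul (.var 13) (.var 13)))

/-- Computes the mean of one group of samples. -/
def groupProg : Prog :=
  .letReal 8 (.ofNat (.const 0)) ;; .for 15 (.var 5) sampleProg ;;
    .setReal 9 (.var 14) (.div (.var 8) (.ofNat (.var 5))) ;;
      .letReal 10 (.add (.var 10) (.get 9 (.var 14)))

/-- Counts the group means that are at most the midpoint. -/
def countProg : Prog :=
  .letNat 16 (.const 0) ;; .for 21 (.var 17)
    (.branch (.realLt (.var 12) (.get 9 (.var 21))) .skip (.letNat 16 (.add (.var 16) (.const 1))))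

/-- One step of the bisection. -/
def bisectProg : Prog :=
  .letReal 12 (.div (.add (.var 11) (.var 10)) (.ofNat (.const 2))) ;; countProg ;;
    .branch (.natLt (.add (.var 16) (.var 16)) (.var 17)) (.letReal 11 (.var 12))
      (.letReal 10 (.var 12))

/-- Estimates the distance to one point. -/
def pointProg : Prog :=
  .letReal 10 (.ofNat (.const 0)) ;; .for 14 (.var 17) groupProg ;;
    .letReal 11 (.ofNat (.const 0)) ;; .for 20 (.var 18) bisectProg ;;
      .setReal 1 (.var 12) (.sqrt (.var 10)) ;; .letNat 13 (.add (.var 13) (.var 4))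

/-- Estimates the distances to all points. -/
def pointsProg : Prog := .letNat 13 (.const 0) ;; .for 12 (.var 6) pointProg

/-- Computes the number of groups and the number of bisection steps. -/
def accuracyProg : Prog :=
  .powTwo 19 17 (.div (.ofNat (.var 6)) (.var 3)) ;;
    .powTwo 19 18 (.div (.mul (.ofNat (.const 4)) (.mul (.ofNat (.var 17)) (.ofNat (.var 4))))
      (.var 2))

/-- Answers a query. -/
def queryProg : Prog := embedProg ;; accuracyProg ;; pointsProg

section

variable {ω : Tape} {M : Mem} {s d N G R K b : ℕ} {ε δ : ℝ} {y a : ℕ → ℝ}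

/-- The sampled vector `y` is never written down: only its sampled coordinates are formed, as
differences of the embedded query and the stored point. This keeps the cost independent of `N`. -/
theorem groupProg_wp (hN : 0 < N) (h4 : M.nat 4 0 = N) (h5 : M.nat 5 0 = G) (h13 : M.nat 13 0 = b)
    (hy : ∀ p < N, M.real 6 p - M.real 5 (b + p) = y p) {r : ℕ} (h14 : M.nat 14 0 = r) :
    groupProg.Wp ω M s ((G + 2) * 55) fun M' s' => s' = s + G ∧
      Mem.Agree [11, 15] [8, 9, 10, 13] M M' ∧
      M'.real 10 0 = M.real 10 0 + groupMean N G y ω s ∧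
      ∀ j, M'.real 9 j = if j = r then groupMean N G y ω s else M.real 9 j := by
  refine Prog.Wp.mono (Prog.Wp.seq (Prog.Wp.setReal (Prog.Wp.seq (T' := 19)
    ((Prog.Wp.for (B := 28) G (fun k M' s' => s' = s + k ∧ Mem.Agree [11, 15] [8, 13] M M' ∧
      M'.real 8 0 = ∑ t ∈ Finset.range k, y (sample N ω (s + t)) ^ 2) ?_ ?_ ?_).mono
        le_rfl ?_)))) ?_ fun _ _ h => h
  · exact ⟨rfl, (Mem.Agree.refl.setReal (by decide) _ _).setNat (by decide) _ _, by
      simp [NatExp.eval, RealExp.eval, Mem.setReal_real]⟩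
  · rintro k M' s' ⟨-, hA, -⟩
    simp [NatExp.eval, hA.nat 5 (by decide), h5]
  · rintro k M' s' hk hc ⟨rfl, hA, h8⟩
    refine Prog.Wp.mono (Prog.Wp.seq (Prog.Wp.unif (Prog.Wp.seq (Prog.Wp.setReal
      (Prog.Wp.setReal ?_))))) (by decide) fun _ _ h => h
    refine ⟨by simpa [Mem.setNat_nat] using hc, rfl, (((hA.setNat (by decide) _ _).setReal
      (by decide) _ _).setReal (by decide) _ _).setNat (by decide) _ _, ?_⟩
    have hs := hy (sample N ω (s + k)) (pick_lt hN _)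
    simp only [sample] at hs
    simp [NatExp.eval, RealExp.eval, Mem.setNat_nat, Mem.setReal_real, h8, hA.nat 4 (by decide), h4,
      hA.nat 13 (by decide), h13, hA.real 6 (by decide), hA.real 5 (by decide),
      Finset.sum_range_succ, sample, hs, sq]
  · rintro M' s' ⟨rfl, hA, h8⟩
    refine Prog.Wp.mono (Prog.Wp.seq (Prog.Wp.setReal (Prog.Wp.setReal ?_))) (by decide)
      fun _ _ h => h
    have h5' := hA.nat 5 (by decide)
    have h14' := hA.nat 14 (by decide)
    refine ⟨rfl, ((hA.weaken (by decide) (by decide)).setReal (by decide) _ _).setReal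
      (by decide) _ _, ?_, fun j => ?_⟩
    · simp [NatExp.eval, RealExp.eval, Mem.setReal_real, h8, h5', h5, hA.real 10 (by decide),
        groupMean]
    · simp [NatExp.eval, RealExp.eval, Mem.setReal_real, h8, h5', h5, h14', h14,
        hA.real 9 (by decide), groupMean]
  · simp only [NatExp.cost, RealExp.cost]
    omega

theorem countLe_succ (R : ℕ) (a : ℕ → ℝ) (v : ℝ) [Decidable (a R ≤ v)] :
    countLe (R + 1) a v = countLe R a v + if a R ≤ v then 1 else 0 := by
  unfold countLe
  rw [Finset.range_add_one, Finset.filter_insert]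
  split_ifs
  · rw [Finset.card_insert_of_notMem (by simp)]
  · rfl

theorem countProg_wp (h17 : M.nat 17 0 = R) (ha : ∀ r < R, M.real 9 r = a r) :
    countProg.Wp ω M s ((R + 2) * 40) fun M' s' => s' = s ∧ Mem.Agree [16, 21] [] M M' ∧
      M'.nat 16 0 = countLe R a (M.real 12 0) := by
  classical
  refine Prog.Wp.mono (Prog.Wp.seq (Prog.Wp.setNat
    ((Prog.Wp.for (B := 20) R (fun k M' s' => s' = s ∧ Mem.Agree [16, 21] [] M M' ∧
      M'.nat 16 0 = countLe k a (M.real 12 0)) ?_ ?_ ?_)))) ?_ fun _ _ h => h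
  · exact ⟨rfl, (Mem.Agree.refl.setNat (by decide) _ _).setNat (by decide) _ _, by
      simp [NatExp.eval, Mem.setNat_nat, countLe]⟩
  · rintro k M' s' ⟨-, hA, -⟩
    simp [NatExp.eval, hA.nat 17 (by decide), h17]
  · rintro k M' s' hk hc ⟨rfl, hA, h16⟩
    have h9 := ha k hk
    rw [← hA.real 9 (by decide)] at h9
    have h12 := hA.real 12 (by decide)
    refine (Prog.Wp.branch (T := 6) (fun h => ?_) fun h => ?_).mono (by decide) fun _ _ h => h
    all_goals simp only [Test.holds, NatExp.eval, RealExp.eval, hc, h9, h12] at h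
    · refine (Prog.Wp.skip ?_).mono (by decide) fun _ _ h => h
      exact ⟨hc, rfl, hA.setNat (by decide) _ _, by
        simp [Mem.setNat_nat, h16, countLe_succ, h]⟩
    · refine (Prog.Wp.setNat ?_).mono (by decide) fun _ _ h => h
      exact ⟨by simpa [Mem.setNat_nat] using hc, rfl,
        (hA.setNat (by decide) _ _).setNat (by decide) _ _, by
          simp [Mem.setNat_nat, NatExp.eval, h16, countLe_succ, not_lt.1 h]⟩
  · simp only [NatExp.cost]
    omega

theorem bisectProg_wp (h17 : M.nat 17 0 = R) (ha : ∀ r < R, M.real 9 r = a r) :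
    bisectProg.Wp ω M s ((R + 3) * 40) fun M' s' => s' = s ∧
      Mem.Agree [16, 21] [10, 11, 12] M M' ∧
      (M'.real 11 0, M'.real 10 0) = bisectStep R a (M.real 11 0, M.real 10 0) := by
  refine Prog.Wp.mono (Prog.Wp.seq (Prog.Wp.setReal (Prog.Wp.seq (T' := 20)
    ((countProg_wp (by simpa using h17) (a := a) (fun r hr => by
      simpa [Mem.setReal_real] using ha r hr)).mono le_rfl ?_)))) ?_ fun _ _ h => h
  · rintro M' s' ⟨rfl, hA, h16⟩
    have hmid : (M.setReal 12 0 ((M.real 11 0 + M.real 10 0) / 2)).real 12 0 =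
        (M.real 11 0 + M.real 10 0) / 2 := by simp [Mem.setReal_real]
    simp [NatExp.eval, RealExp.eval] at hA
    simp [NatExp.eval, RealExp.eval, hmid] at h16
    have h12 : M'.real 12 0 = (M.real 11 0 + M.real 10 0) / 2 := by
      rw [hA.real 12 (by decide), hmid]
    have h10 : M'.real 10 0 = M.real 10 0 := by
      simp [hA.real 10 (by decide), Mem.setReal_real]
    have h11 : M'.real 11 0 = M.real 11 0 := by
      simp [hA.real 11 (by decide), Mem.setReal_real]
    have hA' : Mem.Agree [16, 21] [10, 11, 12] M M' :=
      (Mem.Agree.refl.setReal (by decide) _ _).trans (hA.weaken (by decide) (by decide))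
    refine (Prog.Wp.branch (T := 4) (fun h => ?_) fun h => ?_).mono (by decide) fun _ _ h => h
    all_goals simp only [Test.holds, NatExp.eval, h16, hA'.nat 17 (by decide), h17] at h
    · refine (Prog.Wp.setReal ?_).mono (by decide) fun _ _ h => h
      exact ⟨rfl, hA'.setReal (by decide) _ _, by
        simp [bisectStep, h, NatExp.eval, RealExp.eval, Mem.setReal_real, h12, h10]⟩
    · refine (Prog.Wp.setReal ?_).mono (by decide) fun _ _ h => h
      exact ⟨rfl, hA'.setReal (by decide) _ _, by
        simp [bisectStep, h, NatExp.eval, RealExp.eval, Mem.setReal_real, h12, h11]⟩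
  · simp only [NatExp.cost, RealExp.cost]
    omega

/-- Real variable 10 first accumulates the sum of the group means and then serves as the upper end
of the bisection. The draws take up exactly `R * G` entries of the tape. -/
theorem pointProg_wp (hN : 0 < N) (h4 : M.nat 4 0 = N) (h5 : M.nat 5 0 = G) (h13 : M.nat 13 0 = b)
    (h17 : M.nat 17 0 = R) (h18 : M.nat 18 0 = K)
    (hy : ∀ p < N, M.real 6 p - M.real 5 (b + p) = y p) {i : ℕ} (h12 : M.nat 12 0 = i) :
    pointProg.Wp ω M s ((R + 3) * (G + K + 4) * 60) fun M' s' => s' = s + R * G ∧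
      Mem.Agree [11, 13, 14, 15, 16, 20, 21] [1, 8, 9, 10, 11, 12, 13] M M' ∧
      M'.nat 13 0 = b + N ∧
      ∀ j, M'.real 1 j = if j = i then Real.sqrt (estimate N G R K y ω s) else M.real 1 j := by
  set a : ℕ → ℝ := fun r => groupMean N G y ω (s + r * G) with ha
  refine Prog.Wp.mono (Prog.Wp.seq (Prog.Wp.setReal (Prog.Wp.seq
    (T' := 4 + ((K + 1) * ((R + 3) * 40 + 2 + 14) + 20))
    ((Prog.Wp.for (B := (G + 2) * 55) R (fun k M' s' => s' = s + k * G ∧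
      Mem.Agree [11, 14, 15] [8, 9, 10, 13] M M' ∧ M'.real 10 0 = ∑ r ∈ Finset.range k, a r ∧
      ∀ r < k, M'.real 9 r = a r) ?_ ?_ ?_).mono le_rfl ?_)))) ?_ fun _ _ h => h
  · exact ⟨by simp, (Mem.Agree.refl.setReal (by decide) _ _).setNat (by decide) _ _, by
      simp [NatExp.eval, RealExp.eval, Mem.setReal_real], by simp⟩
  · rintro k M' s' ⟨-, hA, -⟩
    simp [NatExp.eval, hA.nat 17 (by decide), h17]
  · rintro k M' s' hk hc ⟨rfl, hA, h10, h9⟩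
    refine (groupProg_wp (y := y) hN (by rw [hA.nat 4 (by decide), h4])
      (by rw [hA.nat 5 (by decide), h5]) (by rw [hA.nat 13 (by decide), h13])
      (by rw [hA.real 6 (by decide), hA.real 5 (by decide)]; exact hy) hc).mono le_rfl ?_
    rintro M₁ s₁ ⟨rfl, hA₁, h10₁, h9₁⟩
    refine ⟨by rw [hA₁.nat 14 (by decide), hc], by ring, (hA.trans (hA₁.weaken (by decide)
      (by decide))).setNat (by decide) _ _, ?_, fun r hr => ?_⟩
    · rw [Mem.setNat_real, h10₁, h10, Finset.sum_range_succ]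
    · rw [Mem.setNat_real, h9₁]
      split_ifs with h
      · rw [h]
      · exact h9 r (by omega)
  · rintro M₁ s₁ ⟨rfl, hA₁, h10₁, h9₁⟩
    refine Prog.Wp.seq (T := 4) ((Prog.Wp.setReal ?_).mono (by decide) fun _ _ h => h)
    refine Prog.Wp.seq (T' := 20) ((Prog.Wp.for (B := (R + 3) * 40) K (fun k M' s' =>
      s' = s + R * G ∧ Mem.Agree [11, 14, 15, 16, 20, 21] [8, 9, 10, 11, 12, 13] M M' ∧
      (∀ r < R, M'.real 9 r = a r) ∧ (M'.real 11 0, M'.real 10 0) =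
        (bisectStep R a)^[k] (0, ∑ r ∈ Finset.range R, a r)) ?_ ?_ ?_).mono le_rfl ?_)
    · refine ⟨rfl, ((hA₁.weaken (by decide) (by decide)).setReal (by decide) _ _).setNat
        (by decide) _ _, ?_, ?_⟩
      · simpa [Mem.setReal_real] using h9₁
      · simp [NatExp.eval, RealExp.eval, Mem.setReal_real, h10₁]
    · rintro k M' s' ⟨-, hA, -⟩
      simp [NatExp.eval, hA.nat 18 (by decide), h18]
    · rintro k M' s' hk hc ⟨rfl, hA, h9, hb⟩
      refine (bisectProg_wp (by rw [hA.nat 17 (by decide), h17]) h9).mono le_rfl ?_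
      rintro M₂ s₂ ⟨rfl, hA₂, hb₂⟩
      refine ⟨by rw [hA₂.nat 20 (by decide), hc], rfl, (hA.trans (hA₂.weaken (by decide)
        (by decide))).setNat (by decide) _ _, fun r hr => ?_, ?_⟩
      · rw [Mem.setNat_real, hA₂.real 9 (by decide), h9 r hr]
      · rw [Mem.setNat_real, hb₂, hb, Function.iterate_succ_apply']
    · rintro M₂ s₂ ⟨rfl, hA₂, -, hb⟩
      refine Prog.Wp.mono (Prog.Wp.seq (Prog.Wp.setReal (Prog.Wp.setNat ?_))) (by decide)
        fun _ _ h => h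
      refine ⟨rfl, ((hA₂.weaken (by decide) (by decide)).setReal (by decide) _ _).setNat
        (by decide) _ _, ?_, fun j => ?_⟩
      · simp [NatExp.eval, Mem.setNat_nat, hA₂.nat 13 (by decide), h13, hA₂.nat 4 (by decide), h4]
      · have h10 : M₂.real 10 0 = estimate N G R K y ω s := (Prod.ext_iff.1 hb).2
        simp [NatExp.eval, RealExp.eval, Mem.setReal_real, hA₂.nat 12 (by decide), h12, h10,
          hA₂.real 1 (by decide)]
  · simp only [NatExp.cost, RealExp.cost]
    nlinarith

theorem pointsProg_wp {n : ℕ} (hN : 0 < N) (h4 : M.nat 4 0 = N) (h5 : M.nat 5 0 = G)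
    (h6 : M.nat 6 0 = n) (h17 : M.nat 17 0 = R) (h18 : M.nat 18 0 = K) {z : ℕ → ℕ → ℝ}
    (hz : ∀ i < n, ∀ p < N, M.real 6 p - M.real 5 (i * N + p) = z i p) :
    pointsProg.Wp ω M s ((n + 1) * ((R + 3) * (G + K + 4) * 80)) fun M' _ =>
      Mem.Agree [11, 12, 13, 14, 15, 16, 20, 21] [1, 8, 9, 10, 11, 12, 13] M M' ∧
      ∀ i < n, M'.real 1 i = Real.sqrt (estimate N G R K (z i) ω (s + i * (R * G))) := by
  refine Prog.Wp.mono (Prog.Wp.seq (Prog.Wp.setNat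
    ((Prog.Wp.for (B := (R + 3) * (G + K + 4) * 60) n (fun k M' s' => s' = s + k * (R * G) ∧
      Mem.Agree [11, 12, 13, 14, 15, 16, 20, 21] [1, 8, 9, 10, 11, 12, 13] M M' ∧
      M'.nat 13 0 = k * N ∧
      ∀ i < k, M'.real 1 i = Real.sqrt (estimate N G R K (z i) ω (s + i * (R * G))))
      ?_ ?_ ?_)))) ?_ fun _ _ h => ⟨h.2.1, h.2.2.2⟩
  · exact ⟨by simp, (Mem.Agree.refl.setNat (by decide) _ _).setNat (by decide) _ _, by
      simp [NatExp.eval, Mem.setNat_nat], by simp⟩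
  · rintro k M' s' ⟨-, hA, -⟩
    simp [NatExp.eval, hA.nat 6 (by decide), h6]
  · rintro k M' s' hk hc ⟨rfl, hA, h13, h1⟩
    refine (pointProg_wp (y := z k) hN (by rw [hA.nat 4 (by decide), h4])
      (by rw [hA.nat 5 (by decide), h5]) h13 (by rw [hA.nat 17 (by decide), h17])
      (by rw [hA.nat 18 (by decide), h18])
      (by rw [hA.real 6 (by decide), hA.real 5 (by decide)]; exact hz k hk) hc).mono le_rfl ?_
    rintro M₁ s₁ ⟨rfl, hA₁, h13₁, h1₁⟩
    refine ⟨by rw [hA₁.nat 12 (by decide), hc], by ring, (hA.trans (hA₁.weaken (by decide)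
      (by decide))).setNat (by decide) _ _, ?_, fun i hi => ?_⟩
    · rw [Mem.setNat_nat_of_ne _ _ _ (by decide), h13₁]; ring
    · rw [Mem.setNat_real, h1₁]
      split_ifs with h
      · rw [h]
      · exact h1 i (by omega)
  · simp only [NatExp.cost]
    have : 12 ≤ (R + 3) * (G + K + 4) := Nat.mul_le_mul (by omega : 3 ≤ R + 3) (by omega : 4 ≤ G + K + 4)
    nlinarith

/-- The number of groups. -/
noncomputable def groupCount (n : ℕ) (δ : ℝ) : ℕ := ceilLog (n / δ)

/-- The number of bisection steps. -/
noncomputable def bisectCount (n d : ℕ) (ε δ : ℝ) : ℕ :=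
  ceilLog (4 * ((groupCount n δ : ℝ) * (2 * halfSize d ε δ : ℕ)) / ε)

theorem accuracyProg_wp {n : ℕ} (h6 : M.nat 6 0 = n) (h2 : M.real 2 0 = ε) (h3 : M.real 3 0 = δ)
    (h4 : M.nat 4 0 = 2 * halfSize d ε δ) :
    accuracyProg.Wp ω M s ((groupCount n δ + 1) * 60 + (bisectCount n d ε δ + 1) * 60) fun M' s' =>
      s' = s ∧ Mem.Agree [17, 18, 19] [] M M' ∧ M'.nat 17 0 = groupCount n δ ∧
      M'.nat 18 0 = bisectCount n d ε δ := by
  refine Prog.Wp.mono (Prog.Wp.seq ((Prog.Wp.powTwo (v := (n : ℝ) / δ) (by decide) ?_).mono le_rfl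
    fun M₁ s₁ h₁ => (Prog.Wp.powTwo (v := 4 * ((groupCount n δ : ℝ) * (2 * halfSize d ε δ : ℕ)) / ε)
      (by decide) ?_).mono le_rfl ?_)) ?_ fun _ _ h => h
  · intro M' hA
    simp [NatExp.eval, RealExp.eval, hA.nat 6 (by decide), h6, hA.real 3 (by decide), h3]
  · obtain ⟨rfl, hA₁, -, h17⟩ := h₁
    intro M' hA
    simp [NatExp.eval, RealExp.eval, hA.nat 17 (by decide), h17, hA.nat 4 (by decide),
      hA₁.nat 4 (by decide), h4, hA.real 2 (by decide), hA₁.real 2 (by decide), h2, groupCount]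
  · obtain ⟨rfl, hA₁, -, h17⟩ := h₁
    rintro M₂ s₂ ⟨rfl, hA₂, -, h18⟩
    exact ⟨rfl, (hA₁.weaken (by decide) (by decide)).trans (hA₂.weaken (by decide) (by decide)),
      by rw [hA₂.nat 17 (by decide), h17, groupCount], h18⟩
  · simp only [NatExp.cost, RealExp.cost, groupCount, bisectCount]
    omega

theorem halfSize_pos (d : ℕ) (ε δ : ℝ) : 0 < halfSize d ε δ := by unfold halfSize; positivity

theorem embed_sub {H L d : ℕ} (g : ℕ → ℝ) (x y : Fin d → ℝ) {p : ℕ} (hp : p < 2 * H) :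
    embed H L d g (coords x) p - embed H L d g (coords y) p =
      embed H L d g (coords (x - y)) p :=
  (congrFun (map_sub (embedLin H L d g) x y) ⟨p, hp⟩).symm

theorem queryProg_wp {g : ℕ → ℝ} {X : List (EuclideanSpace ℝ (Fin d))}
    (h : M.Ready d ε δ g X) (q : EuclideanSpace ℝ (Fin d)) :
    queryProg.Wp ω (M.load q) s ((stepCount d + 2) * (2 * halfSize d ε δ + 2) * 100 +
      ((groupCount X.length δ + 1) * 60 + (bisectCount X.length d ε δ + 1) * 60 +
      (X.length + 1) * ((groupCount X.length δ + 3) *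
        (2 ^ groupExp d ε δ + bisectCount X.length d ε δ + 4) * 80))) fun M' _ =>
      M'.Ready d ε δ g X ∧ ∀ i : Fin X.length, M'.real 1 i = Real.sqrt (estimate
        (2 * halfSize d ε δ) (2 ^ groupExp d ε δ) (groupCount X.length δ)
        (bisectCount X.length d ε δ) (embed (halfSize d ε δ) (stepCount d) d g
          (coords (⇑q - ⇑(X.get i)))) ω (s + i * (groupCount X.length δ * 2 ^ groupExp d ε δ))) := by
  refine Prog.Wp.seq ((h.embedProg_wp q).mono le_rfl ?_)
  rintro M₁ s₁ ⟨rfl, h₁, hq⟩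
  refine Prog.Wp.seq ((accuracyProg_wp h₁.count h₁.eps h₁.delta h₁.shape.size).mono le_rfl ?_)
  rintro M₂ s₂ ⟨rfl, hA₂, h17, h18⟩
  refine (pointsProg_wp (n := X.length) (N := 2 * halfSize d ε δ) (z := fun i => if hi : i < X.length then
      embed (halfSize d ε δ) (stepCount d) d g (coords (⇑q - ⇑X[i])) else 0)
    (by have := halfSize_pos d ε δ; omega) (by rw [hA₂.nat 4 (by decide), h₁.shape.size])
    (by rw [hA₂.nat 5 (by decide), h₁.group]) (by rw [hA₂.nat 6 (by decide), h₁.count])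
    h17 h18 (fun i hi p hp => ?_)).mono le_rfl ?_
  · rw [dif_pos hi, hA₂.real 6 (by decide), hA₂.real 5 (by decide), hq p hp, h₁.points i hi p hp,
      embed_sub g _ _ hp]
  · rintro M₃ - ⟨hA₃, h1⟩
    have hA := (hA₂.weaken (A' := [11, 12, 13, 14, 15, 16, 17, 18, 19, 20, 21])
      (B' := [1, 8, 9, 10, 11, 12, 13]) (by decide) (by decide)).trans
      (hA₃.weaken (by decide) (by decide))
    refine ⟨⟨h₁.shape.of_agree hA (by decide), ?_, ?_, ?_, ?_, ?_, ?_, ?_⟩, fun i => ?_⟩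
    · rw [hA.nat 5 (by decide), h₁.group]
    · rw [hA.nat 6 (by decide), h₁.count]
    · rw [hA.nat 7 (by decide), h₁.base]
    · rw [hA.real 2 (by decide), h₁.eps]
    · rw [hA.real 3 (by decide), h₁.delta]
    · rw [hA.real 4 (by decide)]; exact h₁.seeds
    · rw [hA.real 5 (by decide)]; exact h₁.points
    · rw [h1 i i.2, dif_pos i.2]
      rfl

end

/-! ### Correctness -/

theorem le_two_pow_stepCount (d : ℕ) : d ≤ 2 ^ stepCount d := by
  have := le_two_pow_ceilLog ((d : ℝ) / 2)
  have h : (d : ℝ) ≤ 2 ^ stepCount d := by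
    rw [stepCount, pow_succ]
    linarith
  exact_mod_cast h

/-- The final `+ 1` in `stepCount` makes the block length even, so that half of the total size is
obtained by doublings of the number of blocks. -/
theorem two_mul_halfSize (d : ℕ) (ε δ : ℝ) :
    2 * halfSize d ε δ = 2 ^ stepCount d * 2 ^ blockExp d ε δ := by
  rw [halfSize, stepCount, pow_succ]
  ring

section

variable {d : ℕ} {ε δ : ℝ}

theorem logParam_pos (hd : 1 ≤ d) (hδ0 : 0 < δ) (hδ : δ < 1 / 2) : 1 ≤ logParam d δ := by
  have hd' : (1 : ℝ) ≤ d := by exact_mod_cast hd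
  have h1 : Real.exp 1 ≤ 32 * d / δ := by
    rw [le_div_iff₀ hδ0]
    have := Real.exp_one_lt_d9
    nlinarith
  exact (Real.le_log_iff_exp_le (by positivity)).2 h1

theorem eight_le_threshSq (d : ℕ) (ε δ : ℝ) : 8 ≤ threshSq d ε δ := by
  have h1 : (1 : ℝ) ≤ 2 ^ blockExp d ε δ := one_le_pow₀ (by norm_num)
  have h2 : (1 : ℝ) ≤ Real.log (12 * 2 ^ blockExp d ε δ) := by
    refine (Real.le_log_iff_exp_le (by positivity)).2 ?_
    have := Real.exp_one_lt_d9
    linarith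
  unfold threshSq
  linarith

theorem le_two_pow_blockExp (hε0 : 0 < ε) :
    16777216 * ((2 * ((stepCount d : ℝ) + 1)) ^ 2 * logParam d δ) ≤
      2 ^ blockExp d ε δ * ε ^ 2 := by
  have h := le_two_pow_ceilLog (16777216 * ((2 * (stepCount d + 1 : ℕ)) *
    (2 * (stepCount d + 1 : ℕ)) * logParam d δ) / (ε * ε))
  rw [← blockExp, div_le_iff₀ (by positivity)] at h
  push_cast at h
  rw [sq, sq]
  exact h

theorem le_two_pow_groupExp (hε0 : 0 < ε) :
    16384 * ((2 * ((stepCount d : ℝ) + 1)) ^ 2 * threshSq d ε δ) ≤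
      2 ^ groupExp d ε δ * ε ^ 2 := by
  have h := le_two_pow_ceilLog (16384 * ((2 * (stepCount d + 1 : ℕ)) *
    (2 * (stepCount d + 1 : ℕ)) * threshSq d ε δ) / (ε * ε))
  rw [← groupExp, div_le_iff₀ (by positivity)] at h
  push_cast at h
  rw [sq, sq]
  exact h

theorem two_pow_groupExp_le (hε0 : 0 < ε) (hε : ε < 1 / 2) :
    2 ^ groupExp d ε δ * ε ^ 2 ≤
      32768 * ((2 * ((stepCount d : ℝ) + 1)) ^ 2 * threshSq d ε δ) := by
  have hT := eight_le_threshSq d ε δ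
  have h := two_pow_ceilLog_le (b := 16384 * ((2 * (stepCount d + 1 : ℕ)) *
    (2 * (stepCount d + 1 : ℕ)) * threshSq d ε δ) / (ε * ε)) (by
      rw [le_div_iff₀ (by positivity)]
      push_cast
      have h1 : (1 : ℝ) ≤ 2 * (stepCount d + 1) := by
        have : (0 : ℝ) ≤ stepCount d := Nat.cast_nonneg _
        linarith
      have h2 : 1 ≤ (2 * ((stepCount d : ℝ) + 1)) * (2 * (stepCount d + 1)) := by nlinarith
      nlinarith)
  rw [← groupExp, ← mul_div_assoc, le_div_iff₀ (by positivity)] at h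
  push_cast at h
  calc 2 ^ groupExp d ε δ * ε ^ 2 = 2 ^ groupExp d ε δ * (ε * ε) := by ring
    _ ≤ _ := h
    _ = _ := by ring

/-- The seeds for which the data structure is initialized correctly. -/
def InitOK (d : ℕ) (ε δ : ℝ) (g : ℕ → ℝ) : Prop :=
  GoodSeeds (halfSize d ε δ) (stepCount d) d (2 ^ blockExp d ε δ) (ε / 8)
    (Real.sqrt (threshSq d ε δ)) (14 * 2 ^ stepCount d * logParam d δ) g

theorem measure_not_initOK_le (hd : 1 ≤ d) (hε0 : 0 < ε) (hε : ε < 1 / 2) (hδ0 : 0 < δ)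
    (hδ : δ < 1 / 2) : tapeLaw {ω | ¬ InitOK d ε δ (seeds ω)} ≤ ENNReal.ofReal δ := by
  have hT := eight_le_threshSq d ε δ
  refine measure_not_goodSeeds_le hd (le_two_pow_stepCount d) (two_mul_halfSize d ε δ)
    (by positivity) hδ0 hδ (Real.sqrt_nonneg _) ?_ (by positivity) (by linarith) ?_
  · rw [Real.sq_sqrt (by linarith), threshSq]
    push_cast
    rfl
  · have hl := logParam_pos hd hδ0 hδ
    have hd' : (1 : ℝ) ≤ d := by exact_mod_cast hd
    have h1 : Real.log (4 * d / δ) ≤ logParam d δ :=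
      Real.log_le_log (by positivity) (by gcongr; norm_num)
    have h2 := le_two_pow_blockExp (d := d) (δ := δ) hε0
    have h3 : (0 : ℝ) ≤ stepCount d := Nat.cast_nonneg _
    have h4 : 4 * logParam d δ ≤ (2 * ((stepCount d : ℝ) + 1)) ^ 2 * logParam d δ := by
      gcongr
      nlinarith
    push_cast
    rw [div_pow, ← mul_div_assoc, le_div_iff₀ (by norm_num)]
    nlinarith

theorem measure_estimate_le (hd : 1 ≤ d) (hε0 : 0 < ε) (hε : ε < 1 / 2) (hδ0 : 0 < δ)
    (hδ : δ < 1 / 2) {g : ℕ → ℝ} (hg : InitOK d ε δ g) (n : ℕ) (z : Fin d → ℝ) {N : ℝ}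
    (hN : 0 ≤ N) (hzN : ∑ k, z k ^ 2 = N ^ 2) (s : ℕ) :
    tapeLaw {ω | ¬ ((1 - ε) * N ^ 2 ≤ estimate (2 * halfSize d ε δ) (2 ^ groupExp d ε δ)
          (groupCount n δ) (bisectCount n d ε δ)
          (embed (halfSize d ε δ) (stepCount d) d g (coords z)) ω s ∧
        estimate (2 * halfSize d ε δ) (2 ^ groupExp d ε δ) (groupCount n δ) (bisectCount n d ε δ)
          (embed (halfSize d ε δ) (stepCount d) d g (coords z)) ω s ≤ (1 + ε) * N ^ 2)} ≤
      ENNReal.ofReal ((2 ^ groupCount n δ)⁻¹) := by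
  have hT := eight_le_threshSq d ε δ
  have hl := logParam_pos hd hδ0 hδ
  have hm := le_two_pow_blockExp (d := d) (δ := δ) hε0
  have hG := two_pow_groupExp_le (d := d) (δ := δ) hε0 hε
  have hG' := le_two_pow_groupExp (d := d) (δ := δ) hε0
  set a : ℝ := (2 * ((stepCount d : ℝ) + 1)) ^ 2
  have ha : 0 ≤ a := sq_nonneg _
  have hsq : Real.sqrt (threshSq d ε δ) ^ 2 = threshSq d ε δ := Real.sq_sqrt (by linarith)
  refine GoodSeeds.measure_estimate_le hg (le_two_pow_stepCount d) (two_mul_halfSize d ε δ)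
    (by positivity) (by positivity) hε0 (by linarith) (Real.sqrt_pos.2 (by linarith))
    (by linarith) ?_ ?_ ?_ ?_ z hN hzN s
  · push_cast
    -- This condition needs only one factor `1 / ε` in the number of blocks; `ε < 1` absorbs the
    -- other.
    have h1 : (2 : ℝ) ^ blockExp d ε δ * ε ^ 2 ≤ 2 ^ blockExp d ε δ * ε := by
      gcongr
      nlinarith
    nlinarith [mul_nonneg ha (zero_le_one.trans hl)]
  · rw [hsq]
    push_cast
    have h1 : 2 ^ groupExp d ε δ * ε ^ 2 * logParam d δ ≤
        32768 * (a * threshSq d ε δ) * logParam d δ := by gcongr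
    have h2 : 16777216 * (a * logParam d δ) * threshSq d ε δ ≤
        2 ^ blockExp d ε δ * ε ^ 2 * threshSq d ε δ := by gcongr
    have h3 : 0 ≤ a * logParam d δ * threshSq d ε δ := by positivity
    -- Rounding up to a power of two gives `G ≤ 32768 * a * T ^ 2 / ε ^ 2`, and `448 * 32768 ≤
    -- 16777216`. This dictates the constant in `blockExp`.
    have h4 : 448 * (2 ^ groupExp d ε δ * logParam d δ) * ε ^ 2 ≤
        2 ^ blockExp d ε δ * threshSq d ε δ * ε ^ 2 := by nlinarith
    exact le_of_mul_le_mul_right h4 (by positivity)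
  · rw [hsq]
    push_cast
    norm_num
    exact hG'
  · have h := le_two_pow_ceilLog (4 * ((groupCount n δ : ℝ) * (2 * halfSize d ε δ : ℕ)) / ε)
    rw [← bisectCount, div_le_iff₀ hε0] at h
    linarith

/-- `(1 - ε) ^ 2 ≤ 1 - ε` and `1 + ε ≤ (1 + ε) ^ 2`: taking roots does not worsen the relative
error. -/
theorem le_sqrt_and_sqrt_le {e N : ℝ} (hε0 : 0 < ε) (hε : ε < 1 / 2) (hN : 0 ≤ N)
    (h1 : (1 - ε) * N ^ 2 ≤ e) (h2 : e ≤ (1 + ε) * N ^ 2) :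
    (1 - ε) * N ≤ Real.sqrt e ∧ Real.sqrt e ≤ (1 + ε) * N := by
  have hN2 : 0 ≤ N ^ 2 := sq_nonneg N
  constructor
  · refine Real.le_sqrt_of_sq_le (le_trans ?_ h1)
    rw [mul_pow]
    gcongr
    nlinarith
  · refine Real.sqrt_le_iff.2 ⟨by positivity, h2.trans ?_⟩
    rw [mul_pow]
    gcongr
    nlinarith

theorem measure_query_le (hd : 1 ≤ d) (hε0 : 0 < ε) (hε : ε < 1 / 2) (hδ0 : 0 < δ)
    (hδ : δ < 1 / 2) {g : ℕ → ℝ} (hg : InitOK d ε δ g) {M : Mem}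
    {X : List (EuclideanSpace ℝ (Fin d))} (hM : M.Ready d ε δ g X)
    (q : EuclideanSpace ℝ (Fin d)) :
    tapeLaw {ω | ¬ ∃ M' t, queryProg.Run ω (M.load q) M' t ∧ M'.Answers ε X q} ≤
      ENNReal.ofReal δ := by
  set R := groupCount X.length δ
  set bad : Fin X.length → Set Tape := fun i => {ω | ¬ ((1 - ε) * dist q (X.get i) ^ 2 ≤
        estimate (2 * halfSize d ε δ) (2 ^ groupExp d ε δ)
          R (bisectCount X.length d ε δ) (embed (halfSize d ε δ) (stepCount d) d g
            (coords (⇑q - ⇑(X.get i)))) ω (0 + i * (R * 2 ^ groupExp d ε δ)) ∧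
        estimate (2 * halfSize d ε δ) (2 ^ groupExp d ε δ)
          R (bisectCount X.length d ε δ) (embed (halfSize d ε δ) (stepCount d) d g
            (coords (⇑q - ⇑(X.get i)))) ω (0 + i * (R * 2 ^ groupExp d ε δ)) ≤
          (1 + ε) * dist q (X.get i) ^ 2)} with hbad
  have hsub : {ω | ¬ ∃ M' t, queryProg.Run ω (M.load q) M' t ∧ M'.Answers ε X q} ⊆ ⋃ i, bad i := by
    intro ω hω
    by_contra hno
    refine hω ?_
    obtain ⟨M', s', t, hrun, -, -, h1⟩ := queryProg_wp (ω := ω) (s := 0) hM q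
    refine ⟨M', t, ⟨s', hrun⟩, fun i => ?_⟩
    rw [h1 i]
    have hi : ω ∉ bad i := fun h => hno (Set.mem_iUnion.2 ⟨i, h⟩)
    simp only [hbad, Set.mem_ofPred_eq, not_not] at hi
    exact le_sqrt_and_sqrt_le hε0 hε dist_nonneg hi.1 hi.2
  -- The number of groups was chosen with `2 ^ R ≥ n / δ`, which pays for the union bound over the
  -- database.
  have hn : (X.length : ℝ) * (2 ^ R)⁻¹ ≤ δ := by
    have h := le_two_pow_ceilLog ((X.length : ℝ) / δ)
    rw [div_le_iff₀ hδ0] at h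
    rw [← div_eq_mul_inv, div_le_iff₀ (by positivity), mul_comm]
    exact h
  calc _ ≤ tapeLaw (⋃ i, bad i) := measure_mono hsub
    _ ≤ ∑ i, tapeLaw (bad i) := measure_iUnion_fintype_le _ _
    _ ≤ ∑ _i : Fin X.length, ENNReal.ofReal ((2 ^ R)⁻¹) := by
        refine Finset.sum_le_sum fun i _ => ?_
        refine measure_estimate_le hd hε0 hε hδ0 hδ hg _ _ dist_nonneg ?_ _
        rw [dist_eq_norm, EuclideanSpace.norm_sq_eq]
        simp
    _ = ENNReal.ofReal (X.length * (2 ^ R)⁻¹) := by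
        rw [ENNReal.ofReal_mul (by positivity)]
        simp
    _ ≤ ENNReal.ofReal δ := ENNReal.ofReal_le_ofReal hn

/-- The data structure. -/
def distanceDS : DistanceDS := ⟨createProg, insertProg, queryProg⟩

/-- Since runs are deterministic, a property of one halting run is a property of every run. -/
theorem Prog.Wp.of_run {ω : Tape} {p : Prog} {M M' : Mem} {T t : ℕ} {Q : Mem → ℕ → Prop}
    (h : p.Wp ω M 0 T Q) (hr : p.Run ω M M' t) : t ≤ T ∧ ∃ s, Q M' s := by
  obtain ⟨M₁, s₁, t₁, h1, h2, h3⟩ := h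
  obtain ⟨s', h4⟩ := hr
  obtain ⟨rfl, rfl, rfl⟩ := h1.det h4
  exact ⟨h2, _, h3⟩

/-- Insertions and queries preserve the invariant for every argument and every tape, and they never
touch the seeds. An adversary thus cannot lead to a memory outside the invariant. -/
theorem ready_of_reachable {ω : Tape} {M : Mem} {X : List (EuclideanSpace ℝ (Fin d))}
    (h : distanceDS.Reachable d ε δ ω M X) : M.Ready d ε δ (seeds ω) X := by
  induction h with
  | create h => exact (createProg_wp.of_run h).2.choose_spec
  | insert x ω' _ h ih => exact ((insertProg_wp ih x).of_run h).2.choose_spec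
  | query q ω' _ h ih => exact ((queryProg_wp ih q).of_run h).2.choose_spec.1

/-- Whether the creation succeeded is decided by the seeds alone; good seeds serve all reachable
memories and all queries, which settles adaptivity. -/
theorem measure_not_correct_le (hd : 1 ≤ d) (hε0 : 0 < ε) (hε : ε < 1 / 2) (hδ0 : 0 < δ)
    (hδ : δ < 1 / 2) :
    tapeLaw {ω | ¬ ∀ M X, distanceDS.Reachable d ε δ ω M X → ∀ q : EuclideanSpace ℝ (Fin d),
      tapeLaw {ω' | ¬ ∃ M' t, distanceDS.query.Run ω' (M.load q) M' t ∧ M'.Answers ε X q}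
        ≤ ENNReal.ofReal δ} ≤ ENNReal.ofReal δ := by
  refine (measure_mono ?_).trans (measure_not_initOK_le hd hε0 hε hδ0 hδ)
  refine fun ω (hω : ¬ _) (hg : InitOK d ε δ (seeds ω)) => hω fun M X hM q => ?_
  exact measure_query_le hd hε0 hε hδ0 hδ hg (ready_of_reachable hM) q

end

/-! ### Running times -/

/-- The factor 2 stands for `1 / log 2 < 2`, and the summand 1 for rounding up. -/
theorem ceilLog_le {b B : ℝ} (hb : b ≤ B) (hB : 1 ≤ B) : (ceilLog b : ℝ) ≤ 1 + 2 * Real.log B := by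
  have hlog := Real.log_nonneg hB
  rcases h : ceilLog b with _ | c
  · push_cast; linarith
  · have h1 : (2 : ℝ) ^ c ≤ B :=
      (two_pow_lt_of_lt_ceilLog (h ▸ Nat.lt_succ_self c : c < ceilLog b)).le.trans hb
    have h2 := Real.log_le_log (by positivity) h1
    rw [Real.log_pow] at h2
    have h3 := Real.log_two_gt_d9
    have h4 : (0 : ℝ) ≤ c := Nat.cast_nonneg _
    push_cast
    nlinarith

/-- The parameters satisfy the hypotheses of the theorem, and `f` is at least the bound for the time of
an insertion. -/
structure TimeScale (d : ℕ) (ε δ f : ℝ) : Prop where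
  one_le_dim : 1 ≤ d
  eps_pos : 0 < ε
  eps_lt : ε < 1 / 2
  delta_pos : 0 < δ
  delta_lt : δ < 1 / 2
  le : (ε ^ 2)⁻¹ * d * Real.log (1 / δ) ≤ f

namespace TimeScale

variable {d n : ℕ} {ε δ f : ℝ}

theorem dim (h : TimeScale d ε δ f) : (1 : ℝ) ≤ d := by exact_mod_cast h.one_le_dim

theorem inv_sq (h : TimeScale d ε δ f) : 4 ≤ (ε ^ 2)⁻¹ := by
  have h1 := h.eps_pos
  have h2 := h.eps_lt
  rw [le_inv_comm₀ (by norm_num) (by positivity)]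
  nlinarith

theorem log_two_le (h : TimeScale d ε δ f) : Real.log 2 ≤ Real.log (1 / δ) := by
  refine Real.log_le_log (by norm_num) ?_
  rw [le_div_iff₀ h.delta_pos]
  linarith [h.delta_lt]

theorem one_le_log (h : TimeScale d ε δ f) : 1 ≤ 3 / 2 * Real.log (1 / δ) := by
  linarith [h.log_two_le, Real.log_two_gt_d9]

theorem inv_sq_mul_log_le (h : TimeScale d ε δ f) : (ε ^ 2)⁻¹ * Real.log (1 / δ) ≤ f := by
  refine le_trans ?_ h.le
  have h1 := h.dim
  have h2 := h.inv_sq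
  have h3 := h.one_le_log
  have h4 : 0 ≤ (ε ^ 2)⁻¹ * Real.log (1 / δ) := mul_nonneg (by linarith) (by linarith)
  nlinarith

theorem log_le (h : TimeScale d ε δ f) : Real.log (1 / δ) ≤ f := by
  refine le_trans ?_ h.inv_sq_mul_log_le
  nlinarith [h.one_le_log, h.inv_sq]

theorem inv_sq_le (h : TimeScale d ε δ f) : (ε ^ 2)⁻¹ ≤ 2 * f := by
  refine le_trans ?_ (mul_le_mul_of_nonneg_left h.inv_sq_mul_log_le zero_le_two)
  nlinarith [h.one_le_log, h.inv_sq]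

theorem dim_le (h : TimeScale d ε δ f) : (d : ℝ) ≤ f := by
  refine le_trans ?_ h.le
  have h1 : 1 ≤ (ε ^ 2)⁻¹ * Real.log (1 / δ) := by nlinarith [h.one_le_log, h.inv_sq]
  nlinarith [h.dim]

theorem one_le (h : TimeScale d ε δ f) : 1 ≤ f := h.dim.trans h.dim_le

theorem one_le_log_two_add (h : TimeScale d ε δ f) : 1 ≤ Real.log (2 + f) := by
  refine (Real.le_log_iff_exp_le (by linarith [h.one_le])).2 ?_
  linarith [h.one_le, Real.exp_one_lt_d9]

theorem log_two_add_le (h : TimeScale d ε δ f) : Real.log (2 + f) ≤ 2 + f :=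
  Real.log_le_self (by linarith [h.one_le])

theorem log_le_log_two_add (_ : TimeScale d ε δ f) {x : ℝ} (hx : 0 < x) (hxf : x ≤ f) :
    Real.log x ≤ Real.log (2 + f) :=
  Real.log_le_log hx (by linarith)

/-- A sum of logarithms becomes a product because `log (2 + f)` is at least 1 and `log (1 / δ)` is
at least `log 2`. -/
theorem logParam_le (h : TimeScale d ε δ f) :
    logParam d δ ≤ 8 * (Real.log (2 + f) * Real.log (1 / δ)) := by
  have h1 : logParam d δ = 5 * Real.log 2 + Real.log d + Real.log (1 / δ) := by
    have hd := h.dim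
    have hδ := h.delta_pos
    rw [logParam, show (32 : ℝ) * d / δ = 2 ^ 5 * d * (1 / δ) by ring, Real.log_mul (by positivity)
      (by positivity), Real.log_mul (by positivity) (by positivity), Real.log_pow]
    push_cast
    ring
  have h2 := h.log_le_log_two_add (by linarith [h.dim]) h.dim_le
  have h3 := h.log_two_le
  have h4 := h.one_le_log
  have h5 := h.one_le_log_two_add
  nlinarith

/-- The general bound `two_pow_ceilLog_le` needs an argument of at least 1, which fails for `d = 1`;
there the exponent is 0. -/
theorem two_pow_ceilLog_half_le (h : TimeScale d ε δ f) :
    (2 : ℝ) ^ ceilLog ((d : ℝ) / 2) ≤ d := by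
  rcases hc : ceilLog ((d : ℝ) / 2) with _ | c
  · simpa using h.dim
  · have := two_pow_lt_of_lt_ceilLog (hc ▸ Nat.lt_succ_self c : c < ceilLog ((d : ℝ) / 2))
    rw [pow_succ]
    linarith

theorem stepCount_le (h : TimeScale d ε δ f) : (stepCount d : ℝ) + 1 ≤ 5 * Real.log (2 + f) := by
  have h1 := ceilLog_le (show (d : ℝ) / 2 ≤ d by linarith [h.dim]) h.dim
  have h2 := h.log_le_log_two_add (by linarith [h.dim]) h.dim_le
  have h3 := h.one_le_log_two_add
  rw [stepCount]
  push_cast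
  linarith

theorem sq_le (h : TimeScale d ε δ f) :
    (2 * (stepCount d + 1 : ℕ)) * (2 * (stepCount d + 1 : ℕ)) ≤ 100 * Real.log (2 + f) ^ 2 := by
  have h1 := h.stepCount_le
  have h2 : (0 : ℝ) ≤ stepCount d := Nat.cast_nonneg _
  push_cast
  nlinarith

theorem blockArg_le (h : TimeScale d ε δ f) :
    16777216 * ((2 * (stepCount d + 1 : ℕ)) * (2 * (stepCount d + 1 : ℕ)) * logParam d δ)
      / (ε * ε) ≤ 2 ^ 34 * (Real.log (2 + f) ^ 3 * ((ε ^ 2)⁻¹ * Real.log (1 / δ))) := by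
  have h1 := h.sq_le
  have h2 := h.logParam_le
  have h3 := h.one_le_log_two_add
  have h4 := h.inv_sq
  have h5 := h.one_le_log
  have h6 := logParam_pos h.one_le_dim h.delta_pos h.delta_lt
  have h7 : 0 ≤ Real.log (1 / δ) := by linarith
  calc _ = 16777216 * ((2 * (stepCount d + 1 : ℕ)) * (2 * (stepCount d + 1 : ℕ)) * logParam d δ)
        * (ε ^ 2)⁻¹ := by rw [div_eq_mul_inv, ← sq ε]
    _ ≤ 16777216 * ((100 * Real.log (2 + f) ^ 2) * (8 * (Real.log (2 + f) * Real.log (1 / δ))))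
        * (ε ^ 2)⁻¹ := by gcongr
    _ = 13421772800 * (Real.log (2 + f) ^ 3 * ((ε ^ 2)⁻¹ * Real.log (1 / δ))) := by ring
    _ ≤ _ := by
      have : 0 ≤ Real.log (2 + f) ^ 3 * ((ε ^ 2)⁻¹ * Real.log (1 / δ)) := by positivity
      linarith

theorem log_two_pow_mul_le (h : TimeScale d ε δ f) (j k : ℕ) :
    Real.log (2 ^ j * (2 + f) ^ k) ≤ (j + k : ℕ) * Real.log (2 + f) := by
  have h1 := h.one_le
  have h2 := h.one_le_log_two_add
  rw [Real.log_mul (by positivity) (by positivity), Real.log_pow, Real.log_pow]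
  have h3 : (j : ℝ) * Real.log 2 ≤ j * Real.log (2 + f) := by
    gcongr
    linarith
  push_cast
  linarith

theorem one_le_two_pow_mul (h : TimeScale d ε δ f) (j k : ℕ) :
    (1 : ℝ) ≤ 2 ^ j * (2 + f) ^ k :=
  one_le_mul_of_one_le_of_one_le (one_le_pow₀ (by norm_num))
    (one_le_pow₀ (by linarith [h.one_le]))

theorem blockExp_le (h : TimeScale d ε δ f) : (blockExp d ε δ : ℝ) ≤ 80 * Real.log (2 + f) := by
  have h1 := h.one_le
  have h2 := h.one_le_log_two_add
  -- Only the logarithm of this quantity is needed, so any bound polynomial in `2 + f` will do.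
  have h3 : 2 ^ 34 * (Real.log (2 + f) ^ 3 * ((ε ^ 2)⁻¹ * Real.log (1 / δ))) ≤
      2 ^ 34 * (2 + f) ^ 4 := by
    have h4 := h.inv_sq_mul_log_le
    rw [pow_succ (2 + f) 3]
    gcongr
    · nlinarith [h.inv_sq, h.one_le_log]
    · exact h.log_two_add_le
    · linarith
  have h4 := ceilLog_le (h.blockArg_le.trans h3) (h.one_le_two_pow_mul 34 4)
  have h5 := h.log_two_pow_mul_le 34 4
  rw [← blockExp] at h4
  push_cast at h5
  linarith

theorem two_pow_blockExp_le (h : TimeScale d ε δ f) : (2 : ℝ) ^ blockExp d ε δ ≤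
    2 ^ 35 * (Real.log (2 + f) ^ 3 * ((ε ^ 2)⁻¹ * Real.log (1 / δ))) := by
  have h0 := h.eps_pos
  have h1 : (1 : ℝ) ≤ 16777216 * ((2 * (stepCount d + 1 : ℕ)) * (2 * (stepCount d + 1 : ℕ)) *
      logParam d δ) / (ε * ε) := by
    have h6 := logParam_pos h.one_le_dim h.delta_pos h.delta_lt
    have h7 : (1 : ℝ) ≤ (2 * (stepCount d + 1 : ℕ)) * (2 * (stepCount d + 1 : ℕ)) := by
      have : (0 : ℝ) ≤ stepCount d := Nat.cast_nonneg _
      push_cast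
      nlinarith
    rw [le_div_iff₀ (by positivity)]
    nlinarith [h.eps_lt, h.eps_pos]
  have h2 := two_pow_ceilLog_le h1
  rw [← blockExp] at h2
  linarith [h.blockArg_le]

theorem size_le (h : TimeScale d ε δ f) : ((2 * halfSize d ε δ + 2 : ℕ) : ℝ) ≤
    2 ^ 37 * (Real.log (2 + f) ^ 3 * ((ε ^ 2)⁻¹ * d * Real.log (1 / δ))) := by
  have h1 := h.two_pow_blockExp_le
  have h2 := h.two_pow_ceilLog_half_le
  have h3 : (1 : ℝ) ≤ halfSize d ε δ := by exact_mod_cast halfSize_pos d ε δ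
  have h4 : (halfSize d ε δ : ℝ) ≤
      2 ^ 35 * (Real.log (2 + f) ^ 3 * ((ε ^ 2)⁻¹ * Real.log (1 / δ))) * d := by
    rw [halfSize]
    push_cast
    exact mul_le_mul h1 h2 (by positivity) (le_trans (by positivity) h1)
  push_cast
  linarith

theorem size_le' (h : TimeScale d ε δ f) :
    ((2 * halfSize d ε δ + 2 : ℕ) : ℝ) ≤ 2 ^ 37 * (Real.log (2 + f) ^ 3 * f) := by
  refine h.size_le.trans ?_
  have := h.one_le_log_two_add
  gcongr
  exact h.le

theorem threshSq_le (h : TimeScale d ε δ f) : threshSq d ε δ ≤ 800 * Real.log (2 + f) := by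
  have h1 := h.blockExp_le
  have h2 := h.one_le_log_two_add
  have h3 : Real.log 12 ≤ 11 := (Real.log_le_sub_one_of_pos (by norm_num)).trans (by norm_num)
  have h4 := Real.log_two_lt_d9
  have h5 : (0 : ℝ) ≤ blockExp d ε δ := Nat.cast_nonneg _
  rw [threshSq, Real.log_mul (by positivity) (by positivity), Real.log_pow]
  nlinarith

theorem groupArg_le (h : TimeScale d ε δ f) :
    16384 * ((2 * (stepCount d + 1 : ℕ)) * (2 * (stepCount d + 1 : ℕ)) * threshSq d ε δ)
      / (ε * ε) ≤ 2 ^ 31 * (Real.log (2 + f) ^ 3 * (ε ^ 2)⁻¹) := by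
  have h1 := h.sq_le
  have h2 := h.threshSq_le
  have h3 := h.one_le_log_two_add
  have h4 := h.inv_sq
  have h6 := eight_le_threshSq d ε δ
  calc _ = 16384 * ((2 * (stepCount d + 1 : ℕ)) * (2 * (stepCount d + 1 : ℕ)) * threshSq d ε δ)
        * (ε ^ 2)⁻¹ := by rw [div_eq_mul_inv, ← sq ε]
    _ ≤ 16384 * ((100 * Real.log (2 + f) ^ 2) * (800 * Real.log (2 + f)))
        * (ε ^ 2)⁻¹ := by gcongr
    _ = 1310720000 * (Real.log (2 + f) ^ 3 * (ε ^ 2)⁻¹) := by ring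
    _ ≤ _ := by
      gcongr
      norm_num

theorem groupExp_le (h : TimeScale d ε δ f) : (groupExp d ε δ : ℝ) ≤ 80 * Real.log (2 + f) := by
  have h1 := h.one_le
  have h2 := h.one_le_log_two_add
  have h3 : 2 ^ 31 * (Real.log (2 + f) ^ 3 * (ε ^ 2)⁻¹) ≤ 2 ^ 32 * (2 + f) ^ 4 := by
    have h4 : Real.log (2 + f) ^ 3 * (ε ^ 2)⁻¹ ≤ (2 + f) ^ 3 * (2 * (2 + f)) := by
      gcongr
      · exact h.log_two_add_le
      · exact h.inv_sq_le.trans (by linarith)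
    linarith
  have h4 := ceilLog_le (h.groupArg_le.trans h3) (h.one_le_two_pow_mul 32 4)
  have h5 := h.log_two_pow_mul_le 32 4
  rw [← groupExp] at h4
  push_cast at h5
  linarith

theorem two_pow_groupExp_le' (h : TimeScale d ε δ f) :
    (2 : ℝ) ^ groupExp d ε δ ≤ 2 ^ 33 * (Real.log (2 + f) ^ 3 * (ε ^ 2)⁻¹) := by
  have h0 := h.eps_pos
  have h1 := two_pow_groupExp_le (d := d) (δ := δ) h.eps_pos h.eps_lt
  rw [← le_div_iff₀ (by positivity)] at h1
  have h2 := h.groupArg_le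
  rw [← sq, ← sq] at h2
  push_cast at h2
  refine h1.trans (le_trans (le_of_eq ?_) (mul_le_mul_of_nonneg_left h2 zero_le_two) |>.trans ?_)
  · ring
  · have := h.one_le_log_two_add
    have : 0 ≤ Real.log (2 + f) ^ 3 * (ε ^ 2)⁻¹ := by positivity
    linarith

theorem groupCount_le (h : TimeScale d ε δ f) (hn : (n : ℝ) ≤ f) :
    (groupCount n δ : ℝ) ≤ 7 * (Real.log (2 + f) * Real.log (1 / δ)) := by
  have h1 := h.one_le
  have h2 := h.one_le_log_two_add
  have h3 := h.one_le_log
  have hδ := h.delta_pos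
  have h4 : (n : ℝ) / δ ≤ (2 + f) * (1 / δ) := by
    rw [div_eq_mul_one_div]
    gcongr
    linarith
  have h5 := ceilLog_le h4 (one_le_mul_of_one_le_of_one_le (by linarith) (by
    rw [le_div_iff₀ hδ]; linarith [h.delta_lt]))
  rw [Real.log_mul (by positivity) (by positivity), ← groupCount] at h5
  nlinarith

/-- The bisection must gain a factor `R * M / ε`, which is polynomial in `2 + f`; so logarithmically
many steps suffice. -/
theorem bisectCount_le (h : TimeScale d ε δ f) (hn : (n : ℝ) ≤ f) :
    (bisectCount n d ε δ : ℝ) ≤ 110 * Real.log (2 + f) := by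
  have h1 := h.one_le
  have h2 := h.one_le_log_two_add
  have h3 := h.one_le_log
  have h0 := h.eps_pos
  have hlog := h.log_two_add_le
  have hR : (groupCount n δ : ℝ) ≤ 2 ^ 3 * ((2 + f) * (2 + f)) := by
    refine (h.groupCount_le hn).trans ?_
    have : Real.log (2 + f) * Real.log (1 / δ) ≤ (2 + f) * (2 + f) :=
      mul_le_mul hlog (h.log_le.trans (by linarith)) (by linarith) (by linarith)
    have : 0 ≤ (2 + f) * (2 + f) := by positivity
    linarith
  have hM : ((2 * halfSize d ε δ : ℕ) : ℝ) ≤ 2 ^ 37 * ((2 + f) ^ 3 * (2 + f)) := by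
    have h4 : 2 ^ 37 * (Real.log (2 + f) ^ 3 * f) ≤ 2 ^ 37 * ((2 + f) ^ 3 * (2 + f)) := by
      gcongr
      linarith
    have h5 := h.size_le'
    push_cast at h5 ⊢
    linarith
  have hε : ε⁻¹ ≤ 2 * (2 + f) := by
    have h4 : ε⁻¹ ≤ (ε ^ 2)⁻¹ := by
      gcongr
      nlinarith [h.eps_lt]
    linarith [h.inv_sq_le]
  have h4 : 4 * ((groupCount n δ : ℝ) * (2 * halfSize d ε δ : ℕ)) / ε ≤ 2 ^ 43 * (2 + f) ^ 7 := by
    calc _ = 4 * ((groupCount n δ : ℝ) * (2 * halfSize d ε δ : ℕ)) * ε⁻¹ := div_eq_mul_inv _ _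
      _ ≤ 4 * ((2 ^ 3 * ((2 + f) * (2 + f))) * (2 ^ 37 * ((2 + f) ^ 3 * (2 + f)))) *
          (2 * (2 + f)) := by gcongr
      _ = _ := by ring
  have h5 := ceilLog_le h4 (h.one_le_two_pow_mul 43 7)
  have h6 := h.log_two_pow_mul_le 43 7
  rw [← bisectCount] at h5
  push_cast at h6
  linarith

theorem log_pow_le (h : TimeScale d ε δ f) {j : ℕ} (hj : j ≤ 4) :
    Real.log (2 + f) ^ j ≤ Real.log (2 + f) ^ 4 :=
  pow_le_pow_right₀ h.one_le_log_two_add hj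

theorem embedTime_le (h : TimeScale d ε δ f) :
    (((stepCount d + 2) * (2 * halfSize d ε δ + 2) * 100 + (2 * halfSize d ε δ + 2) * 32 : ℕ) : ℝ) ≤
      2 ^ 47 * (f * Real.log (2 + f) ^ 4) := by
  have h1 := h.stepCount_le
  have h2 := h.one_le_log_two_add
  have h3 := h.size_le'
  have h4 := h.one_le
  rw [show (stepCount d + 2) * (2 * halfSize d ε δ + 2) * 100 +
    (2 * halfSize d ε δ + 2) * 32 = ((stepCount d + 2) * 100 + 32) * (2 * halfSize d ε δ + 2) by ring,
    Nat.cast_mul]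
  calc _ ≤ (1000 * Real.log (2 + f)) * (2 ^ 37 * (Real.log (2 + f) ^ 3 * f)) := by
        refine mul_le_mul ?_ h3 (by positivity) (by positivity)
        push_cast
        linarith
    _ = (1000 * 2 ^ 37) * (f * Real.log (2 + f) ^ 4) := by ring
    _ ≤ _ := by
      gcongr
      norm_num

theorem createTime_le (h : TimeScale d ε δ f) :
    (((stepCount d + 1) * 40 + ((blockExp d ε δ + 1) * 100 + ((stepCount d + 1) * 40 +
      ((groupExp d ε δ + 1) * 100 + (2 * halfSize d ε δ + 1) * 20))) : ℕ) : ℝ) ≤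
      2 ^ 47 * (f * Real.log (2 + f) ^ 4) := by
  have h1 := h.stepCount_le
  have h2 := h.one_le_log_two_add
  have h3 := h.size_le'
  have h4 := h.one_le
  have h5 := h.blockExp_le
  have h6 := h.groupExp_le
  have h7 : Real.log (2 + f) ≤ f * Real.log (2 + f) ^ 4 := by
    have := h.log_pow_le (j := 1) (by norm_num)
    rw [pow_one] at this
    nlinarith
  have h8 : Real.log (2 + f) ^ 3 * f ≤ f * Real.log (2 + f) ^ 4 := by
    rw [mul_comm]
    gcongr
    norm_num
  push_cast at h3 ⊢
  linarith

/-- Here `f` is the query bound itself, which dominates `n` as well as the bound for embedding the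
query. Each point costs about `R * (G + K)`, that is, `log (2 + f) * log (1 / δ)` times `log (2 + f)
^ 3 * ε⁻²`. -/
theorem queryTime_le (h : TimeScale d ε δ ((ε ^ 2)⁻¹ * ((n : ℝ) + d) * Real.log (1 / δ))) :
    (((stepCount d + 2) * (2 * halfSize d ε δ + 2) * 100 +
      ((groupCount n δ + 1) * 60 + (bisectCount n d ε δ + 1) * 60 +
      (n + 1) * ((groupCount n δ + 3) *
        (2 ^ groupExp d ε δ + bisectCount n d ε δ + 4) * 80)) : ℕ) : ℝ) ≤
      2 ^ 49 * (((ε ^ 2)⁻¹ * ((n : ℝ) + d) * Real.log (1 / δ)) *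
        Real.log (2 + (ε ^ 2)⁻¹ * ((n : ℝ) + d) * Real.log (1 / δ)) ^ 4) := by
  set f := (ε ^ 2)⁻¹ * ((n : ℝ) + d) * Real.log (1 / δ) with hf
  have hE := h.inv_sq
  have hl := h.one_le_log
  have hd := h.dim
  have h2 := h.one_le_log_two_add
  have h4 := h.one_le
  have hn : (n : ℝ) ≤ f := by
    have h1 : 1 ≤ (ε ^ 2)⁻¹ * Real.log (1 / δ) := by nlinarith
    have h3 : (0 : ℝ) ≤ n := Nat.cast_nonneg _
    calc (n : ℝ) ≤ (n + d) * ((ε ^ 2)⁻¹ * Real.log (1 / δ)) := by nlinarith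
      _ = f := by ring
  have hemb := h.embedTime_le
  have hR := h.groupCount_le hn
  have hK := h.bisectCount_le hn
  have hG := h.two_pow_groupExp_le'
  have h7 : Real.log (2 + f) ≤ f * Real.log (2 + f) ^ 4 := by
    have := h.log_pow_le (j := 1) (by norm_num)
    rw [pow_one] at this
    nlinarith
  have h8 : Real.log (2 + f) * Real.log (1 / δ) ≤ f * Real.log (2 + f) ^ 4 := by
    have := h.log_pow_le (j := 1) (by norm_num)
    rw [pow_one] at this
    rw [mul_comm]
    exact mul_le_mul h.log_le this (by linarith) (by linarith)
  have hR3 : ((groupCount n δ + 3 : ℕ) : ℝ) ≤ 12 * (Real.log (2 + f) * Real.log (1 / δ)) := by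
    push_cast
    nlinarith
  have hGK : ((2 ^ groupExp d ε δ + bisectCount n d ε δ + 4 : ℕ) : ℝ) ≤
      2 ^ 34 * (Real.log (2 + f) ^ 3 * (ε ^ 2)⁻¹) := by
    have h9 : Real.log (2 + f) ≤ Real.log (2 + f) ^ 3 * (ε ^ 2)⁻¹ := by
      have h10 : Real.log (2 + f) ≤ Real.log (2 + f) ^ 3 := le_self_pow₀ h2 (by norm_num)
      nlinarith
    push_cast
    linarith
  have hpts : (((n + 1) * ((groupCount n δ + 3) *
      (2 ^ groupExp d ε δ + bisectCount n d ε δ + 4) * 80) : ℕ) : ℝ) ≤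
      2 ^ 44 * (f * Real.log (2 + f) ^ 4) := by
    rw [Nat.cast_mul, Nat.cast_mul, Nat.cast_mul]
    -- `n + 1 ≤ n + d`, as `d ≥ 1`; this absorbs the overhead of an empty database.
    calc _ ≤ ((n : ℝ) + d) * ((12 * (Real.log (2 + f) * Real.log (1 / δ))) *
          (2 ^ 34 * (Real.log (2 + f) ^ 3 * (ε ^ 2)⁻¹)) * 80) := by
          push_cast at hR3 hGK ⊢
          have : 0 ≤ Real.log (1 / δ) := by linarith
          gcongr
      _ = (960 * 2 ^ 34) * (f * Real.log (2 + f) ^ 4) := by rw [hf]; ring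
      _ ≤ _ := by
        gcongr
        norm_num
  push_cast at hemb hpts ⊢
  have hpos : (0 : ℝ) ≤ halfSize d ε δ := Nat.cast_nonneg _
  linarith

end TimeScale

/-! ### Construction time and the main theorem. -/

/-- The creation and each insertion obey the same bound, hence the factor `X.length + 1`. The seeds
are arbitrary, since the running time does not depend on their quality. -/
theorem ready_and_time_of_constructs {d : ℕ} {ε δ f : ℝ} (h : TimeScale d ε δ f) {M : Mem}
    {X : List (EuclideanSpace ℝ (Fin d))} {t : ℕ} (hc : distanceDS.Constructs d ε δ M X t) :
    (∃ g, M.Ready d ε δ g X) ∧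
      (t : ℝ) ≤ (X.length + 1) * (2 ^ 47 * (f * Real.log (2 + f) ^ 4)) := by
  induction hc with
  | create ω hr =>
    obtain ⟨h1, s, h2⟩ := createProg_wp.of_run hr
    refine ⟨⟨_, h2⟩, (Nat.cast_le.2 h1).trans (h.createTime_le.trans ?_)⟩
    simp
  | insert x ω _ hr ih =>
    obtain ⟨⟨g, hg⟩, ht⟩ := ih
    obtain ⟨h1, s, h2⟩ := (insertProg_wp hg x).of_run hr
    refine ⟨⟨g, h2⟩, ?_⟩
    have h3 := (Nat.cast_le (α := ℝ).2 h1).trans h.embedTime_le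
    rw [List.length_append, List.length_singleton]
    push_cast
    linarith

theorem softO_mono {C C' : ℝ} {f : ℝ} {t : ℝ} (hf : 0 ≤ f) (c : ℕ)
    (ht : t ≤ C * (f * Real.log (2 + f) ^ c)) (hC : C ≤ C') : t ≤ softO C' c f := by
  have : 0 ≤ Real.log (2 + f) := Real.log_nonneg (by linarith)
  refine ht.trans ?_
  rw [softO, mul_assoc]
  gcongr

theorem theorem3 :
    ∃ (A : DistanceDS) (C : ℝ) (c : ℕ), ∀ (d : ℕ) (ε δ : ℝ), 1 ≤ d →
      0 < ε → ε < 1 / 2 → 0 < δ → δ < 1 / 2 →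
      -- with probability at least `1 - δ` over its creation, the data structure is such that in
      -- every state reached later, every query is answered correctly with probability at least
      -- `1 - δ` over the random draws made while answering it
      tapeLaw {ω | ¬ ∀ M X, A.Reachable d ε δ ω M X → ∀ q : EuclideanSpace ℝ (Fin d),
          tapeLaw {ω' | ¬ ∃ M' t, A.query.Run ω' (M.load q) M' t ∧ M'.Answers ε X q}
            ≤ ENNReal.ofReal δ}
        ≤ ENNReal.ofReal δ ∧
      -- query time and update time
      (∀ ω M X, A.Reachable d ε δ ω M X → ∀ (x : EuclideanSpace ℝ (Fin d)) (ω' : Tape),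
        (∃ M' t, A.query.Run ω' (M.load x) M' t ∧
          (t : ℝ) ≤ softO C c ((ε ^ 2)⁻¹ * ((X.length : ℝ) + d) * Real.log (1 / δ))) ∧
        (∃ M' t, A.insert.Run ω' (M.load x) M' t ∧
          (t : ℝ) ≤ softO C c ((ε ^ 2)⁻¹ * d * Real.log (1 / δ)))) ∧
      -- construction time; creation halts for every outcome of the random draws
      (∀ ω, ∃ M t, A.create.Run ω (inputMem d ε δ) M t) ∧
      (∀ M X t, A.Constructs d ε δ M X t →
        (t : ℝ) ≤ softO C c ((ε ^ 2)⁻¹ * (max (X.length : ℝ) 1 * d) * Real.log (1 / δ))) := by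
  refine ⟨distanceDS, 2 ^ 50, 4, fun d ε δ hd hε0 hε hδ0 hδ =>
    ⟨measure_not_correct_le hd hε0 hε hδ0 hδ, fun ω M X hM x ω' => ⟨?_, ?_⟩, fun ω => ?_,
      fun M X t hc => ?_⟩⟩
  · obtain ⟨M', s, t, hrun, ht, -⟩ := queryProg_wp (ω := ω') (s := 0) (ready_of_reachable hM) x
    have hlog : 0 ≤ Real.log (1 / δ) := Real.log_nonneg (by rw [le_div_iff₀ hδ0]; linarith)
    have h : TimeScale d ε δ ((ε ^ 2)⁻¹ * ((X.length : ℝ) + d) * Real.log (1 / δ)) :=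
      ⟨hd, hε0, hε, hδ0, hδ, by gcongr; simp⟩
    exact ⟨M', t, ⟨s, hrun⟩, softO_mono (by positivity) 4
      ((Nat.cast_le.2 ht).trans h.queryTime_le) (by norm_num)⟩
  · obtain ⟨M', s, t, hrun, ht, -⟩ := insertProg_wp (ω := ω') (s := 0) (ready_of_reachable hM) x
    have h : TimeScale d ε δ ((ε ^ 2)⁻¹ * d * Real.log (1 / δ)) := ⟨hd, hε0, hε, hδ0, hδ, le_rfl⟩
    exact ⟨M', t, ⟨s, hrun⟩, softO_mono (zero_le_one.trans h.one_le) 4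
      ((Nat.cast_le.2 ht).trans h.embedTime_le) (by norm_num)⟩
  · obtain ⟨M', s, t, hrun, -, -⟩ := createProg_wp (ω := ω) (d := d) (ε := ε) (δ := δ)
    exact ⟨M', t, s, hrun⟩
  · set F := (ε ^ 2)⁻¹ * d * Real.log (1 / δ) with hF
    have h : TimeScale d ε δ F := ⟨hd, hε0, hε, hδ0, hδ, le_rfl⟩
    have ht := (ready_and_time_of_constructs h hc).2
    have hf : (ε ^ 2)⁻¹ * (max (X.length : ℝ) 1 * d) * Real.log (1 / δ) =
        max (X.length : ℝ) 1 * F := by rw [hF]; ring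
    rw [hf]
    have h1 := h.one_le
    have hmax : (1 : ℝ) ≤ max (X.length : ℝ) 1 := le_max_right _ _
    -- The construction bound has the larger argument `max n 1 * F` inside its logarithm.
    have hlog : Real.log (2 + F) ^ 4 ≤ Real.log (2 + max (X.length : ℝ) 1 * F) ^ 4 := by
      have := h.one_le_log_two_add
      gcongr
      nlinarith
    refine softO_mono (C := 2 ^ 48) (by positivity) 4 (ht.trans ?_) (by norm_num)
    have hle : ((X.length : ℝ) + 1) ≤ 2 * max (X.length : ℝ) 1 := by
      linarith [le_max_left (X.length : ℝ) 1]
    calc _ ≤ (2 * max (X.length : ℝ) 1) *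
          (2 ^ 47 * (F * Real.log (2 + max (X.length : ℝ) 1 * F) ^ 4)) := by gcongr
      _ = _ := by ring
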